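/- Let $|1\rangle,\dots,|6\rangle$ be the standard orthonormal basis of $V=\mathbb C^6$, put $e_{ijk}=|i\rangle\wedge|j\rangle\wedge|k\rangle$, and equip $\wedge^3(V)$ with the Hermitian inner product for which the $e_{ijk}$, $i<j<k$, are orthonormal. Two states $\varphi,\psi\in\wedge^3(V)$ are LU-equivalent if $\psi=(\wedge^3U)\varphi$ for some $U\in\mathrm U(6)$. For $\psi\in\wedge^3(V)$ let $\mu(\psi)$ be the maximum of $|\langle\alpha\wedge\beta\wedge\gamma|\psi\rangle|$ over all decomposable three-vectors $\alpha\wedge\beta\wedge\gamma$ of unit norm. For $p=(a,b,c,d,z)\in\mathbb R^4\times\mathbb C$, $z=x+iy$ with $x,y$ real, put $$\psi_p=a\,e_{235}+b\,e_{145}+c\,e_{136}+d\,e_{246}+z\,e_{135},$$ $$\Phi(p)=d^2(d^2-s_1)(d^2-s_1-|z|^2)-2abcd(x^2-y^2)-4a^2b^2c^2,\qquad s_1=a^2+b^2+c^2.$$ Let $\Sigma$ be the unit sphere $a^2+b^2+c^2+d^2+|z|^2=1$ in $\mathbb R^4\times\mathbb C$, let $\Delta$ be the set of all $p\in\Sigma$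 with $a\ge b\ge c\ge0$, $x\ge0$ and $d=\mu(\psi_p)$, and let $\Delta^0$ be the interior of $\Delta$ relative to $\Sigma$. Theorem. Let $\varphi\in\wedge^3(V)$ be a normalized state. Then $\varphi$ is LU-equivalent to $\psi_p$ for some $p\in\Delta$. Moreover, for every $p=(a,b,c,d,x+iy)\in\Delta$ such that $\varphi$ is LU-equivalent to $\psi_p$: (1) if $cx\Phi(p)>0$, then $p$ is the only point of $\Delta$ whose state is LU-equivalent to $\varphi$; (2) otherwise $cx\Phi(p)=0$, and there is exactly one point $q=(\tilde a,\tilde b,\tilde c,\tilde d,\tilde x+i\tilde y)\in\Delta$ such that $\varphi$ is LU-equivalent to $\psi_q$, $\tilde y\ge0$, and $\tilde y=0$ if $\tilde c=0$. Finally, $cx\Phi(p)>0$ for every $p\in\Delta^0$, so that (1) applies to all points of $\Delta^0$. -/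

import Mathlib

open scoped Topology ComplexConjugate

noncomputable section

namespace ThreeFermion

/-- The single-particle space `ℂ⁶` with its standard Hermitian inner product. -/
abbrev V : Type := EuclideanSpace ℂ (Fin 6)

/-- The three-fermion space `∧³(ℂ⁶)`. -/
abbrev W3 : Type := ⋀[ℂ]^3 V

/-- The standard orthonormal basis `|1⟩, …, |6⟩` of `ℂ⁶`; indices are shifted by one,
so `ket 0, …, ket 5` are `|1⟩, …, |6⟩`. -/
def ket (i : Fin 6) : V := EuclideanSpace.basisFun (Fin 6) ℂ i

/-- The decomposable three-vector `α ∧ β ∧ γ`. -/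
def wedge (α β γ : V) : W3 := exteriorPower.ιMulti ℂ 3 ![α, β, γ]

/-- `e i j k = |i+1⟩ ∧ |j+1⟩ ∧ |k+1⟩`. -/
def e (i j k : Fin 6) : W3 := wedge (ket i) (ket j) (ket k)

/-- The Hermitian inner product `⟨φ|ψ⟩` on `∧³(ℂ⁶)`, conjugate-linear in `φ`, for which the
twenty vectors `e i j k`, `i < j < k`, are orthonormal. -/
def braket (φ ψ : W3) : ℂ :=
  ∑ s : Set.powersetCard (Fin 6) 3,
    conj (((EuclideanSpace.basisFun (Fin 6) ℂ).toBasis.exteriorPower 3).repr φ s) *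
      ((EuclideanSpace.basisFun (Fin 6) ℂ).toBasis.exteriorPower 3).repr ψ s

/-- `ψ` is normalized: `⟨ψ|ψ⟩ = 1`. -/
def Normalized (ψ : W3) : Prop := braket ψ ψ = 1

/-- LU-equivalence: `ψ = (∧³ U) φ` for some unitary `U ∈ U(6)`. -/
def LUEquiv (φ ψ : W3) : Prop :=
  ∃ U : V ≃ₗᵢ[ℂ] V, ψ = exteriorPower.map 3 U.toLinearEquiv.toLinearMap φ

/-- `m = μ(ψ)`: the number `m` is the maximum of `|⟨α ∧ β ∧ γ|ψ⟩|` over all decomposable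
three-vectors `α ∧ β ∧ γ` of unit norm. -/
def IsMu (ψ : W3) (m : ℝ) : Prop :=
  IsGreatest {r : ℝ | ∃ α β γ : V, Normalized (wedge α β γ) ∧ r = ‖braket (wedge α β γ) ψ‖} m

/-- The parameter space `ℝ⁴ × ℂ` of points `(a, b, c, d, z)`, with its usual topology. -/
abbrev Point : Type := ℝ × ℝ × ℝ × ℝ × ℂ

namespace Point

abbrev a (p : Point) : ℝ := p.1
abbrev b (p : Point) : ℝ := p.2.1
abbrev c (p : Point) : ℝ := p.2.2.1
abbrev d (p : Point) : ℝ := p.2.2.2.1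
abbrev z (p : Point) : ℂ := p.2.2.2.2
abbrev x (p : Point) : ℝ := p.z.re
abbrev y (p : Point) : ℝ := p.z.im

/-- The three-vector `a e₂₃₅ + b e₁₄₅ + c e₁₃₆ + d e₂₄₆ + z e₁₃₅`. -/
def state (p : Point) : W3 :=
  (p.a : ℂ) • e 1 2 4 + (p.b : ℂ) • e 0 3 4 + (p.c : ℂ) • e 0 2 5 + (p.d : ℂ) • e 1 3 5 +
    p.z • e 0 2 4

/-- `Φ = d²(d² - s₁)(d² - s₁ - |z|²) - 2abcd(x² - y²) - 4s₃` with `s₁ = a² + b² + c²` and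
`s₃ = a²b²c²`. -/
def Phi (p : Point) : ℝ :=
  p.d ^ 2 * (p.d ^ 2 - (p.a ^ 2 + p.b ^ 2 + p.c ^ 2)) *
      (p.d ^ 2 - (p.a ^ 2 + p.b ^ 2 + p.c ^ 2) - ‖p.z‖ ^ 2) -
    2 * p.a * p.b * p.c * p.d * (p.x ^ 2 - p.y ^ 2) - 4 * (p.a ^ 2 * p.b ^ 2 * p.c ^ 2)

end Point

/-- The unit sphere `a² + b² + c² + d² + |z|² = 1` of the parameter space. -/
def sphere : Set Point :=
  {p | p.a ^ 2 + p.b ^ 2 + p.c ^ 2 + p.d ^ 2 + ‖p.z‖ ^ 2 = 1}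

/-- The canonical region `Δ`. -/
def Delta : Set Point :=
  {p | p ∈ sphere ∧ p.a ≥ p.b ∧ p.b ≥ p.c ∧ p.c ≥ 0 ∧ p.x ≥ 0 ∧ IsMu p.state p.d}

/-- The interior `Δ⁰` of `Δ` relative to the unit sphere. -/
def DeltaInterior : Set Point := {p | p ∈ Delta ∧ Delta ∈ 𝓝[sphere] p}

end ThreeFermion

end

open scoped Topology ComplexConjugate

noncomputable section

namespace ThreeFermion

/-! ### The Hermitian product on three-vectors and the alternating form of a state -/

open Module

/-! A state `φ` is replaced by the alternating form `τ = form φ`. LU-equivalence to a canonical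
state then means that `τ` has prescribed values in an orthonormal frame made of two triples `(f, g)`
(`lUEquiv_iff`), and `μ` is the maximum of `|τ|` over orthonormal triples (`isMu_iff`).

Existence (`exists_canon`): let `f` maximize `|τ f|`. Stationarity kills all values at two vectors
of `f` and one of `g`. The remaining freedom `U(3) × U(3)` brings the block of values at one vector
of `f` and two of `g` to diagonal form, as in a singular value decomposition. Phases make `a, b, c,
d` nonnegative, and a leftover sign gives `x ≥ 0`.

Uniqueness (`Canon.uniqueness`): the span of `f` already determines `a, b, c, |z|` and, when `c ≠
0`, also `z²` (`transition_invariants`). Any further ambiguity comes from a second maximizing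
subspace. In principal vectors that subspace is obtained by turning each `f i` towards `g i`, with
cosine `c i` and sine `s i`. Stationarity at the turned triple expresses the block and `τ g` through
these numbers and the two values of `τ` (`turn_block`, `turn_right`). If some but not all sines
vanish, then `b = c = 0` (`turn_degenerate`). If none vanishes, the two sets of coordinates are
complex conjugate (`turn_conj`) and a polynomial identity yields `Φ = 0` (`phi_turn_eq_zero`).

Conversely, the bound `|τ| ≤ d` is tested on triples in the planes of `f i` and `g i`. Contraction
by `f 0 + u • g 0` gives a positive semidefinite Hermitian `2 × 2` matrix. For `u = t (X + iY)` its
determinant is `t²` times a quadratic polynomial in `t`, and the sign of the discriminant says that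
a binary quadratic form in `(X, Y)` is positive semidefinite. The determinant of that form is a
multiple of `Φ`, whence `Φ ≥ 0` (`Admissible.phi_nonneg`). If `Φ = 0` and `c, x > 0`, a null vector
yields a second maximizing triple, and with it a frame in which `z` is conjugated
(`Canon.exists_conj`). Together with `z ↦ -z`, and with arbitrary phases of `z` when `c = 0`, this
gives the normalized representative of case (2). In the interior `Φ = 0` is impossible, because `Φ`
strictly decreases as `x` grows. -/

/-- The standard basis `e i j k`, `i < j < k`, of the three-fermion space. -/
def stdBasis : Basis (Set.powersetCard (Fin 6) 3) ℂ W3 :=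
  (EuclideanSpace.basisFun (Fin 6) ℂ).toBasis.exteriorPower 3

theorem braket_eq (φ ψ : W3) :
    braket φ ψ = ∑ s, conj (stdBasis.repr φ s) * stdBasis.repr ψ s := rfl

theorem braket_add_right (φ ψ χ : W3) : braket φ (ψ + χ) = braket φ ψ + braket φ χ := by
  simp only [braket_eq, map_add, Finsupp.add_apply, mul_add, Finset.sum_add_distrib]

theorem braket_smul_right (r : ℂ) (φ ψ : W3) : braket φ (r • ψ) = r * braket φ ψ := by
  simp only [braket_eq, map_smul, Finsupp.smul_apply, Finset.mul_sum, smul_eq_mul]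
  exact Finset.sum_congr rfl fun s _ => mul_left_comm _ _ _

theorem conj_braket (φ ψ : W3) : conj (braket φ ψ) = braket ψ φ := by
  simp only [braket_eq, map_sum, map_mul, Complex.conj_conj]
  exact Finset.sum_congr rfl fun s _ => mul_comm _ _

theorem braket_add_left (φ ψ χ : W3) : braket (φ + ψ) χ = braket φ χ + braket ψ χ := by
  rw [← conj_braket, braket_add_right, map_add, conj_braket, conj_braket]

theorem braket_smul_left (r : ℂ) (φ χ : W3) : braket (r • φ) χ = conj r * braket φ χ := by
  rw [← conj_braket, braket_smul_right, map_mul, conj_braket]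

/-- The functional `ψ ↦ ⟨φ|ψ⟩`. -/
def braketLin (φ : W3) : W3 →ₗ[ℂ] ℂ where
  toFun ψ := braket φ ψ
  map_add' ψ χ := braket_add_right φ ψ χ
  map_smul' r ψ := braket_smul_right r φ ψ

theorem braket_basis (φ : W3) (s : Set.powersetCard (Fin 6) 3) :
    braket φ (stdBasis s) = conj (stdBasis.repr φ s) := by
  classical
  rw [braket_eq, Finset.sum_eq_single s]
  · rw [Basis.repr_self, Finsupp.single_eq_same, mul_one]
  · intro t _ hts
    rw [Basis.repr_self, Finsupp.single_eq_of_ne hts, mul_zero]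
  · exact fun h => absurd (Finset.mem_univ s) h

/-- The Gram determinant formula for decomposable three-vectors. -/
theorem braket_ιMulti (x y : Fin 3 → V) :
    braket (exteriorPower.ιMulti ℂ 3 x) (exteriorPower.ιMulti ℂ 3 y) =
      (Matrix.of fun i j => inner ℂ (x j) (y i)).det := by
  have key : braketLin (exteriorPower.ιMulti ℂ 3 x) =
      exteriorPower.pairingDual ℂ V 3
        (exteriorPower.ιMulti ℂ 3 fun j => (innerSL ℂ (x j)).toLinearMap) := by
    refine stdBasis.ext fun s => ?_
    change braket _ _ = _
    rw [braket_basis, stdBasis, exteriorPower.basis_repr_apply, exteriorPower.ιMultiDual_apply_ιMulti,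
      exteriorPower.basis_apply, exteriorPower.ιMulti_family,
      exteriorPower.pairingDual_ιMulti_ιMulti, RingHom.map_det, ← Matrix.det_transpose]
    congr 1
    ext i j
    simp [EuclideanSpace.inner_single_right]
  have := LinearMap.congr_fun key (exteriorPower.ιMulti ℂ 3 y)
  rw [exteriorPower.pairingDual_ιMulti_ιMulti] at this
  exact this

/-- The alternating form `(α, β, γ) ↦ ⟨φ|α ∧ β ∧ γ⟩`. -/
def form (φ : W3) : V [⋀^Fin 3]→ₗ[ℂ] ℂ :=
  (braketLin φ).compAlternatingMap (exteriorPower.ιMulti ℂ 3)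

theorem form_apply (φ : W3) (h : Fin 3 → V) :
    form φ h = braket φ (exteriorPower.ιMulti ℂ 3 h) := rfl

theorem form_add (φ ψ : W3) : form (φ + ψ) = form φ + form ψ := by
  ext h; simp [form_apply, braket_add_left]

theorem form_smul (r : ℂ) (φ : W3) : form (r • φ) = conj r • form φ := by
  ext h; simp [form_apply, braket_smul_left]

theorem form_injective : Function.Injective form := by
  intro φ ψ h
  refine stdBasis.ext_elem fun s => ?_
  apply (starRingEnd ℂ).injective
  rw [← braket_basis, ← braket_basis, stdBasis, exteriorPower.basis_apply, exteriorPower.ιMulti_family,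
    ← form_apply, ← form_apply, h]

/-- `∧³U` preserves the inner product. -/
theorem braket_map (U : V ≃ₗᵢ[ℂ] V) (φ ψ : W3) :
    braket (exteriorPower.map 3 U.toLinearEquiv.toLinearMap φ)
      (exteriorPower.map 3 U.toLinearEquiv.toLinearMap ψ) = braket φ ψ := by
  have h1 : ∀ (x : Fin 3 → V) (ψ : W3),
      braket (exteriorPower.map 3 U.toLinearEquiv.toLinearMap (exteriorPower.ιMulti ℂ 3 x))
      (exteriorPower.map 3 U.toLinearEquiv.toLinearMap ψ) =
      braket (exteriorPower.ιMulti ℂ 3 x) ψ := by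
    intro x ψ
    have : (braketLin (exteriorPower.map 3 U.toLinearEquiv.toLinearMap
        (exteriorPower.ιMulti ℂ 3 x))) ∘ₗ exteriorPower.map 3 U.toLinearEquiv.toLinearMap =
        braketLin (exteriorPower.ιMulti ℂ 3 x) := by
      apply exteriorPower.linearMap_ext
      ext y
      change braket _ (exteriorPower.map 3 _ (exteriorPower.ιMulti ℂ 3 y)) =
        braket _ (exteriorPower.ιMulti ℂ 3 y)
      rw [exteriorPower.map_apply_ιMulti, exteriorPower.map_apply_ιMulti, braket_ιMulti,
        braket_ιMulti]
      congr 1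
      ext i j
      simp
    exact LinearMap.congr_fun this ψ
  have h2 : ∀ (x : Fin 3 → V) (φ : W3),
      braket φ (exteriorPower.ιMulti ℂ 3 x) =
      braket (exteriorPower.map 3 U.toLinearEquiv.toLinearMap φ)
      (exteriorPower.map 3 U.toLinearEquiv.toLinearMap (exteriorPower.ιMulti ℂ 3 x)) := by
    intro x φ
    rw [← conj_braket, ← h1 x φ, conj_braket]
  have : (braketLin (exteriorPower.map 3 U.toLinearEquiv.toLinearMap φ)) ∘ₗ
      exteriorPower.map 3 U.toLinearEquiv.toLinearMap = braketLin φ := by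
    apply exteriorPower.linearMap_ext
    ext y
    exact (h2 y φ).symm
  exact LinearMap.congr_fun this ψ

theorem form_map (U : V ≃ₗᵢ[ℂ] V) (φ : W3) (h : Fin 3 → V) :
    form (exteriorPower.map 3 U.toLinearEquiv.toLinearMap φ) (U ∘ h) = form φ h := by
  rw [form_apply, form_apply, ← braket_map U φ, exteriorPower.map_apply_ιMulti]
  rfl

theorem inner_ket (i j : Fin 6) : inner ℂ (ket i) (ket j) = if i = j then 1 else 0 :=
  (orthonormal_iff_ite.1 (EuclideanSpace.basisFun (Fin 6) ℂ).orthonormal) i j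

theorem form_e (i j k l m n : Fin 6) :
    form (e i j k) ![ket l, ket m, ket n] =
      (Matrix.of fun r s => if ![i, j, k] s = ![l, m, n] r then (1 : ℂ) else 0).det := by
  rw [form_apply, e, wedge, braket_ιMulti]
  congr 1
  ext r s
  have h1 : ![ket i, ket j, ket k] s = ket (![i, j, k] s) := by fin_cases s <;> rfl
  have h2 : ![ket l, ket m, ket n] r = ket (![l, m, n] r) := by fin_cases r <;> rfl
  rw [Matrix.of_apply, Matrix.of_apply, h1, h2, inner_ket]

theorem update_vec_zero {E : Type*} (u v w x : E) :
    Function.update ![u, v, w] 0 x = ![x, v, w] := by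
  ext i; fin_cases i <;> simp

theorem update_vec_one {E : Type*} (u v w x : E) :
    Function.update ![u, v, w] 1 x = ![u, x, w] := by
  ext i; fin_cases i <;> simp

theorem update_vec_two {E : Type*} (u v w x : E) :
    Function.update ![u, v, w] 2 x = ![u, v, x] := by
  ext i; fin_cases i <;> simp

/-! ### Alternating trilinear forms and orthonormal frames -/

section Trilinear

variable {E : Type*} [NormedAddCommGroup E] [InnerProductSpace ℂ E]

/-- The value of an alternating form of degree three at three vectors. -/
def tri (τ : E [⋀^Fin 3]→ₗ[ℂ] ℂ) (u v w : E) : ℂ := τ ![u, v, w]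

variable (τ : E [⋀^Fin 3]→ₗ[ℂ] ℂ)

theorem tri_add_left (u u' v w : E) :
    tri τ (u + u') v w = tri τ u v w + tri τ u' v w := by
  have := τ.map_update_add ![u, v, w] 0 u u'
  simp only [update_vec_zero] at this
  exact this

theorem tri_smul_left (r : ℂ) (u v w : E) : tri τ (r • u) v w = r * tri τ u v w := by
  have := τ.map_update_smul ![u, v, w] 0 r u
  simp only [update_vec_zero] at this
  exact this

theorem tri_add_mid (u v v' w : E) :
    tri τ u (v + v') w = tri τ u v w + tri τ u v' w := by
  have := τ.map_update_add ![u, v, w] 1 v v'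
  simp only [update_vec_one] at this
  exact this

theorem tri_smul_mid (r : ℂ) (u v w : E) : tri τ u (r • v) w = r * tri τ u v w := by
  have := τ.map_update_smul ![u, v, w] 1 r v
  simp only [update_vec_one] at this
  exact this

theorem tri_add_right (u v w w' : E) :
    tri τ u v (w + w') = tri τ u v w + tri τ u v w' := by
  have := τ.map_update_add ![u, v, w] 2 w w'
  simp only [update_vec_two] at this
  exact this

theorem tri_smul_right (r : ℂ) (u v w : E) : tri τ u v (r • w) = r * tri τ u v w := by
  have := τ.map_update_smul ![u, v, w] 2 r w
  simp only [update_vec_two] at this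
  exact this

theorem tri_swap_left (u v w : E) : tri τ u v w = -tri τ v u w := by
  have := τ.map_swap ![v, u, w] (i := 0) (j := 1) (by decide)
  rw [tri, tri, ← this]
  congr 1
  ext i; fin_cases i <;> rfl

theorem tri_swap_right (u v w : E) : tri τ u v w = -tri τ u w v := by
  have := τ.map_swap ![u, w, v] (i := 1) (j := 2) (by decide)
  rw [tri, tri, ← this]
  congr 1
  ext i; fin_cases i <;> rfl

theorem tri_cyc (u v w : E) : tri τ u v w = tri τ v w u := by
  rw [tri_swap_left, tri_swap_right, neg_neg]

@[simp] theorem tri_self_left (u w : E) : tri τ u u w = 0 :=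
  τ.map_eq_zero_of_eq ![u, u, w] (i := 0) (j := 1) rfl (by decide)

@[simp] theorem tri_self_right (u v : E) : tri τ u v v = 0 :=
  τ.map_eq_zero_of_eq ![u, v, v] (i := 1) (j := 2) rfl (by decide)

@[simp] theorem tri_self_outer (u v : E) : tri τ u v u = 0 :=
  τ.map_eq_zero_of_eq ![u, v, u] (i := 0) (j := 2) rfl (by decide)

/-- Addition in `Fin 3` is cyclic and a cyclic permutation of three arguments is even, so no sign
appears. -/
theorem tri_cyc_fin (h : Fin 3 → E) (i : Fin 3) :
    tri τ (h i) (h (i + 1)) (h (i + 2)) = τ h := by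
  have h0 : τ h = tri τ (h 0) (h 1) (h 2) := by
    rw [tri]; congr 1; ext i; fin_cases i <;> rfl
  rw [h0]
  fin_cases i
  · rfl
  · exact (tri_cyc _ _ _ _).symm
  · exact tri_cyc τ (h 2) (h 0) (h 1)

/-- A pair of triples forming together an orthonormal family of six vectors. -/
structure Frame (f g : Fin 3 → E) : Prop where
  left : Orthonormal ℂ f
  right : Orthonormal ℂ g
  cross : ∀ i j, inner ℂ (f i) (g j) = 0

namespace Frame

variable {f g : Fin 3 → E}

theorem cross' (h : Frame f g) (i j : Fin 3) : inner ℂ (g i) (f j) = 0 :=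
  inner_eq_zero_symm.1 (h.cross j i)

theorem symm (h : Frame f g) : Frame g f := ⟨h.right, h.left, h.cross'⟩

theorem orthonormal (h : Frame f g) : Orthonormal ℂ (Sum.elim f g) := by
  rw [orthonormal_iff_ite]
  have hl := orthonormal_iff_ite.1 h.left
  have hr := orthonormal_iff_ite.1 h.right
  rintro (i | i) (j | j)
  · simpa using hl i j
  · simpa using h.cross i j
  · simpa using h.cross' i j
  · simpa using hr i j

theorem of_orthonormal (h : Orthonormal ℂ (Sum.elim f g)) : Frame f g := by
  refine ⟨h.comp Sum.inl Sum.inl_injective, h.comp Sum.inr Sum.inr_injective, fun i j => ?_⟩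
  exact h.2 (i := Sum.inl i) (j := Sum.inr j) (by simp)

variable (hE : finrank ℂ E = 6)
include hE

/-- The orthonormal basis given by a frame of a six-dimensional space. -/
def basis (h : Frame f g) : OrthonormalBasis (Fin 3 ⊕ Fin 3) ℂ E :=
  haveI : FiniteDimensional ℂ E := Module.finite_of_finrank_pos (by omega)
  (basisOfOrthonormalOfCardEqFinrank h.orthonormal (by simp [hE])).toOrthonormalBasis
    (by simpa using h.orthonormal)

@[simp] theorem basis_inl (h : Frame f g) (i : Fin 3) : h.basis hE (Sum.inl i) = f i := by
  simp [basis]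

@[simp] theorem basis_inr (h : Frame f g) (i : Fin 3) : h.basis hE (Sum.inr i) = g i := by
  simp [basis]

theorem expand (h : Frame f g) (v : E) :
    v = ∑ i, inner ℂ (f i) v • f i + ∑ i, inner ℂ (g i) v • g i := by
  have := (h.basis hE).sum_repr' v
  simpa using this.symm

end Frame

/-- Coordinates of a form in a frame: the `3 × 3` block of values at one vector of the first
triple and two of the second. -/
def block (τ : E [⋀^Fin 3]→ₗ[ℂ] ℂ) (f g : Fin 3 → E) : Matrix (Fin 3) (Fin 3) ℂ :=
  Matrix.of fun i j => tri τ (f i) (g (j + 1)) (g (j + 2))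

/-- In the frame `(f, g)` the form `τ` has the coordinates of the canonical state of `p`. -/
structure Canon (τ : E [⋀^Fin 3]→ₗ[ℂ] ℂ) (f g : Fin 3 → E) (p : Point) : Prop where
  frame : Frame f g
  block_eq : block τ f g = Matrix.diagonal ![(p.a : ℂ), p.b, p.c]
  left_eq : τ f = p.d
  right_eq : τ g = conj p.z
  crit : ∀ i j, tri τ (g i) (f (j + 1)) (f (j + 2)) = 0

-- Triples of basis vectors fall into four types according to how many come from `g`; up to sign
-- each value is one of those compared in the hypotheses.
variable {τ} in
theorem form_ext_of_frame (hE : finrank ℂ E = 6) {f g : Fin 3 → E} (h : Frame f g)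
    {σ : E [⋀^Fin 3]→ₗ[ℂ] ℂ} (h0 : τ f = σ f) (h3 : τ g = σ g)
    (h2 : block τ f g = block σ f g)
    (h1 : ∀ i j, tri τ (g i) (f (j + 1)) (f (j + 2)) = tri σ (g i) (f (j + 1)) (f (j + 2))) :
    τ = σ := by
  have swap2 : ∀ (x : E) (k : Fin 3 → E),
      (∀ j, tri τ x (k (j + 1)) (k (j + 2)) = tri σ x (k (j + 1)) (k (j + 2))) →
      ∀ i j, tri τ x (k i) (k j) = tri σ x (k i) (k j) := by
    intro x k hk i j
    have e0 := hk 0; have e1 := hk 1; have e2 := hk 2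
    simp only [Fin.isValue, zero_add] at e0
    have q1 : (1 : Fin 3) + 1 = 2 := rfl
    have q2 : (1 : Fin 3) + 2 = 0 := rfl
    have q3 : (2 : Fin 3) + 1 = 0 := rfl
    have q4 : (2 : Fin 3) + 2 = 1 := rfl
    rw [q1, q2] at e1
    rw [q3, q4] at e2
    fin_cases i <;> fin_cases j <;>
      simp only [Fin.zero_eta, Fin.mk_one, Fin.reduceFinMk, Fin.isValue, tri_self_right]
    · exact e2
    · rw [tri_swap_right, tri_swap_right σ, e1]
    · rw [tri_swap_right, tri_swap_right σ, e2]
    · exact e0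
    · exact e1
    · rw [tri_swap_right, tri_swap_right σ, e0]
  have A : ∀ i j k, tri τ (f i) (f j) (f k) = tri σ (f i) (f j) (f k) := by
    intro i
    apply swap2
    intro j
    by_cases hij : i = j
    · subst hij; rw [tri_cyc_fin, tri_cyc_fin, h0]
    · have : i = j + 1 ∨ i = j + 2 := by revert i j; decide
      rcases this with rfl | rfl <;> simp
  have B : ∀ i j k, tri τ (g i) (g j) (g k) = tri σ (g i) (g j) (g k) := by
    intro i
    apply swap2
    intro j
    by_cases hij : i = j
    · subst hij; rw [tri_cyc_fin, tri_cyc_fin, h3]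
    · have : i = j + 1 ∨ i = j + 2 := by revert i j; decide
      rcases this with rfl | rfl <;> simp
  have C : ∀ i j k, tri τ (g i) (f j) (f k) = tri σ (g i) (f j) (f k) := fun i =>
    swap2 _ _ (h1 i)
  have D : ∀ i j k, tri τ (f i) (g j) (g k) = tri σ (f i) (g j) (g k) := fun i =>
    swap2 _ _ fun j => congrFun (congrFun h2 i) j
  have all : ∀ a b c : Fin 3 ⊕ Fin 3, tri τ (Sum.elim f g a) (Sum.elim f g b) (Sum.elim f g c) =
      tri σ (Sum.elim f g a) (Sum.elim f g b) (Sum.elim f g c) := by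
    rintro (i | i) (j | j) (k | k)
    · exact A i j k
    · change tri τ (f i) (f j) (g k) = tri σ (f i) (f j) (g k)
      rw [← tri_cyc, ← tri_cyc σ]; exact C _ _ _
    · change tri τ (f i) (g j) (f k) = tri σ (f i) (g j) (f k)
      rw [tri_cyc, tri_cyc σ]; exact C _ _ _
    · exact D i j k
    · exact C i j k
    · change tri τ (g i) (f j) (g k) = tri σ (g i) (f j) (g k)
      rw [tri_cyc, tri_cyc σ]; exact D _ _ _
    · change tri τ (g i) (g j) (f k) = tri σ (g i) (g j) (f k)
      rw [← tri_cyc, ← tri_cyc σ]; exact D _ _ _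
    · exact B i j k
  refine Basis.ext_alternating (h.basis hE).toBasis fun v _ => ?_
  have hb : ∀ s, (h.basis hE).toBasis s = Sum.elim f g s := by
    rintro (i | i) <;> simp
  have hv : (fun i => (h.basis hE).toBasis (v i)) =
      ![Sum.elim f g (v 0), Sum.elim f g (v 1), Sum.elim f g (v 2)] := by
    ext i; fin_cases i <;> exact hb _
  rw [hv]
  exact all _ _ _

end Trilinear

/-! ### LU-equivalence as coordinates in a frame -/

/-- The vectors `|2⟩, |4⟩, |6⟩`. -/
def ketL : Fin 3 → V := ![ket 1, ket 3, ket 5]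

/-- The vectors `|1⟩, |3⟩, |5⟩`. -/
def ketR : Fin 3 → V := ![ket 0, ket 2, ket 4]

theorem finrank_V : finrank ℂ V = 6 := by simp

theorem frame_ket : Frame ketL ketR := by
  have hk : Orthonormal ℂ ket := (EuclideanSpace.basisFun (Fin 6) ℂ).orthonormal
  refine ⟨?_, ?_, ?_⟩
  · have h : ketL = ket ∘ ![1, 3, 5] := by ext i : 1; fin_cases i <;> rfl
    rw [h]
    exact hk.comp _ (by decide)
  · have h : ketR = ket ∘ ![0, 2, 4] := by ext i : 1; fin_cases i <;> rfl
    rw [h]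
    exact hk.comp _ (by decide)
  · intro i j
    fin_cases i <;> fin_cases j <;> simp [ketL, ketR, inner_ket]

theorem tri_state (p : Point) (l m n : Fin 6) :
    tri (form p.state) (ket l) (ket m) (ket n) =
      p.a * (Matrix.of fun r s => if ![1, 2, 4] s = ![l, m, n] r then (1 : ℂ) else 0).det +
      p.b * (Matrix.of fun r s => if ![0, 3, 4] s = ![l, m, n] r then (1 : ℂ) else 0).det +
      p.c * (Matrix.of fun r s => if ![0, 2, 5] s = ![l, m, n] r then (1 : ℂ) else 0).det +
      p.d * (Matrix.of fun r s => if ![1, 3, 5] s = ![l, m, n] r then (1 : ℂ) else 0).det +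
      conj p.z * (Matrix.of fun r s => if ![0, 2, 4] s = ![l, m, n] r then (1 : ℂ) else 0).det := by
  simp only [tri, Point.state, form_add, form_smul, AlternatingMap.add_apply,
    AlternatingMap.smul_apply, form_e, Complex.conj_ofReal, smul_eq_mul]

/-- The form depends conjugate-linearly on the state; this is why `z` enters `Canon` conjugated, the
other parameters being real. -/
theorem canon_ket (p : Point) : Canon (form p.state) ketL ketR p := by
  refine ⟨frame_ket, ?_, ?_, ?_, ?_⟩
  · ext i j
    fin_cases i <;> fin_cases j <;>
      simp [block, ketL, ketR, tri_state, Matrix.det_fin_three]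
  · have := tri_state p 1 3 5
    rw [ketL, ← tri]
    simpa [Matrix.det_fin_three] using this
  · have := tri_state p 0 2 4
    rw [ketR, ← tri]
    simpa [Matrix.det_fin_three] using this
  · intro i j
    fin_cases i <;> fin_cases j <;>
      simp [ketL, ketR, tri_state, Matrix.det_fin_three]

/-- The unitary carries the required frame to the standard one. Conversely a frame defines such a
unitary, and equality of states follows from `form_ext_of_frame`. -/
theorem lUEquiv_iff (φ : W3) (p : Point) :
    LUEquiv φ p.state ↔ ∃ f g : Fin 3 → V, Canon (form φ) f g p := by
  constructor
  · rintro ⟨U, hU⟩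
    have key : ∀ h : Fin 3 → V, form φ (U.symm ∘ h) = form p.state h := by
      intro h
      rw [hU, ← form_map U φ]
      congr 1; ext i; simp
    have keyt : ∀ u v w : V, tri (form φ) (U.symm u) (U.symm v) (U.symm w) =
        tri (form p.state) u v w := by
      intro u v w
      rw [tri, tri, ← key]
      congr 1; ext i; fin_cases i <;> rfl
    have hc := canon_ket p
    refine ⟨U.symm ∘ ketL, U.symm ∘ ketR, ⟨?_, ?_, fun i j => ?_⟩, ?_, ?_, ?_, fun i j => ?_⟩
    · exact hc.frame.left.comp_linearIsometryEquiv _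
    · exact hc.frame.right.comp_linearIsometryEquiv _
    · simpa using hc.frame.cross i j
    · rw [← hc.block_eq]
      ext i j
      exact keyt _ _ _
    · rw [key, hc.left_eq]
    · rw [key, hc.right_eq]
    · rw [← hc.crit i j]; exact keyt _ _ _
  · rintro ⟨f, g, h⟩
    let U : V ≃ₗᵢ[ℂ] V := (h.frame.basis finrank_V).equiv (frame_ket.basis finrank_V) (Equiv.refl _)
    have hf : ∀ i, U (f i) = ketL i := fun i => by
      rw [← h.frame.basis_inl finrank_V, OrthonormalBasis.equiv_apply_basis]; simp
    have hg : ∀ i, U (g i) = ketR i := fun i => by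
      rw [← h.frame.basis_inr finrank_V, OrthonormalBasis.equiv_apply_basis]; simp
    have hf' : ketL = U ∘ f := funext fun i => (hf i).symm
    have hg' : ketR = U ∘ g := funext fun i => (hg i).symm
    have hc := canon_ket p
    have keyt : ∀ u v w : V, tri (form (exteriorPower.map 3 U.toLinearEquiv.toLinearMap φ))
        (U u) (U v) (U w) = tri (form φ) u v w := by
      intro u v w
      rw [tri, tri, ← form_map U φ ![u, v, w]]
      congr 1; ext i : 1; fin_cases i <;> rfl
    refine ⟨U, form_injective (form_ext_of_frame finrank_V frame_ket ?_ ?_ ?_ ?_)⟩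
    · rw [hc.left_eq, hf', form_map, h.left_eq]
    · rw [hc.right_eq, hg', form_map, h.right_eq]
    · rw [hc.block_eq, ← h.block_eq]
      ext i j
      rw [hf', hg']
      exact (keyt _ _ _).symm
    · intro i j
      rw [hc.crit, ← h.crit i j, hf', hg']
      exact (keyt _ _ _).symm

/-! ### Maximizing orthonormal triples -/

section Bounded

variable {E : Type*} [NormedAddCommGroup E] [InnerProductSpace ℂ E]

/-- The values of `τ` at orthonormal triples have modulus at most `d`. -/
def Bounded (τ : E [⋀^Fin 3]→ₗ[ℂ] ℂ) (d : ℝ) : Prop :=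
  ∀ h : Fin 3 → E, Orthonormal ℂ h → ‖τ h‖ ≤ d

theorem orthonormal_vec {u v w : E} (hu : ‖u‖ = 1) (hv : ‖v‖ = 1) (hw : ‖w‖ = 1)
    (huv : inner ℂ u v = 0) (huw : inner ℂ u w = 0) (hvw : inner ℂ v w = 0) :
    Orthonormal ℂ ![u, v, w] := by
  refine ⟨fun i => ?_, fun i j hij => ?_⟩
  · fin_cases i <;> simpa
  · have h1 := inner_eq_zero_symm.1 huv
    have h2 := inner_eq_zero_symm.1 huw
    have h3 := inner_eq_zero_symm.1 hvw
    fin_cases i <;> fin_cases j <;> first | exact absurd rfl hij | simpa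

theorem tri_zero_left (τ : E [⋀^Fin 3]→ₗ[ℂ] ℂ) (v w : E) : tri τ 0 v w = 0 := by
  simpa using tri_smul_left τ 0 0 v w

theorem tri_zero_mid (τ : E [⋀^Fin 3]→ₗ[ℂ] ℂ) (u w : E) : tri τ u 0 w = 0 := by
  simpa using tri_smul_mid τ 0 u 0 w

theorem tri_zero_right (τ : E [⋀^Fin 3]→ₗ[ℂ] ℂ) (u v : E) : tri τ u v 0 = 0 := by
  simpa using tri_smul_right τ 0 u v 0

theorem exists_unit_smul (u : E) (hu : u ≠ 0) :
    ∃ u' : E, ‖u'‖ = 1 ∧ u = ((‖u‖ : ℝ) : ℂ) • u' := by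
  have h : (‖u‖ : ℂ) ≠ 0 := by simpa using hu
  refine ⟨((‖u‖ : ℝ) : ℂ)⁻¹ • u, ?_, ?_⟩
  · rw [norm_smul, norm_inv, Complex.norm_real, norm_norm, inv_mul_cancel₀ (by simpa using hu)]
  · rw [smul_smul, mul_inv_cancel₀ h, one_smul]

theorem Bounded.norm_tri_le {τ : E [⋀^Fin 3]→ₗ[ℂ] ℂ} {d : ℝ} (hτ : Bounded τ d) {u v w : E}
    (huv : inner ℂ u v = 0) (huw : inner ℂ u w = 0) (hvw : inner ℂ v w = 0) :
    ‖tri τ u v w‖ ≤ d * (‖u‖ * ‖v‖ * ‖w‖) := by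
  by_cases hu : u = 0
  · simp [hu, tri_zero_left]
  by_cases hv : v = 0
  · simp [hv, tri_zero_mid]
  by_cases hw : w = 0
  · simp [hw, tri_zero_right]
  obtain ⟨u', hu', eu⟩ := exists_unit_smul u hu
  obtain ⟨v', hv', ev⟩ := exists_unit_smul v hv
  obtain ⟨w', hw', ew⟩ := exists_unit_smul w hw
  have nu := norm_ne_zero_iff.2 hu
  have nv := norm_ne_zero_iff.2 hv
  have nw := norm_ne_zero_iff.2 hw
  have h1 : inner ℂ u' v' = 0 := by
    rw [eu, ev, inner_smul_left, inner_smul_right] at huv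
    simpa [hu, hv] using huv
  have h2 : inner ℂ u' w' = 0 := by
    rw [eu, ew, inner_smul_left, inner_smul_right] at huw
    simpa [hu, hw] using huw
  have h3 : inner ℂ v' w' = 0 := by
    rw [ev, ew, inner_smul_left, inner_smul_right] at hvw
    simpa [hv, hw] using hvw
  have hb := hτ _ (orthonormal_vec hu' hv' hw' h1 h2 h3)
  have e : tri τ u v w = (‖u‖ * ‖v‖ * ‖w‖ : ℝ) * tri τ u' v' w' := by
    conv_lhs => rw [eu, ev, ew]
    rw [tri_smul_left, tri_smul_mid, tri_smul_right]
    push_cast; ring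
  rw [e, norm_mul, Complex.norm_real, Real.norm_of_nonneg (by positivity), mul_comm]
  exact mul_le_mul_of_nonneg_right hb (by positivity)

/-- A vector `(D, t)` of `ℂ²` whose first coordinate already has the norm of the largest linear
combination has vanishing second coordinate. -/
theorem eq_zero_of_rotation_le {D t : ℂ}
    (h : ∀ α β : ℂ, ‖α‖ ^ 2 + ‖β‖ ^ 2 = 1 → ‖α * D + β * t‖ ≤ ‖D‖) : t = 0 := by
  by_contra ht
  set N := Real.sqrt (‖D‖ ^ 2 + ‖t‖ ^ 2) with hN
  have ht' : 0 < ‖t‖ := norm_pos_iff.2 ht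
  have hN2 : N ^ 2 = ‖D‖ ^ 2 + ‖t‖ ^ 2 := Real.sq_sqrt (by positivity)
  have hN0 : 0 < N := Real.sqrt_pos.2 (by positivity)
  have hNc : (N : ℂ) ≠ 0 := by exact_mod_cast hN0.ne'
  -- The extremal coefficients of the Cauchy–Schwarz inequality, at which the combination equals the
  -- norm `N` of `(D, t)`.
  have h1 := h (conj D / N) (conj t / N) (by
    rw [norm_div, norm_div, Complex.norm_conj, Complex.norm_conj, Complex.norm_real,
      Real.norm_of_nonneg hN0.le, div_pow, div_pow, ← add_div, hN2, div_self]
    rw [← hN2]; positivity)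
  have e : conj D / N * D + conj t / N * t = N := by
    have h2 : conj D * D = ((‖D‖ ^ 2 : ℝ) : ℂ) := by rw [Complex.conj_mul']; simp
    have h3 : conj t * t = ((‖t‖ ^ 2 : ℝ) : ℂ) := by rw [Complex.conj_mul']; simp
    rw [div_mul_eq_mul_div, div_mul_eq_mul_div, ← add_div, h2, h3, div_eq_iff hNc]
    exact_mod_cast (by rw [← hN2]; ring)
  rw [e, Complex.norm_real, Real.norm_of_nonneg hN0.le] at h1
  have : N ^ 2 ≤ ‖D‖ ^ 2 := pow_le_pow_left₀ hN0.le h1 2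
  nlinarith

theorem Bounded.nonneg {τ : E [⋀^Fin 3]→ₗ[ℂ] ℂ} {d : ℝ} (hτ : Bounded τ d)
    {h : Fin 3 → E} (ho : Orthonormal ℂ h) : 0 ≤ d := (norm_nonneg _).trans (hτ h ho)

theorem norm_sq_combination {u v : E} (hu : ‖u‖ = 1) (hv : ‖v‖ = 1) (huv : inner ℂ u v = 0)
    (α β : ℂ) : ‖α • u + β • v‖ ^ 2 = ‖α‖ ^ 2 + ‖β‖ ^ 2 := by
  have := norm_add_sq_eq_norm_sq_add_norm_sq_of_inner_eq_zero (𝕜 := ℂ) (α • u) (β • v)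
    (by rw [inner_smul_left, inner_smul_right, huv]; simp)
  rw [norm_smul, norm_smul, hu, hv] at this
  nlinarith

/-- First-order condition at a maximum: turning `h i` towards the normalized `v` keeps the triple
orthonormal. -/
theorem tri_eq_zero_of_orthogonal {τ : E [⋀^Fin 3]→ₗ[ℂ] ℂ} {d : ℝ} (hτ : Bounded τ d)
    {h : Fin 3 → E} (ho : Orthonormal ℂ h) (hd : ‖τ h‖ = d) {v : E}
    (hv : ∀ i, inner ℂ (h i) v = 0) (i : Fin 3) : tri τ v (h (i + 1)) (h (i + 2)) = 0 := by
  by_cases hv0 : v = 0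
  · rw [hv0, tri_zero_left]
  obtain ⟨v', hv', ev⟩ := exists_unit_smul v hv0
  have hiv : ∀ j, inner ℂ (h j) v' = 0 := by
    intro j
    have := hv j
    rw [ev, inner_smul_right] at this
    simpa [hv0] using this
  have n01 : i ≠ i + 1 := by revert i; decide
  have n02 : i ≠ i + 2 := by revert i; decide
  have n12 : i + 1 ≠ i + 2 := by revert i; decide
  rw [ev, tri_smul_left]
  refine mul_eq_zero_of_right _ (eq_zero_of_rotation_le (D := τ h) fun α β hαβ => ?_)
  have e : tri τ (α • h i + β • v') (h (i + 1)) (h (i + 2)) =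
      α * τ h + β * tri τ v' (h (i + 1)) (h (i + 2)) := by
    rw [tri_add_left, tri_smul_left, tri_smul_left, tri_cyc_fin]
  rw [← e, hd]
  have key := hτ.norm_tri_le (u := α • h i + β • v') (v := h (i + 1)) (w := h (i + 2))
    (by rw [inner_add_left, inner_smul_left, inner_smul_left, ho.2 n01,
          inner_eq_zero_symm.1 (hiv _)]; simp)
    (by rw [inner_add_left, inner_smul_left, inner_smul_left, ho.2 n02,
          inner_eq_zero_symm.1 (hiv _)]; simp)
    (ho.2 n12)
  have hn : ‖α • h i + β • v'‖ = 1 := by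
    have := norm_sq_combination (ho.1 i) hv' (hiv i) α β
    rw [hαβ] at this
    exact (pow_eq_one_iff_of_nonneg (norm_nonneg _) two_ne_zero).1 this
  rw [hn, ho.1, ho.1] at key
  simpa using key

/-- At a maximizing orthonormal triple the form is determined in each slot by the inner product. -/
theorem tri_eq_inner_mul {τ : E [⋀^Fin 3]→ₗ[ℂ] ℂ} {d : ℝ} (hτ : Bounded τ d)
    {h : Fin 3 → E} (ho : Orthonormal ℂ h) (hd : ‖τ h‖ = d) (v : E) (i : Fin 3) :
    tri τ v (h (i + 1)) (h (i + 2)) = inner ℂ (h i) v * τ h := by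
  set v' := v - ∑ j, inner ℂ (h j) v • h j with hv'
  have hz : ∀ j, inner ℂ (h j) v' = 0 := by
    intro j
    rw [hv', inner_sub_right, ho.inner_right_fintype, sub_self]
  have h0 := tri_eq_zero_of_orthogonal hτ ho hd hz i
  have ev : v = v' + (inner ℂ (h i) v • h i + inner ℂ (h (i + 1)) v • h (i + 1) +
      inner ℂ (h (i + 2)) v • h (i + 2)) := by
    have : ∑ j, inner ℂ (h j) v • h j = inner ℂ (h i) v • h i +
        inner ℂ (h (i + 1)) v • h (i + 1) + inner ℂ (h (i + 2)) v • h (i + 2) := by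
      rw [Fin.sum_univ_three]
      fin_cases i
      · rfl
      · simp only [Fin.mk_one, Fin.isValue, Fin.reduceAdd]; abel
      · simp only [Fin.reduceFinMk, Fin.isValue, Fin.reduceAdd]; abel
    rw [← this, hv']; abel
  conv_lhs => rw [ev]
  rw [tri_add_left, h0, tri_add_left, tri_add_left, tri_smul_left, tri_smul_left, tri_smul_left,
    tri_cyc_fin, tri_self_left, tri_self_outer]
  ring

/-- A decomposable three-vector with Gram determinant one is, up to a phase, spanned by an
orthonormal triple. -/
theorem exists_orthonormal_of_linearIndependent (x : Fin 3 → E) (hx : LinearIndependent ℂ x) :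
    ∃ (h : Fin 3 → E) (c : ℂ), Orthonormal ℂ h ∧
      ∀ τ : E [⋀^Fin 3]→ₗ[ℂ] ℂ, τ x = c * τ h := by
  set W := Submodule.span ℂ (Set.range x)
  have : FiniteDimensional ℂ W := FiniteDimensional.span_of_finite ℂ (Set.finite_range x)
  have hW : finrank ℂ W = 3 := by
    have := finrank_span_eq_card hx
    simpa using this
  let b : OrthonormalBasis (Fin 3) ℂ W := (stdOrthonormalBasis ℂ W).reindex (finCongr hW)
  let x' : Fin 3 → W := fun i => ⟨x i, Submodule.subset_span ⟨i, rfl⟩⟩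
  refine ⟨fun i => b i, b.toBasis.det x', ?_, fun τ => ?_⟩
  · exact b.orthonormal.comp_linearIsometry W.subtypeₗᵢ
  · have := congrArg (fun σ => σ x') ((τ.compLinearMap W.subtype).eq_smul_basis_det b.toBasis)
    simp only [AlternatingMap.compLinearMap_apply, AlternatingMap.smul_apply, smul_eq_mul] at this
    rw [mul_comm]
    have e : ∀ i, W.subtype (b.toBasis i) = b i := fun i => by simp
    simp only [e] at this
    exact this

/-- Alternating forms on a finite-dimensional space are continuous. -/
theorem continuous_form [FiniteDimensional ℂ E] (τ : E [⋀^Fin 3]→ₗ[ℂ] ℂ) :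
    Continuous fun h : Fin 3 → E => τ h := by
  let b := stdOrthonormalBasis ℂ E
  have : (fun h : Fin 3 → E => τ h) = fun h => ∑ r : Fin 3 → Fin (finrank ℂ E),
      (∏ i, inner ℂ (b (r i)) (h i)) • τ (fun i => b (r i)) := by
    ext h
    have e : h = fun i => ∑ j, inner ℂ (b j) (h i) • b j :=
      funext fun i => (b.sum_repr' (h i)).symm
    conv_lhs => rw [e]
    have := τ.toMultilinearMap.map_sum fun (i : Fin 3) (j : Fin (finrank ℂ E)) =>
      inner ℂ (b j) (h i) • b j
    refine this.trans (Finset.sum_congr rfl fun r _ => ?_)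
    exact τ.toMultilinearMap.map_smul_univ (fun i => inner ℂ (b (r i)) (h i)) fun i => b (r i)
  rw [this]
  fun_prop

end Bounded

/-- An orthonormal basis of the span changes a decomposable vector only by a scalar, of modulus one
when the norm is one. Hence `μ` may be computed on orthonormal triples. -/
theorem inner_ofNormalized (x : Fin 3 → V) (hx : Normalized (exteriorPower.ιMulti ℂ 3 x)) :
    ∃ h : Fin 3 → V, Orthonormal ℂ h ∧ ∀ φ : W3, ‖form φ x‖ = ‖form φ h‖ := by
  have hli : LinearIndependent ℂ x := by
    by_contra hli
    have := (exteriorPower.ιMulti ℂ 3 (M := V)).map_linearDependent x hli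
    rw [Normalized, this, ← zero_smul ℂ (0 : W3), braket_smul_left] at hx
    simp at hx
  obtain ⟨h, c, ho, hc⟩ := exists_orthonormal_of_linearIndependent x hli
  refine ⟨h, ho, fun φ => ?_⟩
  have hh : braket (exteriorPower.ιMulti ℂ 3 h) (exteriorPower.ιMulti ℂ 3 h) = 1 := by
    rw [braket_ιMulti, ← Matrix.det_one (n := Fin 3)]
    congr 1
    ext i j
    rw [Matrix.of_apply, orthonormal_iff_ite.1 ho, Matrix.one_apply]
    simp only [eq_comm]
  have h1 : braket (exteriorPower.ιMulti ℂ 3 x) (exteriorPower.ιMulti ℂ 3 x) = c * conj c := by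
    rw [← form_apply, hc, form_apply, ← conj_braket, ← form_apply, hc, form_apply, hh, mul_one]
  rw [Normalized, h1, Complex.mul_conj, Complex.normSq_eq_norm_sq] at hx
  have hc1 : ‖c‖ = 1 := by
    have : ‖c‖ ^ 2 = 1 := by exact_mod_cast hx
    exact (pow_eq_one_iff_of_nonneg (norm_nonneg _) two_ne_zero).1 this
  rw [hc, norm_mul, hc1, one_mul]

theorem isMu_iff (φ : W3) (m : ℝ) :
    IsMu φ m ↔ Bounded (form φ) m ∧ ∃ h : Fin 3 → V, Orthonormal ℂ h ∧ ‖form φ h‖ = m := by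
  have hvec : ∀ h : Fin 3 → V, h = ![h 0, h 1, h 2] := fun h => by
    ext i : 1; fin_cases i <;> rfl
  have hval : ∀ α β γ : V, ‖braket (wedge α β γ) φ‖ = ‖form φ ![α, β, γ]‖ := fun α β γ => by
    rw [← conj_braket, Complex.norm_conj]; rfl
  have hmem : ∀ h : Fin 3 → V, Orthonormal ℂ h → ‖form φ h‖ ∈ {r : ℝ | ∃ α β γ : V,
      Normalized (wedge α β γ) ∧ r = ‖braket (wedge α β γ) φ‖} := by
    intro h ho
    refine ⟨h 0, h 1, h 2, ?_, ?_⟩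
    · rw [Normalized, wedge, ← hvec, braket_ιMulti, ← Matrix.det_one (n := Fin 3)]
      congr 1
      ext i j
      rw [Matrix.of_apply, orthonormal_iff_ite.1 ho, Matrix.one_apply]
      simp only [eq_comm]
    · rw [hval, ← hvec]
  constructor
  · rintro ⟨⟨α, β, γ, hn, hm⟩, hub⟩
    refine ⟨fun h ho => hub (hmem h ho), ?_⟩
    obtain ⟨h, ho, hh⟩ := inner_ofNormalized _ hn
    exact ⟨h, ho, by rw [hm, hval, hh]⟩
  · rintro ⟨hb, h, ho, hm⟩
    refine ⟨hm ▸ hmem h ho, ?_⟩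
    rintro r ⟨α, β, γ, hn, rfl⟩
    obtain ⟨h', ho', hh'⟩ := inner_ofNormalized _ hn
    rw [hval, hh']
    exact hb h' ho'

/-! ### Existence of a canonical frame -/

section Existence

variable {E : Type*} [NormedAddCommGroup E] [InnerProductSpace ℂ E]

theorem isCompact_setOf_frame [FiniteDimensional ℂ E] :
    IsCompact {F : (Fin 3 → E) × (Fin 3 → E) | Frame F.1 F.2} := by
  have : ProperSpace E := FiniteDimensional.proper ℂ E
  refine Metric.isCompact_of_isClosed_isBounded ?_ ?_
  · have e : {F : (Fin 3 → E) × (Fin 3 → E) | Frame F.1 F.2} =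
        (⋂ i, ⋂ j, {F | inner ℂ (F.1 i) (F.1 j) = if i = j then (1 : ℂ) else 0}) ∩
        ((⋂ i, ⋂ j, {F | inner ℂ (F.2 i) (F.2 j) = if i = j then (1 : ℂ) else 0}) ∩
        (⋂ i, ⋂ j, {F | inner ℂ (F.1 i) (F.2 j) = (0 : ℂ)})) := by
      ext F
      simp only [Set.mem_inter_iff, Set.mem_iInter, Set.mem_ofPred_eq]
      constructor
      · exact fun h => ⟨orthonormal_iff_ite.1 h.left, orthonormal_iff_ite.1 h.right, h.cross⟩
      · exact fun h => ⟨orthonormal_iff_ite.2 h.1, orthonormal_iff_ite.2 h.2.1, h.2.2⟩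
    rw [e]
    refine IsClosed.inter ?_ (IsClosed.inter ?_ ?_) <;>
      exact isClosed_iInter fun i => isClosed_iInter fun j =>
        isClosed_eq (by fun_prop) continuous_const
  · refine (Metric.isBounded_closedBall (x := 0) (r := 1)).subset fun F hF => ?_
    rw [mem_closedBall_zero_iff, Prod.norm_def, max_le_iff, pi_norm_le_iff_of_nonneg zero_le_one,
      pi_norm_le_iff_of_nonneg zero_le_one]
    exact ⟨fun i => (hF.left.1 i).le, fun i => (hF.right.1 i).le⟩

/-- Replace `h i, h j` by their image under a special unitary transformation of the plane. -/
def rot (i j : Fin 3) (α β : ℂ) (h : Fin 3 → E) : Fin 3 → E := fun k =>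
  if k = i then α • h i + β • h j else if k = j then -conj β • h i + conj α • h j else h k

theorem inner_rot_eq_zero {i j : Fin 3} {α β : ℂ} {h : Fin 3 → E} {v : E}
    (hv : ∀ k, inner ℂ v (h k) = 0) (k : Fin 3) : inner ℂ v (rot i j α β h k) = 0 := by
  unfold rot
  split_ifs <;> simp [inner_smul_right, hv]

theorem orthonormal_rot {i j : Fin 3} (hij : i ≠ j) {α β : ℂ} (hαβ : ‖α‖ ^ 2 + ‖β‖ ^ 2 = 1)
    {h : Fin 3 → E} (ho : Orthonormal ℂ h) : Orthonormal ℂ (rot i j α β h) := by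
  have hc : conj α * α + conj β * β = 1 := by
    rw [Complex.conj_mul', Complex.conj_mul']; exact_mod_cast hαβ
  have hi := orthonormal_iff_ite.1 ho
  rw [orthonormal_iff_ite]
  intro k l
  unfold rot
  by_cases hki : k = i
  · by_cases hli : l = i
    · subst hki hli
      simp only [if_true, inner_add_left, inner_add_right, inner_smul_left, inner_smul_right, hi,
        hij, hij.symm, if_false]
      linear_combination hc
    · by_cases hlj : l = j
      · subst hki hlj
        simp only [if_true, inner_add_left, inner_add_right, inner_smul_left, inner_smul_right, hi,
          hij, hij.symm, if_false]
        ring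
      · subst hki
        simp only [if_true, inner_add_left, inner_smul_left, hi, hli, hlj, if_false,
          Ne.symm hli, Ne.symm hlj]
        ring
  · by_cases hkj : k = j
    · subst hkj
      by_cases hli : l = i
      · subst hli
        simp only [if_true, inner_add_left, inner_add_right, inner_smul_left, inner_smul_right, hi,
          hij, hij.symm, if_false, map_neg, Complex.conj_conj]
        ring
      · by_cases hlk : l = k
        · subst hlk
          simp only [if_true, inner_add_left, inner_add_right, inner_smul_left, inner_smul_right,
            hi, hij, hij.symm, if_false, map_neg, Complex.conj_conj]
          linear_combination hc
        · simp only [if_true, inner_add_left, inner_smul_left, hi, hli, hlk, if_false,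
            Ne.symm hli, Ne.symm hlk, hki]
          ring
    · by_cases hli : l = i
      · subst hli
        simp only [if_true, inner_add_right, inner_smul_right, hi, hki, hkj, if_false]
        ring
      · by_cases hlj : l = j
        · subst hlj
          simp only [if_true, inner_add_right, inner_smul_right, hi, hki, hkj, if_false, hli]
          ring
        · simp only [hki, hkj, hli, hlj, if_false, hi]

theorem Frame.rot_left {f g : Fin 3 → E} (h : Frame f g) {i j : Fin 3} (hij : i ≠ j) {α β : ℂ}
    (hαβ : ‖α‖ ^ 2 + ‖β‖ ^ 2 = 1) : Frame (rot i j α β f) g :=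
  ⟨orthonormal_rot hij hαβ h.left, h.right, fun _ l => inner_eq_zero_symm.1
    (inner_rot_eq_zero (fun k => h.cross' l k) _)⟩

theorem Frame.rot_right {f g : Fin 3 → E} (h : Frame f g) {i j : Fin 3} (hij : i ≠ j) {α β : ℂ}
    (hαβ : ‖α‖ ^ 2 + ‖β‖ ^ 2 = 1) : Frame f (rot i j α β g) := (h.symm.rot_left hij hαβ).symm

theorem Frame.comp {f g : Fin 3 → E} (h : Frame f g) {r s : Fin 3 → Fin 3}
    (hr : Function.Injective r) (hs : Function.Injective s) : Frame (f ∘ r) (g ∘ s) :=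
  ⟨h.left.comp r hr, h.right.comp s hs, fun _ _ => h.cross _ _⟩

theorem tri_rot_first (τ : E [⋀^Fin 3]→ₗ[ℂ] ℂ) {α β : ℂ} (hαβ : ‖α‖ ^ 2 + ‖β‖ ^ 2 = 1)
    (u v w : E) : tri τ u (α • v + β • w) (-conj β • v + conj α • w) = tri τ u v w := by
  have hc : conj α * α + conj β * β = 1 := by
    rw [Complex.conj_mul', Complex.conj_mul']; exact_mod_cast hαβ
  simp only [tri_add_mid, tri_add_right, tri_smul_mid, tri_smul_right, tri_self_right]
  rw [tri_swap_right τ u w v]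
  linear_combination tri τ u v w * hc

theorem form_eq_tri (τ : E [⋀^Fin 3]→ₗ[ℂ] ℂ) (h : Fin 3 → E) : τ h = tri τ (h 0) (h 1) (h 2) :=
  (tri_cyc_fin τ h 0).symm

/-- The rotation has determinant one. Rotations inside a triple therefore leave the first quantity
to be maximized untouched. -/
theorem form_rot (τ : E [⋀^Fin 3]→ₗ[ℂ] ℂ) {α β : ℂ} (hαβ : ‖α‖ ^ 2 + ‖β‖ ^ 2 = 1)
    (h : Fin 3 → E) {i j : Fin 3} (hij : i ≠ j) : τ (rot i j α β h) = τ h := by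
  have hαβ' : ‖conj α‖ ^ 2 + ‖-conj β‖ ^ 2 = 1 := by simpa using hαβ
  have q1 : (1 : Fin 3) + 1 = 2 := rfl
  have q2 : (1 : Fin 3) + 2 = 0 := rfl
  have q3 : (2 : Fin 3) + 1 = 0 := rfl
  have q4 : (2 : Fin 3) + 2 = 1 := rfl
  have : j = i + 1 ∨ j = i + 2 := by revert i j; decide
  rcases this with rfl | rfl
  · rw [← tri_cyc_fin τ h i, ← tri_cyc_fin τ _ i, tri_cyc τ, tri_cyc τ, tri_cyc τ (h i),
      tri_cyc τ (h (i + 1))]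
    rw [← tri_rot_first τ hαβ (h (i + 2)) (h i) (h (i + 1))]
    congr 1
    · fin_cases i <;> simp [rot]
    · fin_cases i <;> simp [rot]
    · fin_cases i <;> simp [rot]
  · rw [← tri_cyc_fin τ h i, ← tri_cyc_fin τ _ i, tri_swap_left, tri_swap_left τ (h i), neg_inj]
    rw [← tri_rot_first τ hαβ (h (i + 1)) (h i) (h (i + 2))]
    congr 1
    · fin_cases i <;> simp [rot]
    · fin_cases i <;> simp [rot]
    · fin_cases i <;> simp [rot]

end Existence

section Existence

variable {E : Type*} [NormedAddCommGroup E] [InnerProductSpace ℂ E]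

theorem exists_frame_extension (hE : finrank ℂ E = 6) {f : Fin 3 → E} (hf : Orthonormal ℂ f) :
    ∃ g : Fin 3 → E, Frame f g := by
  have : FiniteDimensional ℂ E := Module.finite_of_finrank_pos (by omega)
  let s : Set (Fin 3 ⊕ Fin 3) := Set.range Sum.inl
  have ho : Orthonormal ℂ (s.domRestrict (Sum.elim f (0 : Fin 3 → E))) := by
    refine ⟨?_, ?_⟩
    · rintro ⟨_, i, rfl⟩
      exact hf.1 i
    · rintro ⟨_, i, rfl⟩ ⟨_, j, rfl⟩ hij
      exact hf.2 fun h => hij (by subst h; rfl)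
  obtain ⟨b, hb⟩ := ho.exists_orthonormalBasis_extension_of_card_eq (by simp [hE])
  refine ⟨fun i => b (Sum.inr i), Frame.of_orthonormal ?_⟩
  have : Sum.elim f (fun i => b (Sum.inr i)) = b := by
    ext k
    rcases k with i | i
    · exact (hb _ ⟨i, rfl⟩).symm
    · rfl
  rw [this]
  exact b.orthonormal

theorem exists_frame (hE : finrank ℂ E = 6) : ∃ f g : Fin 3 → E, Frame f g := by
  have : FiniteDimensional ℂ E := Module.finite_of_finrank_pos (by omega)
  let b : OrthonormalBasis (Fin 6) ℂ E := (stdOrthonormalBasis ℂ E).reindex (finCongr hE)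
  exact ⟨_, exists_frame_extension hE (b.orthonormal.comp (Fin.castLE (by norm_num : 3 ≤ 6))
    (Fin.castLE_injective _))⟩

/-- The maximizers of each function form a compact set on which the next one is maximized. -/
theorem exists_lexicographic_max {X : Type*} [TopologicalSpace X] {K : Set X} (hK : IsCompact K)
    (hn : K.Nonempty) {u v w : X → ℝ} (hu : Continuous u) (hv : Continuous v) (hw : Continuous w) :
    ∃ x ∈ K, (∀ y ∈ K, u y ≤ u x) ∧ (∀ y ∈ K, u y = u x → v y ≤ v x) ∧
      ∀ y ∈ K, u y = u x → v y = v x → w y ≤ w x := by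
  obtain ⟨x₁, hx₁, m₁⟩ := hK.exists_isMaxOn hn hu.continuousOn
  obtain ⟨x₂, hx₂, m₂⟩ := (hK.inter_right (isClosed_eq hu (continuous_const (y := u x₁)))).exists_isMaxOn
    ⟨x₁, hx₁, rfl⟩ hv.continuousOn
  obtain ⟨x₃, hx₃, m₃⟩ := ((hK.inter_right (isClosed_eq hu (continuous_const (y := u x₁)))).inter_right
    (isClosed_eq hv (continuous_const (y := v x₂)))).exists_isMaxOn ⟨x₂, hx₂, rfl⟩ hw.continuousOn
  have e₁ : u x₃ = u x₁ := hx₃.1.2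
  have e₂ : v x₃ = v x₂ := hx₃.2
  refine ⟨x₃, hx₃.1.1, fun y hy => e₁ ▸ m₁ hy, fun y hy h => ?_, fun y hy h h' => ?_⟩
  · rw [e₂]; exact m₂ ⟨hy, h.trans e₁⟩
  · exact m₃ ⟨⟨hy, h.trans e₁⟩, h'.trans e₂⟩

theorem exists_unit_mul_eq_norm (w : ℂ) : ∃ u : ℂ, ‖u‖ = 1 ∧ u * w = ‖w‖ := by
  by_cases hw : w = 0
  · exact ⟨1, by simp, by simp [hw]⟩
  · have h : (‖w‖ : ℂ) ≠ 0 := by simpa using hw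
    refine ⟨conj w / ‖w‖, by simp [hw], ?_⟩
    rw [div_mul_eq_mul_div, Complex.conj_mul', sq, mul_div_assoc, div_self h, mul_one]

theorem Frame.smul {f g : Fin 3 → E} (h : Frame f g) {r s : Fin 3 → ℂ} (hr : ∀ i, ‖r i‖ = 1)
    (hs : ∀ i, ‖s i‖ = 1) : Frame (fun i => r i • f i) (fun i => s i • g i) := by
  refine ⟨⟨fun i => by rw [norm_smul, hr, h.left.1, one_mul], fun i j hij => ?_⟩,
    ⟨fun i => by rw [norm_smul, hs, h.right.1, one_mul], fun i j hij => ?_⟩, fun i j => ?_⟩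
  · simp only [inner_smul_left, inner_smul_right, h.left.2 hij, mul_zero]
  · simp only [inner_smul_left, inner_smul_right, h.right.2 hij, mul_zero]
  · simp only [inner_smul_left, inner_smul_right, h.cross, mul_zero]

theorem form_smul_fin (τ : E [⋀^Fin 3]→ₗ[ℂ] ℂ) (r : Fin 3 → ℂ) (f : Fin 3 → E) :
    τ (fun i => r i • f i) = r 0 * r 1 * r 2 * τ f := by
  rw [form_eq_tri, form_eq_tri, tri_smul_left, tri_smul_mid, tri_smul_right]
  ring

theorem block_smul (τ : E [⋀^Fin 3]→ₗ[ℂ] ℂ) (r s : Fin 3 → ℂ) (f g : Fin 3 → E) (i j : Fin 3) :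
    block τ (fun i => r i • f i) (fun i => s i • g i) i j =
      r i * s (j + 1) * s (j + 2) * block τ f g i j := by
  simp only [block, Matrix.of_apply, tri_smul_left, tri_smul_mid, tri_smul_right]
  ring

/-- A frame with a diagonal block, ordered by modulus. -/
theorem exists_frame_block_diagonal (hE : finrank ℂ E = 6) (τ : E [⋀^Fin 3]→ₗ[ℂ] ℂ) :
    ∃ f g : Fin 3 → E, Frame f g ∧ Bounded τ ‖τ f‖ ∧
      (∀ i j, i ≠ j → block τ f g i j = 0) ∧
      ‖block τ f g 1 1‖ ≤ ‖block τ f g 0 0‖ ∧ ‖block τ f g 2 2‖ ≤ ‖block τ f g 1 1‖ := by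
  have : FiniteDimensional ℂ E := Module.finite_of_finrank_pos (by omega)
  have hcont := continuous_form τ
  have hblock : ∀ i j k : Fin 3, Continuous fun F : (Fin 3 → E) × (Fin 3 → E) =>
      ‖tri τ (F.1 i) (F.2 j) (F.2 k)‖ := fun i j k => by
    refine (hcont.comp (continuous_pi fun l => ?_)).norm
    fin_cases l
    · exact (continuous_apply i).comp continuous_fst
    · exact (continuous_apply j).comp continuous_snd
    · exact (continuous_apply k).comp continuous_snd
  obtain ⟨f₀, g₀, h₀⟩ := exists_frame hE
  -- A singular value decomposition by hand: after `|τ f|`, the moduli of the block entries `(0, 0)`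
  -- and `(1, 1)` are maximized in turn. Stationarity under rotations removes the off-diagonal
  -- entries, and comparison with permuted frames orders the diagonal.
  obtain ⟨⟨f, g⟩, hF, m₁, m₂, m₃⟩ := exists_lexicographic_max
    (isCompact_setOf_frame (E := E)) ⟨(f₀, g₀), h₀⟩
    (hcont.comp continuous_fst).norm (hblock 0 1 2) (hblock 1 2 0)
  have hF : Frame f g := hF
  have m₁ : ∀ f' g', Frame f' g' → ‖τ f'‖ ≤ ‖τ f‖ := fun f' g' h => m₁ (f', g') h
  have m₂ : ∀ f' g', Frame f' g' → ‖τ f'‖ = ‖τ f‖ →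
      ‖tri τ (f' 0) (g' 1) (g' 2)‖ ≤ ‖tri τ (f 0) (g 1) (g 2)‖ := fun f' g' h => m₂ (f', g') h
  have m₃ : ∀ f' g', Frame f' g' → ‖τ f'‖ = ‖τ f‖ →
      ‖tri τ (f' 0) (g' 1) (g' 2)‖ = ‖tri τ (f 0) (g 1) (g 2)‖ →
      ‖tri τ (f' 1) (g' 2) (g' 0)‖ ≤ ‖tri τ (f 1) (g 2) (g 0)‖ := fun f' g' h => m₃ (f', g') h
  have q1 : (1 : Fin 3) + 1 = 2 := rfl
  have q2 : (1 : Fin 3) + 2 = 0 := rfl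
  have q3 : (2 : Fin 3) + 1 = 0 := rfl
  have q4 : (2 : Fin 3) + 2 = 1 := rfl
  have z10 : tri τ (f 1) (g 1) (g 2) = 0 :=
    eq_zero_of_rotation_le (D := tri τ (f 0) (g 1) (g 2)) fun α β hαβ => by
      have := m₂ _ _ (hF.rot_left (i := 0) (j := 1) (by decide) hαβ)
        (by rw [form_rot τ hαβ f (by decide)])
      simpa [rot, tri_add_left, tri_smul_left] using this
  have z20 : tri τ (f 2) (g 1) (g 2) = 0 :=
    eq_zero_of_rotation_le (D := tri τ (f 0) (g 1) (g 2)) fun α β hαβ => by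
      have := m₂ _ _ (hF.rot_left (i := 0) (j := 2) (by decide) hαβ)
        (by rw [form_rot τ hαβ f (by decide)])
      simpa [rot, tri_add_left, tri_smul_left] using this
  have z01 : tri τ (f 0) (g 0) (g 2) = 0 :=
    eq_zero_of_rotation_le (D := tri τ (f 0) (g 1) (g 2)) fun α β hαβ => by
      have := m₂ _ _ (hF.rot_right (i := 1) (j := 0) (by decide) hαβ) rfl
      simpa [rot, tri_add_mid, tri_smul_mid] using this
  have z02 : tri τ (f 0) (g 1) (g 0) = 0 :=
    eq_zero_of_rotation_le (D := tri τ (f 0) (g 1) (g 2)) fun α β hαβ => by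
      have := m₂ _ _ (hF.rot_right (i := 2) (j := 0) (by decide) hαβ) rfl
      simpa [rot, tri_add_right, tri_smul_right] using this
  have z21 : tri τ (f 2) (g 2) (g 0) = 0 :=
    eq_zero_of_rotation_le (D := tri τ (f 1) (g 2) (g 0)) fun α β hαβ => by
      have := m₃ _ _ (hF.rot_left (i := 1) (j := 2) (by decide) hαβ)
        (by rw [form_rot τ hαβ f (by decide)]) (by simp [rot])
      simpa [rot, tri_add_left, tri_smul_left] using this
  -- The rotation of `g 2, g 1` has determinant one, so the entry `(0, 0)` is kept and the third
  -- stage of the maximization applies.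
  have z12 : tri τ (f 1) (g 1) (g 0) = 0 :=
    eq_zero_of_rotation_le (D := tri τ (f 1) (g 2) (g 0)) fun α β hαβ => by
      have hαβ' : ‖conj α‖ ^ 2 + ‖-conj β‖ ^ 2 = 1 := by simpa using hαβ
      have := m₃ _ _ (hF.rot_right (i := 2) (j := 1) (by decide) hαβ) rfl (by
        have := tri_rot_first τ hαβ (f 0) (g 2) (g 1)
        rw [tri_swap_right, tri_swap_right τ (f 0) (g 2), neg_inj] at this
        simpa [rot] using congrArg norm this)
      simpa [rot, tri_add_mid, tri_smul_mid] using this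
  refine ⟨f, g, hF, fun h ho => ?_, ?_, ?_, ?_⟩
  · obtain ⟨k, hk⟩ := exists_frame_extension hE ho
    exact m₁ h k hk
  · intro i j hij
    rw [block, Matrix.of_apply]
    fin_cases i <;> fin_cases j <;>
      simp only [Fin.zero_eta, Fin.mk_one, Fin.reduceFinMk, Fin.isValue, zero_add, q1, q2, q3, q4,
        ne_eq, not_true_eq_false] at hij ⊢
    · rw [tri_swap_right, z01, neg_zero]
    · rw [tri_swap_right, z02, neg_zero]
    · exact z10
    · rw [tri_swap_right, z12, neg_zero]
    · exact z20
    · exact z21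
  · have := m₂ (f ∘ ![1, 0, 2]) (g ∘ ![1, 0, 2]) (hF.comp (by decide) (by decide)) (by
      rw [form_eq_tri, form_eq_tri τ f, tri_swap_left, norm_neg]; rfl)
    simp only [block, Matrix.of_apply, q1, q2, zero_add]
    rw [tri_swap_right, norm_neg]
    exact this
  · have := m₃ (f ∘ ![0, 2, 1]) (g ∘ ![0, 2, 1]) (hF.comp (by decide) (by decide)) (by
      rw [form_eq_tri, form_eq_tri τ f, tri_swap_right, norm_neg]; rfl) (by
      rw [tri_swap_right, norm_neg]; rfl)
    simp only [block, Matrix.of_apply, q1, q2, q3, q4]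
    rw [tri_swap_right, norm_neg]
    exact this

/-- Every form has canonical coordinates in some frame. -/
theorem exists_canon (hE : finrank ℂ E = 6) (τ : E [⋀^Fin 3]→ₗ[ℂ] ℂ) :
    ∃ (f g : Fin 3 → E) (p : Point), Canon τ f g p ∧ Bounded τ p.d ∧ 0 ≤ p.d ∧
      p.b ≤ p.a ∧ p.c ≤ p.b ∧ 0 ≤ p.c ∧ 0 ≤ p.x := by
  obtain ⟨f, g, hF, hb, hoff, hab, hbc⟩ := exists_frame_block_diagonal hE τ
  obtain ⟨A, hA, eA⟩ := exists_unit_mul_eq_norm (block τ f g 0 0)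
  obtain ⟨B, hB, eB⟩ := exists_unit_mul_eq_norm (block τ f g 1 1)
  obtain ⟨C, hC, eC⟩ := exists_unit_mul_eq_norm (block τ f g 2 2)
  obtain ⟨D, hD, eD⟩ := exists_unit_mul_eq_norm (τ f)
  have A0 : A ≠ 0 := norm_ne_zero_iff.1 (by rw [hA]; norm_num)
  have B0 : B ≠ 0 := norm_ne_zero_iff.1 (by rw [hB]; norm_num)
  have C0 : C ≠ 0 := norm_ne_zero_iff.1 (by rw [hC]; norm_num)
  have D0 : D ≠ 0 := norm_ne_zero_iff.1 (by rw [hD]; norm_num)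
  -- With phases `A, B / ν, C / ν` on `f` and `ν, 1, 1` on `g` the diagonal block entries receive
  -- `A, B, C`. Then `τ f` receives `A B C / ν²`, which has to be `D`. The free sign of `ν` settles
  -- the sign of the real part.
  obtain ⟨ν, hν, hre⟩ : ∃ ν : ℂ, ν ^ 2 = A * B * C / D ∧ 0 ≤ (ν * τ g).re := by
    obtain ⟨ν, hν⟩ := IsAlgClosed.exists_pow_nat_eq (A * B * C / D) (n := 2) (by norm_num)
    rcases le_total 0 (ν * τ g).re with h | h
    · exact ⟨ν, hν, h⟩
    · exact ⟨-ν, by rw [neg_sq, hν], by rw [neg_mul, Complex.neg_re]; linarith⟩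
  have hν1 : ‖ν‖ = 1 := by
    have := congrArg norm hν
    rw [norm_pow, norm_div, norm_mul, norm_mul, hA, hB, hC, hD] at this
    exact (pow_eq_one_iff_of_nonneg (norm_nonneg _) two_ne_zero).1 (by simpa using this)
  have ν0 : ν ≠ 0 := norm_ne_zero_iff.1 (by rw [hν1]; norm_num)
  have hν' : ν ^ 2 * D = A * B * C := by rw [hν]; field_simp
  let r : Fin 3 → ℂ := ![A, B / ν, C / ν]
  let s : Fin 3 → ℂ := ![ν, 1, 1]
  have hr : ∀ i, ‖r i‖ = 1 := by intro i; fin_cases i <;> simp [r, hA, hB, hC, hν1]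
  have hs : ∀ i, ‖s i‖ = 1 := by intro i; fin_cases i <;> simp [s, hν1]
  have hF' := hF.smul hr hs
  have hτ : τ (fun i => r i • f i) = ‖τ f‖ := by
    rw [form_smul_fin, ← eD]
    have : r 0 * r 1 * r 2 = D := by
      simp only [r, Matrix.cons_val]
      field_simp
      linear_combination -hν'
    rw [this]
  refine ⟨_, _, (‖block τ f g 0 0‖, ‖block τ f g 1 1‖, ‖block τ f g 2 2‖, ‖τ f‖,
    conj (ν * τ g)), ⟨hF', ?_, hτ, ?_, ?_⟩, hb, norm_nonneg _, hab, hbc, norm_nonneg _, ?_⟩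
  · ext i j
    rw [block_smul]
    by_cases hij : i = j
    · subst hij
      rw [Matrix.diagonal_apply_eq]
      fin_cases i
      · simpa [r, s] using eA
      · have : (1 : Fin 3) + 2 = 0 := rfl
        simp [r, s, this, ν0, eB]
      · have : (2 : Fin 3) + 1 = 0 := rfl
        have : (2 : Fin 3) + 2 = 1 := rfl
        simp [r, s, *]
    · rw [hoff i j hij, Matrix.diagonal_apply_ne _ hij, mul_zero]
  · rw [form_smul_fin]
    change _ = conj (conj (ν * τ g))
    rw [Complex.conj_conj]
    simp [s]
  · intro i j
    exact tri_eq_zero_of_orthogonal hb hF'.left (by simp [hτ]) (fun k => hF'.cross k i) j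
  · change 0 ≤ (conj (ν * τ g)).re
    rw [Complex.conj_re]
    exact hre

end Existence

/-! ### Invariants of the span of the first triple -/

section FrameChange

variable {E : Type*} [NormedAddCommGroup E] [InnerProductSpace ℂ E]

theorem tri_combination (τ : E [⋀^Fin 3]→ₗ[ℂ] ℂ) (u : E) (x y : Fin 3 → ℂ) (g : Fin 3 → E) :
    tri τ u (∑ l, x l • g l) (∑ l, y l • g l) =
      ∑ l, (x (l + 1) * y (l + 2) - x (l + 2) * y (l + 1)) * tri τ u (g (l + 1)) (g (l + 2)) := by
  have q1 : (1 : Fin 3) + 1 = 2 := rfl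
  have q2 : (1 : Fin 3) + 2 = 0 := rfl
  have q3 : (2 : Fin 3) + 1 = 0 := rfl
  have q4 : (2 : Fin 3) + 2 = 1 := rfl
  simp only [Fin.sum_univ_three, tri_add_mid, tri_add_right, tri_smul_mid, tri_smul_right,
    tri_self_right, q1, q2, q3, q4, zero_add]
  rw [tri_swap_right τ u (g 2) (g 1), tri_swap_right τ u (g 0) (g 2), tri_swap_right τ u (g 1) (g 0)]
  ring

theorem tri_sum_left (τ : E [⋀^Fin 3]→ₗ[ℂ] ℂ) (v w : E) (x : Fin 3 → ℂ) (f : Fin 3 → E) :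
    tri τ (∑ l, x l • f l) v w = ∑ l, x l * tri τ (f l) v w := by
  simp only [Fin.sum_univ_three, tri_add_left, tri_smul_left]

theorem form_sum (τ : E [⋀^Fin 3]→ₗ[ℂ] ℂ) (P : Matrix (Fin 3) (Fin 3) ℂ) (f : Fin 3 → E) :
    τ (fun i => ∑ j, P i j • f j) = P.det * τ f := by
  have q1 : (1 : Fin 3) + 1 = 2 := rfl
  have q2 : (1 : Fin 3) + 2 = 0 := rfl
  have q3 : (2 : Fin 3) + 1 = 0 := rfl
  have q4 : (2 : Fin 3) + 2 = 1 := rfl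
  rw [form_eq_tri, tri_combination, Matrix.det_fin_three]
  simp only [tri_sum_left]
  simp only [Fin.sum_univ_three, q1, q2, q3, q4, zero_add, tri_self_left, tri_self_outer]
  rw [← tri_cyc τ (f 0) (f 1) (f 2), tri_cyc τ (f 2) (f 0) (f 1), ← form_eq_tri]
  ring

/-- Two arguments come from the second triple, so `Q` acts through its `2 × 2` minors, that is,
through the adjugate. -/
theorem block_sum (τ : E [⋀^Fin 3]→ₗ[ℂ] ℂ) (P Q : Matrix (Fin 3) (Fin 3) ℂ) (f g : Fin 3 → E) :
    block τ (fun i => ∑ j, P i j • f j) (fun i => ∑ j, Q i j • g j) =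
      P * block τ f g * Q.adjugate := by
  have q1 : (1 : Fin 3) + 1 = 2 := rfl
  have q2 : (1 : Fin 3) + 2 = 0 := rfl
  have q3 : (2 : Fin 3) + 1 = 0 := rfl
  have q4 : (2 : Fin 3) + 2 = 1 := rfl
  ext i j
  rw [block, Matrix.of_apply, tri_combination]
  simp only [tri_sum_left]
  rw [Matrix.mul_apply]
  simp only [Matrix.mul_apply, Matrix.adjugate_fin_three, block, Matrix.of_apply,
    Fin.sum_univ_three, q1, q2, q3, q4, zero_add]
  fin_cases j <;>
    simp only [Fin.zero_eta, Fin.mk_one, Fin.reduceFinMk, Fin.isValue, q1, q2, q3, q4, zero_add,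
      Matrix.cons_val', Matrix.cons_val_zero, Matrix.cons_val_one, Matrix.cons_val_fin_one,
      Matrix.cons_val] <;>
    ring

theorem expand_of_cross {f g v : Fin 3 → E} (hE : finrank ℂ E = 6) (h : Frame f g)
    (hv : ∀ i j, inner ℂ (g j) (v i) = 0) (i : Fin 3) :
    v i = ∑ j, inner ℂ (f j) (v i) • f j := by
  have := h.expand hE (v i)
  simpa [hv] using this

theorem transition_unitary {f v : Fin 3 → E} (hv : Orthonormal ℂ v)
    (e : ∀ i, v i = ∑ j, inner ℂ (f j) (v i) • f j) :
    (Matrix.of fun i j => inner ℂ (f j) (v i)) *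
      (Matrix.of fun i j => inner ℂ (f j) (v i)).conjTranspose = 1 := by
  ext i k
  rw [Matrix.mul_apply, Matrix.one_apply]
  have := orthonormal_iff_ite.1 hv k i
  have h2 : inner ℂ (v k) (v i) = ∑ j, inner ℂ (f j) (v i) * conj (inner ℂ (f j) (v k)) := by
    conv_lhs => rw [e i]
    rw [inner_sum]
    exact Finset.sum_congr rfl fun j _ => by rw [inner_smul_right, inner_conj_symm]
  rw [h2] at this
  simpa [eq_comm] using this

/-- Two frames whose first triples span the same space are related by two unitary matrices. -/
theorem exists_transition (hE : finrank ℂ E = 6) {f g f' g' : Fin 3 → E} (h : Frame f g)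
    (h' : Frame f' g') (hs : ∀ i j, inner ℂ (g j) (f' i) = 0) :
    ∃ P Q : Matrix (Fin 3) (Fin 3) ℂ, P * P.conjTranspose = 1 ∧ Q * Q.conjTranspose = 1 ∧
      (∀ i, f' i = ∑ j, P i j • f j) ∧ (∀ i, g' i = ∑ j, Q i j • g j) := by
  have ef := expand_of_cross hE h hs
  have uP := transition_unitary h'.left ef
  set P : Matrix (Fin 3) (Fin 3) ℂ := Matrix.of fun i j => inner ℂ (f j) (f' i) with hP
  have uP' : P.conjTranspose * P = 1 := mul_eq_one_comm.1 uP
  have eb : ∀ j, f j = ∑ k, conj (P k j) • f' k := by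
    intro j
    have h1 : ∀ l, ∑ k, conj (P k j) * P k l = if j = l then 1 else 0 := fun l => by
      have := congrFun (congrFun uP' j) l
      rwa [Matrix.mul_apply, Matrix.one_apply] at this
    have : ∑ k, conj (P k j) • f' k = ∑ l, (∑ k, conj (P k j) * P k l) • f l := by
      simp only [Finset.sum_smul]
      rw [Finset.sum_comm]
      refine Finset.sum_congr rfl fun k _ => ?_
      conv_lhs => rw [ef k]
      rw [Finset.smul_sum]
      exact Finset.sum_congr rfl fun l _ => by rw [smul_smul]; rfl
    rw [this]
    simp [h1]
  have hs' : ∀ i j, inner ℂ (f j) (g' i) = 0 := by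
    intro i j
    rw [eb j, sum_inner]
    exact Finset.sum_eq_zero fun k _ => by rw [inner_smul_left, h'.cross, mul_zero]
  have eg := expand_of_cross hE h.symm hs'
  exact ⟨P, _, uP, transition_unitary h'.right eg, ef, eg⟩

/-- The invariants of a form relative to the space spanned by the first triple of a frame. -/
theorem transition_invariants (hE : finrank ℂ E = 6) (τ : E [⋀^Fin 3]→ₗ[ℂ] ℂ)
    {f g f' g' : Fin 3 → E} (h : Frame f g)
    (h' : Frame f' g') (hs : ∀ i j, inner ℂ (g j) (f' i) = 0) :
    (block τ f' g' * (block τ f' g').conjTranspose).charpoly =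
      (block τ f g * (block τ f g).conjTranspose).charpoly ∧
    ‖τ f'‖ = ‖τ f‖ ∧ ‖τ g'‖ = ‖τ g‖ ∧
    τ g' ^ 2 * τ f' * conj (block τ f' g').det = τ g ^ 2 * τ f * conj (block τ f g).det := by
  obtain ⟨P, Q, uP, uQ, ef, eg⟩ := exists_transition hE h h' hs
  have uP' : P.conjTranspose * P = 1 := mul_eq_one_comm.1 uP
  have uQ' : Q.conjTranspose * Q = 1 := mul_eq_one_comm.1 uQ
  have ef : f' = fun i => ∑ j, P i j • f j := funext ef
  have eg : g' = fun i => ∑ j, Q i j • g j := funext eg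
  have dP : P.det * conj P.det = 1 := by
    have := congrArg Matrix.det uP
    rwa [Matrix.det_mul, Matrix.det_conjTranspose, Matrix.det_one] at this
  have dQ : Q.det * conj Q.det = 1 := by
    have := congrArg Matrix.det uQ
    rwa [Matrix.det_mul, Matrix.det_conjTranspose, Matrix.det_one] at this
  have norm_one : ∀ w : ℂ, w * conj w = 1 → ‖w‖ = 1 := fun w hw => by
    rw [Complex.mul_conj'] at hw
    exact (pow_eq_one_iff_of_nonneg (norm_nonneg _) two_ne_zero).1 (by exact_mod_cast hw)
  have hb : block τ f' g' = P * block τ f g * Q.adjugate := by rw [ef, eg, block_sum]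
  have hf : τ f' = P.det * τ f := by rw [ef, form_sum]
  have hg : τ g' = Q.det * τ g := by rw [eg, form_sum]
  have ua : Q.adjugate * Q.adjugate.conjTranspose = 1 := by
    rw [Matrix.adjugate_conjTranspose, ← Matrix.adjugate_mul_distrib, uQ', Matrix.adjugate_one]
  refine ⟨?_, ?_, ?_, ?_⟩
  · have e : block τ f' g' * (block τ f' g').conjTranspose =
        P * (block τ f g * (block τ f g).conjTranspose * P.conjTranspose) := by
      rw [hb, Matrix.conjTranspose_mul, Matrix.conjTranspose_mul]
      calc P * block τ f g * Q.adjugate *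
            (Q.adjugate.conjTranspose * ((block τ f g).conjTranspose * P.conjTranspose))
          = P * block τ f g * (Q.adjugate * Q.adjugate.conjTranspose) *
            ((block τ f g).conjTranspose * P.conjTranspose) := by simp only [Matrix.mul_assoc]
        _ = _ := by rw [ua, Matrix.mul_one]; simp only [Matrix.mul_assoc]
    rw [e, Matrix.charpoly_mul_comm, Matrix.mul_assoc, uP', Matrix.mul_one]
  · rw [hf, norm_mul, norm_one _ dP, one_mul]
  · rw [hg, norm_mul, norm_one _ dQ, one_mul]
  -- The determinant of the block acquires the factor `det P (det Q)²`, the same phase as `τ g ^ 2 *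
  -- τ f`; conjugation makes them cancel.
  · have da : Q.adjugate.det = Q.det ^ 2 := by simp [Matrix.det_adjugate]
    rw [hb, hf, hg, Matrix.det_mul, Matrix.det_mul, da, map_mul, map_mul, map_pow]
    have : (P.det * conj P.det) * (Q.det * conj Q.det) ^ 2 = 1 := by rw [dP, dQ]; ring
    linear_combination (τ g ^ 2 * τ f * conj (block τ f g).det) * this

theorem diagonal_mul_conjTranspose (m : Fin 3 → ℂ) :
    Matrix.diagonal m * (Matrix.diagonal m).conjTranspose =
      Matrix.diagonal fun i => ((‖m i‖ ^ 2 : ℝ) : ℂ) := by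
  rw [Matrix.diagonal_conjTranspose, Matrix.diagonal_mul_diagonal]
  congr 1
  ext i
  simp [Complex.mul_conj']

/-- Elementary symmetric functions of the eigenvalues of a diagonal matrix. -/
theorem esymm_of_charpoly_diagonal {r s : Fin 3 → ℝ}
    (h : (Matrix.diagonal fun i => (r i : ℂ)).charpoly =
      (Matrix.diagonal fun i => (s i : ℂ)).charpoly) :
    r 0 + r 1 + r 2 = s 0 + s 1 + s 2 ∧
    r 0 * r 1 + r 0 * r 2 + r 1 * r 2 = s 0 * s 1 + s 0 * s 2 + s 1 * s 2 ∧
    r 0 * r 1 * r 2 = s 0 * s 1 * s 2 := by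
  rw [Matrix.charpoly_diagonal, Matrix.charpoly_diagonal] at h
  have key : ∀ x : ℝ, (x - r 0) * (x - r 1) * (x - r 2) = (x - s 0) * (x - s 1) * (x - s 2) := by
    intro x
    have := congrArg (Polynomial.eval (x : ℂ)) h
    simp only [Fin.prod_univ_three, Polynomial.eval_mul, Polynomial.eval_sub, Polynomial.eval_X,
      Polynomial.eval_C] at this
    exact_mod_cast this
  have h0 := key 0
  have h1 := key 1
  have h2 := key (-1)
  refine ⟨?_, ?_, ?_⟩ <;> linarith

end FrameChange

/-! ### Two maximizing triples in principal position -/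

theorem fin_add_one_add_one (i : Fin 3) : i + 1 + 1 = i + 2 := by decide +revert

theorem fin_add_one_add_two (i : Fin 3) : i + 1 + 2 = i := by decide +revert

theorem fin_add_two_add_one (i : Fin 3) : i + 2 + 1 = i := by decide +revert

theorem fin_add_two_add_two (i : Fin 3) : i + 2 + 2 = i + 1 := by decide +revert

theorem fin_eq_add_of_ne {i j : Fin 3} (h : j ≠ i) : j = i + 1 ∨ j = i + 2 := by decide +revert

section Pair

variable {E : Type*} [NormedAddCommGroup E] [InnerProductSpace ℂ E]

theorem tri_pair_eq_zero {τ : E [⋀^Fin 3]→ₗ[ℂ] ℂ} {x : E} {k : Fin 3 → E}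
    (hk : ∀ j, tri τ x (k (j + 1)) (k (j + 2)) = 0) (i j : Fin 3) : tri τ x (k i) (k j) = 0 := by
  by_cases hij : i = j
  · rw [hij, tri_self_right]
  · have h1 := hk (i + 2)
    have h2 := hk (i + 1)
    rw [fin_add_two_add_one, fin_add_two_add_two] at h1
    rw [fin_add_one_add_one, fin_add_one_add_two] at h2
    rcases fin_eq_add_of_ne (Ne.symm hij) with rfl | rfl
    · exact h1
    · rw [tri_swap_right, h2, neg_zero]

/-- The second triple of the frame obtained by turning the vectors of a frame in the planes spanned
by corresponding vectors. -/
def turnRight (c s : Fin 3 → ℝ) (f g : Fin 3 → E) : Fin 3 → E :=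
  fun i => (s i : ℂ) • f i - (c i : ℂ) • g i

/-- The first triple of the turned frame. -/
def turnLeft (c s : Fin 3 → ℝ) (f g : Fin 3 → E) : Fin 3 → E :=
  fun i => (c i : ℂ) • f i + (s i : ℂ) • g i

variable {c s : Fin 3 → ℝ} {f g : Fin 3 → E}

/-- In each plane the turn is the reflection with rows `(c, s)` and `(s, -c)`, an involution. Every
relation for the turned triple can thus be read backwards with the two triples exchanged. -/
theorem turn_turn_left (hcs : ∀ i, c i ^ 2 + s i ^ 2 = 1) :
    turnLeft c s (turnLeft c s f g) (turnRight c s f g) = f := by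
  ext i
  have : (c i : ℂ) * c i + s i * s i = 1 := by exact_mod_cast (by linarith [hcs i])
  simp only [turnLeft, turnRight, smul_add, smul_sub, smul_smul]
  rw [mul_comm (c i : ℂ) (s i : ℂ)]
  calc _ = ((c i : ℂ) * c i + s i * s i) • f i := by rw [add_smul]; abel
    _ = f i := by rw [this, one_smul]

theorem Frame.turn (h : Frame f g) (hcs : ∀ i, c i ^ 2 + s i ^ 2 = 1) :
    Frame (turnLeft c s f g) (turnRight c s f g) := by
  have hf := orthonormal_iff_ite.1 h.left
  have hg := orthonormal_iff_ite.1 h.right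
  have h1 : ∀ i, (c i : ℂ) * c i + s i * s i = 1 := fun i => by
    exact_mod_cast (by linarith [hcs i])
  refine ⟨orthonormal_iff_ite.2 fun i j => ?_, orthonormal_iff_ite.2 fun i j => ?_, fun i j => ?_⟩
  · simp only [turnLeft, inner_add_left, inner_add_right, inner_smul_left, inner_smul_right, hf, hg,
      h.cross, h.cross', Complex.conj_ofReal]
    split_ifs with hij
    · subst hij; linear_combination h1 i
    · ring
  · simp only [turnRight, inner_sub_left, inner_sub_right, inner_smul_left, inner_smul_right, hf,
      hg, h.cross, h.cross', Complex.conj_ofReal]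
    split_ifs with hij
    · subst hij; linear_combination h1 i
    · ring
  · simp only [turnLeft, turnRight, inner_add_left, inner_sub_right, inner_smul_left,
      inner_smul_right, hf, hg, h.cross, h.cross', Complex.conj_ofReal]
    split_ifs with hij
    · subst hij; ring
    · ring

variable {τ : E [⋀^Fin 3]→ₗ[ℂ] ℂ} {d : ℝ}

/-- This is `tri_eq_inner_mul` at the turned triple, evaluated at `f j`. The mixed terms of the
expansion vanish because `f` is maximizing as well. -/
theorem turn_block (h : Frame f g) (hcs : ∀ i, c i ^ 2 + s i ^ 2 = 1) (hτ : Bounded τ d)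
    (hd : ‖τ f‖ = d) (hd' : ‖τ (turnLeft c s f g)‖ = d) (j k : Fin 3) :
    (s (k + 1) : ℂ) * s (k + 2) * block τ f g j k =
      if j = k then c k * τ (turnLeft c s f g) - c (k + 1) * c (k + 2) * τ f else 0 := by
  have hc : ∀ i j k, tri τ (g i) (f j) (f k) = 0 := fun i =>
    tri_pair_eq_zero (tri_eq_zero_of_orthogonal hτ h.left hd fun l => h.cross l i)
  have key := tri_eq_inner_mul hτ (h.turn hcs).left hd' (f j) k
  have hf := orthonormal_iff_ite.1 h.left k j
  have e1 : inner ℂ (turnLeft c s f g k) (f j) = c k * if j = k then (1 : ℂ) else 0 := by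
    simp only [turnLeft, inner_add_left, inner_smul_left, hf, h.cross', Complex.conj_ofReal,
      mul_zero, add_zero]
    simp only [eq_comm]
  have e2 : tri τ (f j) (f (k + 1)) (f (k + 2)) = if j = k then τ f else 0 := by
    split_ifs with hjk
    · rw [hjk, tri_cyc_fin]
    · rcases fin_eq_add_of_ne hjk with rfl | rfl
      · rw [tri_self_left]
      · rw [tri_self_outer]
  have e3 : tri τ (f j) (f (k + 1)) (g (k + 2)) = 0 := by rw [← tri_cyc, hc]
  have e4 : tri τ (f j) (g (k + 1)) (f (k + 2)) = 0 := by rw [tri_cyc, hc]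
  have e5 : tri τ (f j) (g (k + 1)) (g (k + 2)) = block τ f g j k := rfl
  rw [e1] at key
  conv_lhs at key => rw [turnLeft, turnLeft]
  simp only [tri_add_mid, tri_add_right, tri_smul_mid, tri_smul_right, e2, e3, e4, e5] at key
  split_ifs at key ⊢
  · linear_combination key
  · linear_combination key

/-- The companion of `turn_block`: the same stationarity condition, evaluated at `g k`. -/
theorem turn_right (h : Frame f g) (hcs : ∀ i, c i ^ 2 + s i ^ 2 = 1) (hτ : Bounded τ d)
    (hd : ‖τ f‖ = d) (hd' : ‖τ (turnLeft c s f g)‖ = d) (k : Fin 3) :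
    (c (k + 1) : ℂ) * s (k + 2) * block τ f g (k + 1) (k + 1) +
      s (k + 1) * c (k + 2) * block τ f g (k + 2) (k + 2) +
      s (k + 1) * s (k + 2) * τ g = s k * τ (turnLeft c s f g) := by
  have hc : ∀ i j k, tri τ (g i) (f j) (f k) = 0 := fun i =>
    tri_pair_eq_zero (tri_eq_zero_of_orthogonal hτ h.left hd fun l => h.cross l i)
  have key := tri_eq_inner_mul hτ (h.turn hcs).left hd' (g k) k
  have e1 : inner ℂ (turnLeft c s f g k) (g k) = s k := by
    simp only [turnLeft, inner_add_left, inner_smul_left, h.cross, Complex.conj_ofReal,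
      orthonormal_iff_ite.1 h.right k k, if_true, mul_zero, zero_add, mul_one]
  have e2 : tri τ (g k) (f (k + 1)) (g (k + 2)) = block τ f g (k + 1) (k + 1) := by
    rw [tri_cyc, block, Matrix.of_apply, fin_add_one_add_one, fin_add_one_add_two]
  have e3 : tri τ (g k) (g (k + 1)) (f (k + 2)) = block τ f g (k + 2) (k + 2) := by
    rw [← tri_cyc, block, Matrix.of_apply, fin_add_two_add_one, fin_add_two_add_two]
  rw [e1] at key
  conv_lhs at key => rw [turnLeft, turnLeft]
  simp only [tri_add_mid, tri_add_right, tri_smul_mid, tri_smul_right, e2, e3, hc,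
    tri_cyc_fin] at key
  linear_combination key

/-- Two different maximizing triples which agree in one direction have a large block entry. -/
theorem turn_degenerate (h : Frame f g) (hcs : ∀ i, c i ^ 2 + s i ^ 2 = 1) (hs : ∀ i, 0 ≤ s i)
    (hτ : Bounded τ d) (hd : ‖τ f‖ = d) (hd' : ‖τ (turnLeft c s f g)‖ = d) (hd0 : 0 < d)
    {k : Fin 3} (hk : s k = 0) : (∀ i, s i = 0) ∨ ‖block τ f g k k‖ = d := by
  have h1 := turn_right h hcs hτ hd hd' (k + 1)
  have h2 := turn_right h hcs hτ hd hd' (k + 2)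
  rw [fin_add_one_add_one, fin_add_one_add_two, hk] at h1
  rw [fin_add_two_add_one, fin_add_two_add_two, hk] at h2
  have hck : |c k| = 1 := by
    have := hcs k
    rw [hk] at this
    exact (pow_eq_one_iff_of_nonneg (abs_nonneg _) two_ne_zero).1 (by rw [sq_abs]; linarith)
  -- When `s k = 0`, the two remaining sines are interchanged by multiplication with `‖block τ f g k
  -- k‖ / d`. Hence either both vanish or this factor is one.
  have n1 := congrArg norm (show (s (k + 2) : ℂ) * c k * block τ f g k k =
    s (k + 1) * τ (turnLeft c s f g) by rw [← h1]; push_cast; ring)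
  have n2 := congrArg norm (show (s (k + 1) : ℂ) * c k * block τ f g k k =
    s (k + 2) * τ (turnLeft c s f g) by rw [← h2]; push_cast; ring)
  simp only [norm_mul, Complex.norm_real, Real.norm_eq_abs, hck, mul_one, hd',
    abs_of_nonneg (hs _)] at n1 n2
  by_cases hz : s (k + 1) = 0
  · left
    have : s (k + 2) = 0 := by
      rw [hz, zero_mul] at n2
      rcases mul_eq_zero.1 n2.symm with h | h
      · exact h
      · exact absurd h hd0.ne'
    intro i
    by_cases hik : i = k
    · rw [hik, hk]
    · rcases fin_eq_add_of_ne hik with rfl | rfl <;> assumption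
  · right
    have hp : 0 < s (k + 1) := lt_of_le_of_ne (hs _) (Ne.symm hz)
    have e : s (k + 1) * (‖block τ f g k k‖ ^ 2 - d ^ 2) = 0 := by
      linear_combination ‖block τ f g k k‖ * n2 + d * n1
    rcases mul_eq_zero.1 e with h | h
    · exact absurd h hz
    · have := norm_nonneg (block τ f g k k)
      nlinarith

theorem mul_conj_of_norm {w : ℂ} {d : ℝ} (h : ‖w‖ = d) : w * conj w = (d : ℂ) ^ 2 := by
  rw [Complex.mul_conj', h]

/-- Two maximizing triples in general position have complex conjugate coordinates. -/
theorem turn_conj (h : Frame f g) (hcs : ∀ i, c i ^ 2 + s i ^ 2 = 1) (hs : ∀ i, s i ≠ 0)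
    (hτ : Bounded τ d) (hd : ‖τ f‖ = d) (hd' : ‖τ (turnLeft c s f g)‖ = d) :
    (∀ i j, i ≠ j → block τ f g i j = 0) ∧
    (∀ i j, i ≠ j → block τ (turnLeft c s f g) (turnRight c s f g) i j = 0) ∧
    (∀ i, conj (τ f) * block τ (turnLeft c s f g) (turnRight c s f g) i i =
      τ (turnLeft c s f g) * conj (block τ f g i i)) ∧
    conj (τ f) * τ (turnRight c s f g) = τ (turnLeft c s f g) * conj (τ g) := by
  have hs' : ∀ i, (s i : ℂ) ≠ 0 := fun i => by exact_mod_cast hs i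
  have h' := h.turn hcs
  have b := turn_block h hcs hτ hd hd'
  have r := turn_right h hcs hτ hd hd' 0
  have b' := turn_block h' hcs hτ hd' (by rw [turn_turn_left hcs, hd])
  have r' := turn_right h' hcs hτ hd' (by rw [turn_turn_left hcs, hd]) 0
  rw [turn_turn_left hcs] at r'
  simp only [turn_turn_left hcs] at b'
  set D := τ f
  set D' := τ (turnLeft c s f g)
  have hD := mul_conj_of_norm hd
  have hD' := mul_conj_of_norm hd'
  refine ⟨fun i j hij => ?_, fun i j hij => ?_, fun i => ?_, ?_⟩
  · have := b i j
    rw [if_neg hij] at this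
    simpa [hs'] using this
  · have := b' i j
    rw [if_neg hij] at this
    simpa [hs'] using this
  -- The relation `b'` is `b` with `D` and `D'` exchanged. After multiplying it by `conj D`, and the
  -- conjugate of `b` by `D'`, both right-hand sides agree since `|D| = |D'|`.
  · have e1 := congrArg conj (b i i)
    have e2 := b' i i
    rw [if_pos rfl] at e1 e2
    simp only [map_sub, map_mul, Complex.conj_ofReal] at e1
    refine mul_left_cancel₀ (mul_ne_zero (hs' (i + 1)) (hs' (i + 2))) ?_
    linear_combination conj D * e2 - D' * e1 + c i * hD - c i * hD'
  · have q1 : (1 : Fin 3) + 1 = 2 := rfl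
    have q2 : (1 : Fin 3) + 2 = 0 := rfl
    have q3 : (2 : Fin 3) + 1 = 0 := rfl
    have q4 : (2 : Fin 3) + 2 = 1 := rfl
    have e1 := b 1 1
    have e2 := b 2 2
    have f1 := b' 1 1
    have f2 := b' 2 2
    rw [if_pos rfl] at e1 e2 f1 f2
    simp only [zero_add, q1, q2, q3, q4] at r r' e1 e2 f1 f2
    have k1 : (s 0 : ℂ) * s 1 * s 2 * τ g =
        (s 0 ^ 2 - c 1 ^ 2 - c 2 ^ 2) * D' + 2 * c 0 * c 1 * c 2 * D := by
      linear_combination s 0 * r - c 1 * e1 - c 2 * e2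
    have k2 : (s 0 : ℂ) * s 1 * s 2 * τ (turnRight c s f g) =
        (s 0 ^ 2 - c 1 ^ 2 - c 2 ^ 2) * D + 2 * c 0 * c 1 * c 2 * D' := by
      linear_combination s 0 * r' - c 1 * f1 - c 2 * f2
    have k1' := congrArg conj k1
    simp only [map_add, map_sub, map_mul, map_pow, Complex.conj_ofReal, map_ofNat] at k1'
    refine mul_left_cancel₀ (mul_ne_zero (mul_ne_zero (hs' 0) (hs' 1)) (hs' 2)) ?_
    linear_combination conj D * k2 - D' * k1' + (s 0 ^ 2 - c 1 ^ 2 - c 2 ^ 2) * (hD - hD')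

end Pair

/-- In the application `a, b, c` are the cosines and `w`, `v` are `D' / D` and its conjugate. By
`turn_block` and `turn_right`, the `x`'s and `z` are the diagonal block entries and `τ g`, divided
by `D` and multiplied by sines; the `y`'s and `u` are their conjugates. The identity is `Φ = 0` with
the sines cleared from the denominators. -/
theorem turn_polynomial_identity {w v : ℂ} (hw : w * v = 1) (a b c : ℂ) :
    let S := (1 - a ^ 2) * (1 - b ^ 2) * (1 - c ^ 2)
    let x₀ := a * w - b * c
    let x₁ := b * w - c * a
    let x₂ := c * w - a * b
    let y₀ := a * v - b * c
    let y₁ := b * v - c * a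
    let y₂ := c * v - a * b
    let z := (1 - a ^ 2 - b ^ 2 - c ^ 2) * w + 2 * a * b * c
    let u := (1 - a ^ 2 - b ^ 2 - c ^ 2) * v + 2 * a * b * c
    let A := (1 - a ^ 2) * (x₀ * y₀) + (1 - b ^ 2) * (x₁ * y₁) + (1 - c ^ 2) * (x₂ * y₂)
    (S - A) * (S - A - z * u) - z ^ 2 * (y₀ * y₁ * y₂) - u ^ 2 * (x₀ * x₁ * x₂) -
      4 * (x₀ * y₀) * (x₁ * y₁) * (x₂ * y₂) = 0 := by
  intro S x₀ x₁ x₂ y₀ y₁ y₂ z u A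
  have hw0 : w ≠ 0 := left_ne_zero_of_mul_eq_one hw
  have hv : v = w⁻¹ := eq_inv_of_mul_eq_one_right hw
  subst hv
  simp only [S, x₀, x₁, x₂, y₀, y₁, y₂, z, u, A]
  field_simp
  ring

/-- The invariant `Φ` expressed by relative invariants of a maximizing triple vanishes when there is
a second maximizing triple in general position. -/
theorem phi_turn_eq_zero {c s : Fin 3 → ℝ} (hcs : ∀ i, c i ^ 2 + s i ^ 2 = 1) (hs : ∀ i, s i ≠ 0)
    {d : ℝ} (hd0 : 0 < d) {D D' Z : ℂ} {m : Fin 3 → ℂ} (hD : ‖D‖ = d) (hD' : ‖D'‖ = d)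
    (hm : ∀ k, (s (k + 1) : ℂ) * s (k + 2) * m k = c k * D' - c (k + 1) * c (k + 2) * D)
    (hZ : (c 1 : ℂ) * s 2 * m 1 + s 1 * c 2 * m 2 + s 1 * s 2 * Z = s 0 * D') :
    d ^ 2 * (d ^ 2 - (‖m 0‖ ^ 2 + ‖m 1‖ ^ 2 + ‖m 2‖ ^ 2)) *
      (d ^ 2 - (‖m 0‖ ^ 2 + ‖m 1‖ ^ 2 + ‖m 2‖ ^ 2) - ‖Z‖ ^ 2) -
      2 * (Z ^ 2 * D * conj (m 0 * m 1 * m 2)).re - 4 * (‖m 0‖ ^ 2 * ‖m 1‖ ^ 2 * ‖m 2‖ ^ 2) = 0 := by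
  have q1 : (1 : Fin 3) + 1 = 2 := rfl
  have q2 : (1 : Fin 3) + 2 = 0 := rfl
  have q3 : (2 : Fin 3) + 1 = 0 := rfl
  have q4 : (2 : Fin 3) + 2 = 1 := rfl
  have D0 : D ≠ 0 := norm_ne_zero_iff.1 (by rw [hD]; exact hd0.ne')
  have D0' : conj D ≠ 0 := by simpa using D0
  have hDD := mul_conj_of_norm hD
  have hDD' := mul_conj_of_norm hD'
  have hs' : ∀ i, (s i : ℂ) ≠ 0 := fun i => by exact_mod_cast hs i
  have hs2 : ∀ i, (1 - (c i : ℂ) ^ 2) = (s i : ℂ) ^ 2 := fun i => by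
    rw [sub_eq_iff_eq_add']; exact_mod_cast (hcs i).symm
  have m0 := hm 0
  have m1 := hm 1
  have m2 := hm 2
  simp only [zero_add, q1, q2, q3, q4] at m0 m1 m2
  have mZ : (s 0 : ℂ) * s 1 * s 2 * Z =
      (1 - c 0 ^ 2 - c 1 ^ 2 - c 2 ^ 2) * D' + 2 * c 0 * c 1 * c 2 * D := by
    linear_combination s 0 * hZ - c 1 * m1 - c 2 * m2 - D' * hs2 0
  have m0' := congrArg conj m0
  have m1' := congrArg conj m1
  have m2' := congrArg conj m2
  have mZ' := congrArg conj mZ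
  simp only [map_add, map_sub, map_mul, map_pow, Complex.conj_ofReal, map_ofNat, map_one] at m0' m1' m2' mZ'
  have hw : D' / D * (conj D' / conj D) = 1 := by
    rw [div_mul_div_comm, hDD, hDD', div_self]
    exact_mod_cast (by positivity)
  have key := turn_polynomial_identity hw (c 0) (c 1) (c 2)
  have x0 : (c 0 : ℂ) * (D' / D) - c 1 * c 2 = s 1 * s 2 * (m 0 / D) := by
    field_simp; linear_combination -m0
  have x1 : (c 1 : ℂ) * (D' / D) - c 2 * c 0 = s 2 * s 0 * (m 1 / D) := by
    field_simp; linear_combination -m1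
  have x2 : (c 2 : ℂ) * (D' / D) - c 0 * c 1 = s 0 * s 1 * (m 2 / D) := by
    field_simp; linear_combination -m2
  have y0 : (c 0 : ℂ) * (conj D' / conj D) - c 1 * c 2 = s 1 * s 2 * (conj (m 0) / conj D) := by
    field_simp; linear_combination -m0'
  have y1 : (c 1 : ℂ) * (conj D' / conj D) - c 2 * c 0 = s 2 * s 0 * (conj (m 1) / conj D) := by
    field_simp; linear_combination -m1'
  have y2 : (c 2 : ℂ) * (conj D' / conj D) - c 0 * c 1 = s 0 * s 1 * (conj (m 2) / conj D) := by
    field_simp; linear_combination -m2'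
  have z0 : (1 - c 0 ^ 2 - c 1 ^ 2 - c 2 ^ 2 : ℂ) * (D' / D) + 2 * c 0 * c 1 * c 2 =
      s 0 * s 1 * s 2 * (Z / D) := by
    field_simp; linear_combination -mZ
  have u0 : (1 - c 0 ^ 2 - c 1 ^ 2 - c 2 ^ 2 : ℂ) * (conj D' / conj D) + 2 * c 0 * c 1 * c 2 =
      s 0 * s 1 * s 2 * (conj Z / conj D) := by
    field_simp; linear_combination -mZ'
  simp only [x0, x1, x2, y0, y1, y2, z0, u0] at key
  simp only [hs2] at key
  have e0 := mul_conj_of_norm (w := m 0) rfl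
  have e1 := mul_conj_of_norm (w := m 1) rfl
  have e2 := mul_conj_of_norm (w := m 2) rfl
  have eZ := mul_conj_of_norm (w := Z) rfl
  rw [← Complex.ofReal_inj]
  have hre : ((2 * (Z ^ 2 * D * conj (m 0 * m 1 * m 2)).re : ℝ) : ℂ) =
      Z ^ 2 * D * (conj (m 0) * conj (m 1) * conj (m 2)) +
      conj Z ^ 2 * conj D * (m 0 * m 1 * m 2) := by
    rw [← Complex.add_conj]
    simp only [map_mul, map_pow, Complex.conj_conj]
  rw [Complex.ofReal_sub, Complex.ofReal_sub, hre]
  push_cast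
  rw [← hDD, ← e0, ← e1, ← e2, ← eZ]
  have hS : ((s 0 : ℂ) * s 1 * s 2) ^ 4 ≠ 0 :=
    pow_ne_zero _ (mul_ne_zero (mul_ne_zero (hs' 0) (hs' 1)) (hs' 2))
  refine (mul_eq_zero.1 ?_).resolve_left hS
  field_simp at key
  linear_combination key

/-! ### Principal vectors of two subspaces -/

section Principal

variable {E : Type*} [NormedAddCommGroup E] [InnerProductSpace ℂ E]

/-- Pairwise orthogonal vectors are nonnegative multiples of the vectors of an orthonormal basis. -/
theorem exists_orthonormalBasis_smul [FiniteDimensional ℂ E] {n : ℕ} (hn : finrank ℂ E = n)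
    {u : Fin n → E} (hu : ∀ i j, i ≠ j → inner ℂ (u i) (u j) = 0) :
    ∃ b : OrthonormalBasis (Fin n) ℂ E, ∀ i, u i = ((‖u i‖ : ℝ) : ℂ) • b i := by
  let s : Set (Fin n) := {i | u i ≠ 0}
  have ho : Orthonormal ℂ (s.domRestrict fun i => ((‖u i‖ : ℝ) : ℂ)⁻¹ • u i) := by
    refine ⟨fun ⟨i, hi⟩ => ?_, fun ⟨i, hi⟩ ⟨j, hj⟩ hij => ?_⟩
    · change ‖((‖u i‖ : ℝ) : ℂ)⁻¹ • u i‖ = 1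
      rw [norm_smul, norm_inv, Complex.norm_real, norm_norm,
        inv_mul_cancel₀ (norm_ne_zero_iff.2 hi)]
    · change inner ℂ (((‖u i‖ : ℝ) : ℂ)⁻¹ • u i) (((‖u j‖ : ℝ) : ℂ)⁻¹ • u j) = 0
      rw [inner_smul_left, inner_smul_right, hu i j fun h => hij (Subtype.ext h)]
      simp
  obtain ⟨b, hb⟩ := ho.exists_orthonormalBasis_extension_of_card_eq (by simp [hn])
  refine ⟨b, fun i => ?_⟩
  by_cases hi : u i = 0
  · simp [hi]
  · rw [hb i hi, smul_smul, mul_inv_cancel₀, one_smul]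
    simpa using hi

/-- Principal vectors of two three-dimensional subspaces of a six-dimensional space. -/
theorem exists_principal (hE : finrank ℂ E = 6) {f₀ g₀ f₁ g₁ : Fin 3 → E} (h₀ : Frame f₀ g₀)
    (h₁ : Frame f₁ g₁) : ∃ (f g : Fin 3 → E) (c s : Fin 3 → ℝ), Frame f g ∧
      (∀ i, c i ^ 2 + s i ^ 2 = 1) ∧ (∀ i, 0 ≤ s i) ∧
      (∀ i j, inner ℂ (g₀ j) (f i) = 0) ∧ (∀ i j, inner ℂ (g₁ j) (turnLeft c s f g i) = 0) := by
  have : FiniteDimensional ℂ E := Module.finite_of_finrank_pos (by omega)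
  set F := Submodule.span ℂ (Set.range f₀) with hF
  set G := Submodule.span ℂ (Set.range f₁) with hG
  have dF : finrank ℂ F = 3 := by
    rw [hF, finrank_span_eq_card h₀.left.linearIndependent, Fintype.card_fin]
  have dG : finrank ℂ G = 3 := by
    rw [hG, finrank_span_eq_card h₁.left.linearIndependent, Fintype.card_fin]
  have dF' : finrank ℂ Fᗮ = 3 := by
    have := F.finrank_add_finrank_orthogonal
    omega
  have perp : ∀ (u v : Fin 3 → E) (_ : Frame u v) (x : E), x ∈ Submodule.span ℂ (Set.range u) →
      ∀ j, inner ℂ (v j) x = 0 := by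
    intro u v huv x hx j
    induction hx using Submodule.span_induction with
    | mem x hx => obtain ⟨i, rfl⟩ := hx; exact huv.cross' j i
    | zero => exact inner_zero_right _
    | add x y _ _ hx hy => rw [inner_add_right, hx, hy, add_zero]
    | smul r x _ hx => rw [inner_smul_right, hx, mul_zero]
  -- The projection onto `F` compressed to `G`. Its orthonormal eigenvectors have mutually
  -- orthogonal projections to `F`, hence also to `Fᗮ`; the lengths of these projections are the
  -- cosines and sines.
  let T : G →ₗ[ℂ] G :=
    (G.orthogonalProjectionOnto ∘L F.starProjection ∘L G.subtypeL).toLinearMap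
  have hT : ∀ x y : G, inner ℂ x (T y) = inner ℂ (F.starProjection x) (F.starProjection y) := by
    intro x y
    change inner ℂ x (G.orthogonalProjectionOnto (F.starProjection y)) = _
    rw [Submodule.inner_orthogonalProjectionOnto_eq_of_mem_left,
      Submodule.inner_starProjection_left_eq_right,
      Submodule.starProjection_eq_self_iff.2 (Submodule.starProjection_apply_mem _ _)]
  have hsym : T.IsSymmetric := by
    intro x y
    rw [hT, ← inner_conj_symm, hT, inner_conj_symm]
  let b := hsym.eigenvectorBasis dG
  have hb : ∀ i j, i ≠ j →
      inner ℂ (F.starProjection (b i)) (F.starProjection (b j)) = 0 := by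
    intro i j hij
    rw [← hT, hsym.apply_eigenvectorBasis dG, inner_smul_right, b.orthonormal.2 hij, mul_zero]
  have hadd : ∀ x : E, x = F.starProjection x + Fᗮ.starProjection x := fun x =>
    (F.starProjection_add_starProjection_orthogonal x).symm
  have hmix : ∀ x y : E, inner ℂ (F.starProjection x) (Fᗮ.starProjection y) = 0 := fun x y =>
    Submodule.inner_right_of_mem_orthogonal (Submodule.starProjection_apply_mem _ _)
      (Submodule.starProjection_apply_mem _ _)
  have hmix' : ∀ x y : E, inner ℂ (Fᗮ.starProjection x) (F.starProjection y) = 0 := fun x y =>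
    inner_eq_zero_symm.1 (hmix y x)
  have hb' : ∀ i j, i ≠ j →
      inner ℂ (Fᗮ.starProjection (b i)) (Fᗮ.starProjection (b j)) = 0 := by
    intro i j hij
    have h1 : inner ℂ ((b i : G) : E) ((b j : G) : E) = 0 := b.orthonormal.2 hij
    rw [hadd (b i), hadd (b j)] at h1
    simp only [inner_add_left, inner_add_right, hmix, hmix', hb i j hij, zero_add, add_zero] at h1
    exact h1
  obtain ⟨p, hp⟩ := exists_orthonormalBasis_smul dF
    (u := fun i => ⟨F.starProjection (b i), Submodule.starProjection_apply_mem _ _⟩) hb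
  obtain ⟨q, hq⟩ := exists_orthonormalBasis_smul dF'
    (u := fun i => ⟨Fᗮ.starProjection (b i), Submodule.starProjection_apply_mem _ _⟩) hb'
  have hp' : ∀ i, F.starProjection (b i) = ((‖F.starProjection (b i)‖ : ℝ) : ℂ) • (p i : E) :=
    fun i => congrArg Subtype.val (hp i)
  have hq' : ∀ i, Fᗮ.starProjection (b i) = ((‖Fᗮ.starProjection (b i)‖ : ℝ) : ℂ) • (q i : E) :=
    fun i => congrArg Subtype.val (hq i)
  have hturn : ∀ i, turnLeft (fun i => ‖F.starProjection (b i)‖)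
      (fun i => ‖Fᗮ.starProjection (b i)‖) (fun i => (p i : E)) (fun i => (q i : E)) i = b i := by
    intro i
    rw [turnLeft, ← hp', ← hq', ← hadd]
  refine ⟨fun i => p i, fun i => q i, fun i => ‖F.starProjection (b i)‖,
    fun i => ‖Fᗮ.starProjection (b i)‖, ⟨?_, ?_, ?_⟩, ?_, fun i => norm_nonneg _, ?_, ?_⟩
  · exact p.orthonormal.comp_linearIsometry F.subtypeₗᵢ
  · exact q.orthonormal.comp_linearIsometry Fᗮ.subtypeₗᵢ
  · exact fun i j => Submodule.inner_right_of_mem_orthogonal (p i).2 (q j).2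
  · intro i
    have h1 := norm_add_sq_eq_norm_sq_add_norm_sq_of_inner_eq_zero (𝕜 := ℂ) _ _ (hmix (b i) (b i))
    rw [← hadd] at h1
    have h2 : ‖((b i : G) : E)‖ = 1 := b.orthonormal.1 i
    rw [h2] at h1
    linarith
  · exact fun i j => perp f₀ g₀ h₀ _ (p i).2 j
  · intro i j
    rw [hturn]
    exact perp f₁ g₁ h₁ _ (b i).2 j

end Principal

/-! ### Real inequalities and the sign of `Φ` -/

section Real

/-- The value `t = 0` is excluded because the inequality arises by dividing by `t²`. Continuity
recovers the constant coefficient, and `t ↦ t⁻¹` exchanges it with the leading one. -/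
theorem quadratic_bounds {A B C : ℝ} (h : ∀ t : ℝ, t ≠ 0 → 0 ≤ A + B * t + C * t ^ 2) :
    0 ≤ A ∧ 0 ≤ C ∧ B ^ 2 ≤ 4 * A * C := by
  have const : ∀ {A B C : ℝ}, (∀ t : ℝ, t ≠ 0 → 0 ≤ A + B * t + C * t ^ 2) → 0 ≤ A := by
    intro A B C h
    have hc : Filter.Tendsto (fun t : ℝ => A + B * t + C * t ^ 2) (𝓝[≠] 0)
        (𝓝 (A + B * 0 + C * 0 ^ 2)) :=
      (Continuous.tendsto (by fun_prop) 0).mono_left nhdsWithin_le_nhds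
    have := ge_of_tendsto hc (Filter.eventually_of_mem self_mem_nhdsWithin fun t ht => h t ht)
    simpa using this
  have hA := const h
  have hC : 0 ≤ C := const (A := C) (B := B) (C := A) fun t ht => by
    have := mul_nonneg (sq_nonneg t) (h t⁻¹ (inv_ne_zero ht))
    have e : t ^ 2 * (A + B * t⁻¹ + C * t⁻¹ ^ 2) = C + B * t + A * t ^ 2 := by field_simp; ring
    rwa [e] at this
  refine ⟨hA, hC, ?_⟩
  have := discrim_le_zero (a := C) (b := B) (c := A) fun t => by
    by_cases ht : t = 0
    · simpa [ht] using hA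
    · have := h t ht
      nlinarith
  rw [discrim] at this
  linarith

theorem hermitian_bounds {p r : ℝ} {q : ℂ}
    (h : ∀ α β : ℂ, 0 ≤ p * ‖α‖ ^ 2 + 2 * (q * conj α * β).re + r * ‖β‖ ^ 2) : ‖q‖ ^ 2 ≤ p * r := by
  have hp : 0 ≤ p := by simpa using h 1 0
  have hq : (q * conj q).re = ‖q‖ ^ 2 := by
    rw [Complex.mul_conj']; exact_mod_cast rfl
  rcases hp.eq_or_lt with h0 | h0
  · by_contra hlt
    rw [← h0, zero_mul, not_le] at hlt
    -- Scaled so that, with `p = 0`, the form takes the value `-1`.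
    have h1 := h (((r + 1) / (2 * ‖q‖ ^ 2) : ℝ) * q) (-1)
    have e : q * conj ((((r + 1) / (2 * ‖q‖ ^ 2) : ℝ) : ℂ) * q) * (-1) =
        ((-((r + 1) / (2 * ‖q‖ ^ 2)) : ℝ) : ℂ) * (q * conj q) := by
      rw [map_mul, Complex.conj_ofReal]; push_cast; ring
    rw [e, Complex.re_ofReal_mul, hq, ← h0] at h1
    have e2 : (r + 1) / (2 * ‖q‖ ^ 2) * ‖q‖ ^ 2 = (r + 1) / 2 := by
      have := hlt.ne'
      generalize ‖q‖ ^ 2 = N at this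
      field_simp
    rw [neg_mul, e2] at h1
    simp at h1
    linarith
  -- At this vector the form equals `p (p r - ‖q‖²)`.
  · have h1 := h q (-(p : ℂ))
    have e : q * conj q * (-(p : ℂ)) = ((-p : ℝ) : ℂ) * (q * conj q) := by push_cast; ring
    rw [e, Complex.re_ofReal_mul, hq, norm_neg, Complex.norm_real, Real.norm_eq_abs, sq_abs] at h1
    have h2 : 0 ≤ p * (p * r - ‖q‖ ^ 2) := by nlinarith
    have := nonneg_of_mul_nonneg_right h2 h0
    linarith

/-- The inequalities satisfied by the parameters of a canonical state for which `d` is the maximal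
overlap. -/
structure Admissible (a b c d x y : ℝ) : Prop where
  pos : 0 < d
  hab : b ≤ a
  hbc : c ≤ b
  hc : 0 ≤ c
  nonneg : 0 ≤ (d ^ 2 - b ^ 2) * (d ^ 2 - c ^ 2) - d ^ 2 * (x ^ 2 + y ^ 2)
  hessian : 2 * a * b * c * d ≤ d ^ 2 * (d ^ 2 - (a ^ 2 + b ^ 2 + c ^ 2))
  form : ∀ X Y : ℝ, d ^ 2 * ((a * d + b * c) * x * X + (a * d - b * c) * y * Y) ^ 2 ≤
    ((d ^ 2 * (d ^ 2 - (a ^ 2 + b ^ 2 + c ^ 2)) - 2 * a * b * c * d) * X ^ 2 +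
      (d ^ 2 * (d ^ 2 - (a ^ 2 + b ^ 2 + c ^ 2)) + 2 * a * b * c * d) * Y ^ 2) *
    ((d ^ 2 - b ^ 2) * (d ^ 2 - c ^ 2) - d ^ 2 * (x ^ 2 + y ^ 2))

/-- The polynomial `Φ` in real coordinates. -/
def realPhi (a b c d x y : ℝ) : ℝ :=
  d ^ 2 * (d ^ 2 - (a ^ 2 + b ^ 2 + c ^ 2)) *
      (d ^ 2 - (a ^ 2 + b ^ 2 + c ^ 2) - (x ^ 2 + y ^ 2)) -
    2 * a * b * c * d * (x ^ 2 - y ^ 2) - 4 * (a ^ 2 * b ^ 2 * c ^ 2)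

/-- The determinant of a binary quadratic form in terms of `Φ`. -/
theorem binary_det_eq (a b c d x y : ℝ) :
    (((d ^ 2 - b ^ 2) * (d ^ 2 - c ^ 2) - d ^ 2 * (x ^ 2 + y ^ 2)) *
      (d ^ 2 * (d ^ 2 - (a ^ 2 + b ^ 2 + c ^ 2)) - 2 * a * b * c * d) -
      d ^ 2 * ((a * d + b * c) * x) ^ 2) *
    (((d ^ 2 - b ^ 2) * (d ^ 2 - c ^ 2) - d ^ 2 * (x ^ 2 + y ^ 2)) *
      (d ^ 2 * (d ^ 2 - (a ^ 2 + b ^ 2 + c ^ 2)) + 2 * a * b * c * d) -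
      d ^ 2 * ((a * d - b * c) * y) ^ 2) -
    (d ^ 2 * ((a * d + b * c) * x) * ((a * d - b * c) * y)) ^ 2 =
    ((d ^ 2 - b ^ 2) * (d ^ 2 - c ^ 2) - d ^ 2 * (x ^ 2 + y ^ 2)) * d ^ 2 *
      ((d ^ 2 - b ^ 2) * (d ^ 2 - c ^ 2)) * realPhi a b c d x y := by
  rw [realPhi]; ring

/-- The determinant of the Hermitian form attached to a direction in the first plane. -/
theorem hermitian_det_eq (a b c d x y X Y t : ℝ) (u : ℂ) (hu : u = t * (X + Y * Complex.I)) :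
    (d ^ 2 - c ^ 2) * ‖u‖ ^ 2 *
        (d ^ 2 * (1 + ‖u‖ ^ 2) - b ^ 2 * ‖u‖ ^ 2 - ‖a + conj (x + y * Complex.I) * u‖ ^ 2) -
      ‖(d * b : ℂ) * u + c * conj u * (a + conj (x + y * Complex.I) * u)‖ ^ 2 =
    t ^ 2 * (((d ^ 2 * (d ^ 2 - (a ^ 2 + b ^ 2 + c ^ 2)) - 2 * a * b * c * d) * X ^ 2 +
      (d ^ 2 * (d ^ 2 - (a ^ 2 + b ^ 2 + c ^ 2)) + 2 * a * b * c * d) * Y ^ 2) +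
      -(2 * d * ((a * d + b * c) * x * X + (a * d - b * c) * y * Y) * (X ^ 2 + Y ^ 2)) * t +
      ((d ^ 2 - b ^ 2) * (d ^ 2 - c ^ 2) - d ^ 2 * (x ^ 2 + y ^ 2)) * (X ^ 2 + Y ^ 2) ^ 2 *
        t ^ 2) := by
  subst hu
  simp only [Complex.sq_norm, Complex.normSq_apply, Complex.add_re, Complex.add_im, Complex.mul_re,
    Complex.mul_im, Complex.ofReal_re, Complex.ofReal_im,
    Complex.I_re, Complex.I_im, map_add, map_mul, Complex.conj_ofReal, Complex.conj_I,
    Complex.neg_re, Complex.neg_im]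
  ring

namespace Admissible

variable {a b c d x y : ℝ} (h : Admissible a b c d x y)
include h

theorem sum_le : a ^ 2 + b ^ 2 + c ^ 2 ≤ d ^ 2 := by
  have hb := h.hc.trans h.hbc
  have ha := hb.trans h.hab
  have := h.pos
  have h0 : 0 ≤ 2 * a * b * c * d := by have := h.hc; positivity
  have h1 := h0.trans h.hessian
  have := nonneg_of_mul_nonneg_right h1 (by positivity)
  linarith

theorem b_lt : b < d := by
  have hb := h.hc.trans h.hbc
  have := h.sum_le
  have := h.pos
  have := h.hab
  by_contra hlt
  push Not at hlt
  nlinarith [sq_nonneg c]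

/-- If it vanished, `form` at `(1, 0)` would force `(a d + b c) x = 0`. -/
theorem discr_pos (hx : 0 < x) (hc : 0 < c) :
    0 < (d ^ 2 - b ^ 2) * (d ^ 2 - c ^ 2) - d ^ 2 * (x ^ 2 + y ^ 2) := by
  refine lt_of_le_of_ne h.nonneg fun h0 => ?_
  have h1 := h.form 1 0
  rw [← h0] at h1
  have hb := hc.trans_le h.hbc
  have ha := hb.trans_le h.hab
  have := h.pos
  have : 0 < d ^ 2 * ((a * d + b * c) * x) ^ 2 := by positivity
  nlinarith

theorem prod_pos : 0 < (d ^ 2 - b ^ 2) * (d ^ 2 - c ^ 2) := by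
  have hc := h.hc
  have hb := hc.trans h.hbc
  have hbd := h.b_lt
  have hcd := h.hbc.trans_lt hbd
  have := h.pos
  exact mul_pos (by nlinarith) (by nlinarith)

/-- By `form`, a binary quadratic form is positive semidefinite, and `binary_det_eq` writes its
determinant as `Φ` times factors that are positive unless `C = 0`. For `C = 0` the linear form in
`form` must vanish; this leaves only `a = b = c = 0`, where `Φ = 0`. -/
theorem phi_nonneg : 0 ≤ realPhi a b c d x y := by
  have hc := h.hc
  have hb := hc.trans h.hbc
  have ha := hb.trans h.hab
  have hd := h.pos
  have hP := h.prod_pos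
  rcases h.nonneg.eq_or_lt with h0 | h0
  · have h1 := h.form 1 0
    have h2 := h.form 0 1
    rw [← h0] at h1 h2
    have hd2 : 0 < d ^ 2 := by positivity
    have e1 : (a * d + b * c) * x = 0 := by
      have : d ^ 2 * ((a * d + b * c) * x) ^ 2 ≤ 0 := by nlinarith
      have := nonpos_of_mul_nonpos_right this hd2
      exact pow_eq_zero_iff two_ne_zero |>.1 (le_antisymm this (sq_nonneg _))
    have e2 : (a * d - b * c) * y = 0 := by
      have : d ^ 2 * ((a * d - b * c) * y) ^ 2 ≤ 0 := by nlinarith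
      have := nonpos_of_mul_nonpos_right this hd2
      exact pow_eq_zero_iff two_ne_zero |>.1 (le_antisymm this (sq_nonneg _))
    rcases ha.eq_or_lt with a0 | a0
    · have b0 : b = 0 := le_antisymm (a0 ▸ h.hab) hb
      have c0 : c = 0 := le_antisymm (b0 ▸ h.hbc) hc
      rw [b0, c0] at h0
      rw [b0, c0, ← a0]
      have h3 : d ^ 2 * (d ^ 2 - (x ^ 2 + y ^ 2)) = 0 := by linarith
      rw [realPhi]
      have h4 := (mul_eq_zero.1 h3).resolve_left hd2.ne'
      have : d ^ 2 - ((0 : ℝ) ^ 2 + 0 ^ 2 + 0 ^ 2) - (x ^ 2 + y ^ 2) = 0 := by linarith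
      rw [this]
      norm_num
    · exfalso
      have hbd := h.b_lt
      have : 0 < a * d := by positivity
      have hbc : 0 ≤ b * c := by positivity
      have hlt : b * c < a * d := by
        have := h.hab; have := h.hbc
        nlinarith
      have x0 : x = 0 := (mul_eq_zero.1 e1).resolve_left (by linarith)
      have y0 : y = 0 := (mul_eq_zero.1 e2).resolve_left (by linarith)
      rw [x0, y0] at h0
      nlinarith
  · set C := (d ^ 2 - b ^ 2) * (d ^ 2 - c ^ 2) - d ^ 2 * (x ^ 2 + y ^ 2) with hC
    have hdet := hermitian_bounds
      (p := C * (d ^ 2 * (d ^ 2 - (a ^ 2 + b ^ 2 + c ^ 2)) - 2 * a * b * c * d) -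
        d ^ 2 * ((a * d + b * c) * x) ^ 2)
      (r := C * (d ^ 2 * (d ^ 2 - (a ^ 2 + b ^ 2 + c ^ 2)) + 2 * a * b * c * d) -
        d ^ 2 * ((a * d - b * c) * y) ^ 2)
      (q := ((-(d ^ 2 * ((a * d + b * c) * x) * ((a * d - b * c) * y)) : ℝ) : ℂ))
      (fun α β => by
        have h1 := h.form α.re β.re
        have h2 := h.form α.im β.im
        rw [← hC] at h1 h2
        rw [mul_assoc _ (conj α) β, Complex.re_ofReal_mul, Complex.sq_norm, Complex.sq_norm,
          Complex.normSq_apply, Complex.normSq_apply, Complex.mul_re, Complex.conj_re,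
          Complex.conj_im]
        linarith)
    rw [Complex.norm_real, Real.norm_eq_abs, sq_abs, neg_sq] at hdet
    have key := binary_det_eq a b c d x y
    rw [← hC] at key
    have : 0 ≤ (C * d ^ 2 * ((d ^ 2 - b ^ 2) * (d ^ 2 - c ^ 2))) * realPhi a b c d x y := by
      linarith
    exact nonneg_of_mul_nonneg_right this (by positivity)

/-- If `Φ` vanishes, the binary form is degenerate. -/
theorem exists_null (hx : 0 < x) (hc : 0 < c) (hΦ : realPhi a b c d x y = 0) :
    ∃ u : ℂ, u ≠ 0 ∧
      ‖(d * b : ℂ) * u + c * conj u * (a + conj (x + y * Complex.I) * u)‖ ^ 2 =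
      (d ^ 2 - c ^ 2) * ‖u‖ ^ 2 *
        (d ^ 2 * (1 + ‖u‖ ^ 2) - b ^ 2 * ‖u‖ ^ 2 - ‖a + conj (x + y * Complex.I) * u‖ ^ 2) := by
  set C := (d ^ 2 - b ^ 2) * (d ^ 2 - c ^ 2) - d ^ 2 * (x ^ 2 + y ^ 2) with hC
  have hC0 : 0 < C := h.discr_pos hx hc
  have hd := h.pos
  have hb := hc.trans_le h.hbc
  have ha := hb.trans_le h.hab
  have hdet := binary_det_eq a b c d x y
  rw [hΦ, mul_zero, ← hC] at hdet
  set R := d ^ 2 * (d ^ 2 - (a ^ 2 + b ^ 2 + c ^ 2)) - 2 * a * b * c * d with hR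
  set S := d ^ 2 * (d ^ 2 - (a ^ 2 + b ^ 2 + c ^ 2)) + 2 * a * b * c * d with hS
  have hR0 : 0 ≤ R := by have := h.hessian; linarith
  have hS0 : 0 < S := by
    have : 0 < 2 * a * b * c * d := by positivity
    linarith only [hR0, this, hR, hS]
  -- A null vector of the binary form, whose determinant is zero: `(1, 0)` if the first diagonal
  -- entry vanishes, otherwise the vector read off from the first row.
  obtain ⟨X, Y, hXY, hnull⟩ : ∃ X Y : ℝ, (X ≠ 0 ∨ Y ≠ 0) ∧
      C * (R * X ^ 2 + S * Y ^ 2) =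
      d ^ 2 * ((a * d + b * c) * x * X + (a * d - b * c) * y * Y) ^ 2 := by
    by_cases h11 : C * R - d ^ 2 * ((a * d + b * c) * x) ^ 2 = 0
    · exact ⟨1, 0, Or.inl one_ne_zero, by linear_combination h11⟩
    · refine ⟨d ^ 2 * ((a * d + b * c) * x) * ((a * d - b * c) * y),
        C * R - d ^ 2 * ((a * d + b * c) * x) ^ 2, Or.inr h11, ?_⟩
      linear_combination (C * R - d ^ 2 * ((a * d + b * c) * x) ^ 2) * hdet
  have hn : 0 < X ^ 2 + Y ^ 2 := by
    rcases hXY with h | h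
    · exact add_pos_of_pos_of_nonneg (by positivity) (sq_nonneg _)
    · exact add_pos_of_nonneg_of_pos (sq_nonneg _) (by positivity)
  set L := (a * d + b * c) * x * X + (a * d - b * c) * y * Y with hL
  have hL0 : L ≠ 0 := by
    intro h0
    rw [h0] at hnull
    have h1 : R * X ^ 2 + S * Y ^ 2 = 0 := by
      have : C * (R * X ^ 2 + S * Y ^ 2) = 0 := by rw [hnull]; ring
      exact (mul_eq_zero.1 this).resolve_left hC0.ne'
    have h2 : S * Y ^ 2 = 0 := by
      have h3 : 0 ≤ R * X ^ 2 := by positivity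
      have h4 : 0 ≤ S * Y ^ 2 := by positivity
      linarith only [h1, h3, h4]
    have hY : Y = 0 := by
      have := (mul_eq_zero.1 h2).resolve_left hS0.ne'
      exact pow_eq_zero_iff two_ne_zero |>.1 this
    rw [hY, mul_zero, add_zero] at hL
    have hX : X ≠ 0 := hXY.resolve_right (fun h => h hY)
    rw [h0] at hL
    have : (a * d + b * c) * x ≠ 0 := by positivity
    exact mul_ne_zero this hX hL.symm
  -- The double root of the quadratic polynomial in `t` from `hermitian_det_eq`; it is nonzero
  -- because `L` is.
  set t := d * L / (C * (X ^ 2 + Y ^ 2)) with ht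
  have ht0 : t ≠ 0 := div_ne_zero (mul_ne_zero hd.ne' hL0) (mul_pos hC0 hn).ne'
  have htC : t * (C * (X ^ 2 + Y ^ 2)) = d * L := div_mul_cancel₀ _ (mul_pos hC0 hn).ne'
  refine ⟨t * (X + Y * Complex.I), ?_, ?_⟩
  · refine mul_ne_zero (by exact_mod_cast ht0) fun h0 => ?_
    have h1 := congrArg Complex.re h0
    have h2 := congrArg Complex.im h0
    simp at h1 h2
    rcases hXY with h | h
    · exact h h1
    · exact h h2
  · have key := hermitian_det_eq a b c d x y X Y t _ rfl
    rw [← hC, ← hR, ← hS, ← hL] at key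
    have h0 : R * X ^ 2 + S * Y ^ 2 + -(2 * d * L * (X ^ 2 + Y ^ 2)) * t +
        C * (X ^ 2 + Y ^ 2) ^ 2 * t ^ 2 = 0 := by
      refine (mul_eq_zero.1 ?_).resolve_left hC0.ne'
      linear_combination hnull + (t * (C * (X ^ 2 + Y ^ 2)) - d * L) * htC
    rw [h0, mul_zero, sub_eq_zero] at key
    exact key.symm

end Admissible

end Real

/-! ### The overlap bound for canonical forms and its equality case -/

section CanonForms

variable {E : Type*} [NormedAddCommGroup E] [InnerProductSpace ℂ E]
variable {τ : E [⋀^Fin 3]→ₗ[ℂ] ℂ} {f g : Fin 3 → E} {p : Point}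

namespace Canon

theorem block_apply (h : Canon τ f g p) (i j : Fin 3) :
    tri τ (f i) (g (j + 1)) (g (j + 2)) = if i = j then ![(p.a : ℂ), p.b, p.c] i else 0 := by
  have := congrFun (congrFun h.block_eq i) j
  rw [Matrix.diagonal_apply] at this
  exact this

/-- The value of the form at vectors in the planes of a canonical frame. -/
theorem tri_planes (h : Canon τ f g p) (α β : Fin 3 → ℂ) :
    tri τ (α 0 • f 0 + β 0 • g 0) (α 1 • f 1 + β 1 • g 1) (α 2 • f 2 + β 2 • g 2) =
      p.d * (α 0 * α 1 * α 2) + p.a * (α 0 * β 1 * β 2) + p.b * (β 0 * α 1 * β 2) +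
        p.c * (β 0 * β 1 * α 2) + conj p.z * (β 0 * β 1 * β 2) := by
  have hc : ∀ i j k, tri τ (g i) (f j) (f k) = 0 := fun i => tri_pair_eq_zero (h.crit i)
  have b0 : tri τ (f 0) (g 1) (g 2) = p.a := h.block_apply 0 0
  have b1 : tri τ (g 0) (f 1) (g 2) = p.b := by
    rw [tri_cyc]; exact h.block_apply 1 1
  have b2 : tri τ (g 0) (g 1) (f 2) = p.c := by
    rw [← tri_cyc]; exact h.block_apply 2 2
  have e1 : tri τ (f 0) (g 1) (f 2) = 0 := by rw [tri_cyc, hc]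
  have e2 : tri τ (f 0) (f 1) (g 2) = 0 := by rw [← tri_cyc, hc]
  have e3 : tri τ (f 0) (f 1) (f 2) = p.d := by rw [← form_eq_tri, h.left_eq]
  have e4 : tri τ (g 0) (g 1) (g 2) = conj p.z := by rw [← form_eq_tri, h.right_eq]
  simp only [tri_add_left, tri_add_mid, tri_add_right, tri_smul_left, tri_smul_mid,
    tri_smul_right, hc, b0, b1, b2, e1, e2, e3, e4]
  ring

theorem inner_planes (h : Canon τ f g p) (α β : Fin 3 → ℂ) {i j : Fin 3} (hij : i ≠ j) :
    inner ℂ (α i • f i + β i • g i) (α j • f j + β j • g j) = 0 := by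
  simp only [inner_add_left, inner_add_right, inner_smul_left, inner_smul_right, h.frame.left.2 hij,
    h.frame.right.2 hij, h.frame.cross, h.frame.cross', mul_zero, add_zero]

theorem norm_sq_plane (h : Canon τ f g p) (α β : ℂ) (i : Fin 3) :
    ‖α • f i + β • g i‖ ^ 2 = ‖α‖ ^ 2 + ‖β‖ ^ 2 :=
  norm_sq_combination (h.frame.left.1 i) (h.frame.right.1 i) (h.frame.cross i i) α β

theorem le_left (h : Canon τ f g p) (hτ : Bounded τ p.d) : ‖τ f‖ = p.d := by
  rw [h.left_eq, Complex.norm_real, Real.norm_of_nonneg]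
  exact hτ.nonneg h.frame.left

/-- The contraction of a canonical form by a vector of the first plane has operator norm at
most `d`. -/
theorem contraction_le (h : Canon τ f g p) (hτ : Bounded τ p.d) (u α β : ℂ) :
    ‖p.d * α + p.b * u * β‖ ^ 2 + ‖p.c * u * α + (p.a + conj p.z * u) * β‖ ^ 2 ≤
      p.d ^ 2 * (1 + ‖u‖ ^ 2) * (‖α‖ ^ 2 + ‖β‖ ^ 2) := by
  set A : ℂ := p.d * α + p.b * u * β
  set B : ℂ := p.c * u * α + (p.a + conj p.z * u) * β
  have hd : 0 ≤ p.d := hτ.nonneg h.frame.left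
  -- Contraction by the other two vectors leaves the functional with coefficients `(A, B)` on the
  -- middle plane. The conjugate coefficients are extremal for it and give the value `|A|² + |B|²`.
  have hval := h.tri_planes ![1, conj A, α] ![u, conj B, β]
  have hle := hτ.norm_tri_le (h.inner_planes ![1, conj A, α] ![u, conj B, β] (i := 0) (j := 1)
    (by decide)) (h.inner_planes ![1, conj A, α] ![u, conj B, β] (i := 0) (j := 2) (by decide))
    (h.inner_planes ![1, conj A, α] ![u, conj B, β] (i := 1) (j := 2) (by decide))
  rw [hval] at hle
  simp only [Matrix.cons_val] at hle
  have e : (p.d : ℂ) * (1 * conj A * α) + p.a * (1 * conj B * β) + p.b * (u * conj A * β) +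
      p.c * (u * conj B * α) + conj p.z * (u * conj B * β) = ((‖A‖ ^ 2 + ‖B‖ ^ 2 : ℝ) : ℂ) := by
    have hA := Complex.conj_mul' A
    have hB := Complex.conj_mul' B
    push_cast
    rw [← hA, ← hB]
    simp only [A, B]
    ring
  rw [e, Complex.norm_real, Real.norm_of_nonneg (by positivity)] at hle
  have n0 := h.norm_sq_plane 1 u 0
  have n1 := h.norm_sq_plane (conj A) (conj B) 1
  have n2 := h.norm_sq_plane α β 2
  rw [norm_one, one_pow] at n0
  rw [Complex.norm_conj, Complex.norm_conj] at n1
  have hsq := pow_le_pow_left₀ (by positivity) hle 2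
  rw [mul_pow, mul_pow, mul_pow, n0, n1, n2] at hsq
  rcases (show 0 ≤ ‖A‖ ^ 2 + ‖B‖ ^ 2 by positivity).eq_or_lt with h0 | h0
  · rw [← h0]; positivity
  · refine le_of_mul_le_mul_right ?_ h0
    linarith

/-- The difference of the two sides of `contraction_le` is a positive semidefinite Hermitian form in
`(α, β)`; its determinant is nonnegative. -/
theorem hermitian_le (h : Canon τ f g p) (hτ : Bounded τ p.d) (u : ℂ) :
    ‖(p.d * p.b : ℂ) * u + p.c * conj u * (p.a + conj p.z * u)‖ ^ 2 ≤
      (p.d ^ 2 - p.c ^ 2) * ‖u‖ ^ 2 *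
        (p.d ^ 2 * (1 + ‖u‖ ^ 2) - p.b ^ 2 * ‖u‖ ^ 2 - ‖p.a + conj p.z * u‖ ^ 2) := by
  rw [← norm_neg]
  refine hermitian_bounds fun α β => ?_
  have := h.contraction_le hτ u α β
  have e : ‖p.d * α + p.b * u * β‖ ^ 2 + ‖p.c * u * α + (p.a + conj p.z * u) * β‖ ^ 2 =
      p.d ^ 2 * ‖α‖ ^ 2 + p.b ^ 2 * ‖u‖ ^ 2 * ‖β‖ ^ 2 + p.c ^ 2 * ‖u‖ ^ 2 * ‖α‖ ^ 2 +
      ‖p.a + conj p.z * u‖ ^ 2 * ‖β‖ ^ 2 +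
      2 * (((p.d * p.b : ℂ) * u + p.c * conj u * (p.a + conj p.z * u)) * conj α * β).re := by
    generalize (p.a : ℂ) + conj p.z * u = w
    simp only [Complex.sq_norm, Complex.normSq_apply, Complex.add_re, Complex.add_im,
      Complex.mul_re, Complex.mul_im, Complex.conj_re, Complex.conj_im, Complex.ofReal_re,
      Complex.ofReal_im]
    ring
  rw [e] at this
  have e2 : (-((p.d * p.b : ℂ) * u + p.c * conj u * (p.a + conj p.z * u)) * conj α * β).re =
    -(((p.d * p.b : ℂ) * u + p.c * conj u * (p.a + conj p.z * u)) * conj α * β).re := by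
    rw [neg_mul, neg_mul, Complex.neg_re]
  rw [e2]
  linarith

/-- For `u = t (X + iY)` the determinant from `hermitian_le` is `t²` times a quadratic in `t`. Its
outer coefficients at `(X, Y) = (1, 0)` give `hessian` and `nonneg`; its discriminant gives `form`.
-/
theorem admissible (h : Canon τ f g p) (hτ : Bounded τ p.d) (hd : 0 < p.d) (hab : p.b ≤ p.a)
    (hbc : p.c ≤ p.b) (hc : 0 ≤ p.c) : Admissible p.a p.b p.c p.d p.x p.y := by
  have hz : p.z = p.x + p.y * Complex.I := (Complex.re_add_im p.z).symm
  have key : ∀ X Y t : ℝ, t ≠ 0 → 0 ≤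
      ((p.d ^ 2 * (p.d ^ 2 - (p.a ^ 2 + p.b ^ 2 + p.c ^ 2)) - 2 * p.a * p.b * p.c * p.d) * X ^ 2 +
      (p.d ^ 2 * (p.d ^ 2 - (p.a ^ 2 + p.b ^ 2 + p.c ^ 2)) + 2 * p.a * p.b * p.c * p.d) * Y ^ 2) +
      -(2 * p.d * ((p.a * p.d + p.b * p.c) * p.x * X + (p.a * p.d - p.b * p.c) * p.y * Y) *
        (X ^ 2 + Y ^ 2)) * t +
      ((p.d ^ 2 - p.b ^ 2) * (p.d ^ 2 - p.c ^ 2) - p.d ^ 2 * (p.x ^ 2 + p.y ^ 2)) *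
        (X ^ 2 + Y ^ 2) ^ 2 * t ^ 2 := by
    intro X Y t ht
    have h1 := h.hermitian_le hτ (t * (X + Y * Complex.I))
    rw [hz] at h1
    have h2 := hermitian_det_eq p.a p.b p.c p.d p.x p.y X Y t _ rfl
    exact nonneg_of_mul_nonneg_right (h2 ▸ sub_nonneg.2 h1) (by positivity)
  have q10 := quadratic_bounds (key 1 0)
  refine ⟨hd, hab, hbc, hc, ?_, ?_, fun X Y => ?_⟩
  · simpa using q10.2.1
  · linarith [q10.1]
  · by_cases hn : X ^ 2 + Y ^ 2 = 0
    · have hX : X = 0 := by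
        have := sq_nonneg Y
        exact pow_eq_zero_iff two_ne_zero |>.1 (le_antisymm (by linarith) (sq_nonneg X))
      have hY : Y = 0 := by
        have := sq_nonneg X
        exact pow_eq_zero_iff two_ne_zero |>.1 (le_antisymm (by linarith) (sq_nonneg Y))
      rw [hX, hY]; simp
    · have hn' : 0 < (X ^ 2 + Y ^ 2) ^ 2 := by positivity
      have := (quadratic_bounds (key X Y)).2.2
      refine le_of_mul_le_mul_right ?_ hn'
      linarith

theorem phi_eq (p : Point) : p.Phi = realPhi p.a p.b p.c p.d p.x p.y := by
  have hz : ‖p.z‖ ^ 2 = p.x ^ 2 + p.y ^ 2 := by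
    rw [Complex.sq_norm, Complex.normSq_apply]; ring
  rw [Point.Phi, realPhi, hz]

theorem exists_polar {x y : ℂ} : ∃ (c s : ℝ) (l k : ℂ), 0 ≤ s ∧ ‖l‖ = 1 ∧ ‖k‖ = 1 ∧
    x = c * l ∧ y = s * k ∧ c ^ 2 = ‖x‖ ^ 2 ∧ s = ‖y‖ := by
  obtain ⟨l, hl, el⟩ := exists_unit_mul_eq_norm x
  obtain ⟨k, hk, ek⟩ := exists_unit_mul_eq_norm y
  have inv : ∀ w : ℂ, ‖w‖ = 1 → conj w * w = 1 := fun w hw => by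
    rw [Complex.conj_mul', hw]; simp
  refine ⟨‖x‖, ‖y‖, conj l, conj k, norm_nonneg _, by simpa using hl, by simpa using hk, ?_, ?_,
    rfl, rfl⟩
  · rw [← el]; linear_combination -x * inv l hl
  · rw [← ek]; linear_combination -y * inv k hk

/-- If `Φ` vanishes there is a second maximizing triple in the planes of the canonical frame. -/
theorem exists_second_max (h : Canon τ f g p)
    (had : Admissible p.a p.b p.c p.d p.x p.y) (hx : 0 < p.x) (hc : 0 < p.c) (hΦ : p.Phi = 0) :
    ∃ α β : Fin 3 → ℂ, (∀ i, ‖α i‖ ^ 2 + ‖β i‖ ^ 2 = 1) ∧ β 0 ≠ 0 ∧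
      ‖tri τ (α 0 • f 0 + β 0 • g 0) (α 1 • f 1 + β 1 • g 1) (α 2 • f 2 + β 2 • g 2)‖ = p.d := by
  have hz : p.z = p.x + p.y * Complex.I := (Complex.re_add_im p.z).symm
  obtain ⟨u, hu, hnull⟩ := had.exists_null hx hc (phi_eq p ▸ hΦ)
  rw [← hz] at hnull
  set q : ℂ := (p.d * p.b : ℂ) * u + p.c * conj u * (p.a + conj p.z * u) with hq
  set P : ℝ := (p.d ^ 2 - p.c ^ 2) * ‖u‖ ^ 2 with hP
  have hP0 : 0 < P := by
    have h1 := had.b_lt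
    have h2 := had.hbc
    have hu' : 0 < ‖u‖ := norm_pos_iff.2 hu
    have : 0 < p.d ^ 2 - p.c ^ 2 := by nlinarith
    positivity
  -- For this `u` the Hermitian form is degenerate with null vector `(α, β) = (q, P)`. There
  -- `contraction_le` becomes an equality, and its three test vectors, normalized, form the new
  -- maximizing triple.
  set A : ℂ := p.d * q + p.b * u * (P : ℂ)
  set B : ℂ := p.c * u * q + (p.a + conj p.z * u) * (P : ℂ)
  have hd := had.pos
  have hAB : ‖A‖ ^ 2 + ‖B‖ ^ 2 = p.d ^ 2 * (1 + ‖u‖ ^ 2) * (‖q‖ ^ 2 + ‖(P : ℂ)‖ ^ 2) := by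
    have e : ‖p.d * q + p.b * u * (P : ℂ)‖ ^ 2 +
        ‖p.c * u * q + (p.a + conj p.z * u) * (P : ℂ)‖ ^ 2 =
        p.d ^ 2 * ‖q‖ ^ 2 + p.b ^ 2 * ‖u‖ ^ 2 * P ^ 2 + p.c ^ 2 * ‖u‖ ^ 2 * ‖q‖ ^ 2 +
        ‖p.a + conj p.z * u‖ ^ 2 * P ^ 2 +
        2 * P * (((p.d * p.b : ℂ) * u + p.c * conj u * (p.a + conj p.z * u)) * conj q).re := by
      clear_value P q
      generalize (p.a : ℂ) + conj p.z * u = w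
      simp only [Complex.sq_norm, Complex.normSq_apply, Complex.add_re, Complex.add_im,
        Complex.mul_re, Complex.mul_im, Complex.conj_re, Complex.conj_im, Complex.ofReal_re,
        Complex.ofReal_im]
      ring
    have hqq : (q * conj q).re = ‖q‖ ^ 2 := by
      rw [Complex.mul_conj']; exact_mod_cast rfl
    rw [e, ← hq, hqq, Complex.norm_real, Real.norm_of_nonneg hP0.le]
    linear_combination P * hnull + ‖q‖ ^ 2 * hP
  have hm0 : 0 < ‖q‖ ^ 2 + ‖(P : ℂ)‖ ^ 2 := by
    have : 0 < ‖(P : ℂ)‖ := norm_pos_iff.2 (by simpa using hP0.ne')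
    positivity
  have hN0 : 0 < 1 + ‖u‖ ^ 2 := by positivity
  have hR0 : 0 < ‖A‖ ^ 2 + ‖B‖ ^ 2 := by rw [hAB]; positivity
  set n := Real.sqrt (1 + ‖u‖ ^ 2)
  set m := Real.sqrt (‖q‖ ^ 2 + ‖(P : ℂ)‖ ^ 2)
  set R := Real.sqrt (‖A‖ ^ 2 + ‖B‖ ^ 2)
  have hn : n ^ 2 = 1 + ‖u‖ ^ 2 := Real.sq_sqrt hN0.le
  have hm : m ^ 2 = ‖q‖ ^ 2 + ‖(P : ℂ)‖ ^ 2 := Real.sq_sqrt hm0.le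
  have hR : R ^ 2 = ‖A‖ ^ 2 + ‖B‖ ^ 2 := Real.sq_sqrt hR0.le
  have n0 : 0 < n := Real.sqrt_pos.2 hN0
  have m0 : 0 < m := Real.sqrt_pos.2 hm0
  have R0 : 0 < R := Real.sqrt_pos.2 hR0
  have hnorm : ∀ {x y : ℂ} {r : ℝ}, 0 < r → r ^ 2 = ‖x‖ ^ 2 + ‖y‖ ^ 2 →
      ‖x / r‖ ^ 2 + ‖y / r‖ ^ 2 = 1 := by
    intro x y r hr h
    rw [norm_div, norm_div, Complex.norm_real, Real.norm_of_nonneg hr.le, div_pow, div_pow,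
      ← add_div, ← h, div_self (by positivity)]
  refine ⟨![1 / n, conj A / R, q / m], ![u / n, conj B / R, (P : ℂ) / m], fun i => ?_, ?_, ?_⟩
  · fin_cases i
    · exact hnorm n0 (by rw [hn]; simp)
    · exact hnorm R0 (by rw [hR]; simp)
    · exact hnorm m0 hm
  · exact div_ne_zero hu (by exact_mod_cast n0.ne')
  · rw [h.tri_planes]
    simp only [Matrix.cons_val]
    have hnc : (n : ℂ) ≠ 0 := by exact_mod_cast n0.ne'
    have hmc : (m : ℂ) ≠ 0 := by exact_mod_cast m0.ne'
    have hRc : (R : ℂ) ≠ 0 := by exact_mod_cast R0.ne'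
    have e : (p.d : ℂ) * (1 / n * (conj A / R) * (q / m)) +
        p.a * (1 / n * (conj B / R) * ((P : ℂ) / m)) +
        p.b * (u / n * (conj A / R) * ((P : ℂ) / m)) + p.c * (u / n * (conj B / R) * (q / m)) +
        conj p.z * (u / n * (conj B / R) * ((P : ℂ) / m)) = ((R ^ 2 / (n * R * m) : ℝ) : ℂ) := by
      have hA := Complex.conj_mul' A
      have hB := Complex.conj_mul' B
      rw [hR]
      push_cast
      rw [← hA, ← hB]
      simp only [A, B]
      field_simp
      ring
    have hRR : R = p.d * n * m := by
      have : R ^ 2 = (p.d * n * m) ^ 2 := by rw [hR, hAB, mul_pow, mul_pow, hn, hm]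
      exact (pow_left_inj₀ R0.le (by positivity) two_ne_zero).1 this
    rw [e, Complex.norm_real, Real.norm_of_nonneg (by positivity), hRR]
    field_simp

end Canon

end CanonForms

/-! ### The conjugate canonical form on the zero set of `Φ` -/

section ConjugateForms

variable {E : Type*} [NormedAddCommGroup E] [InnerProductSpace ℂ E]
variable {τ : E [⋀^Fin 3]→ₗ[ℂ] ℂ} {f g : Fin 3 → E} {p : Point}

theorem exists_unit_cube_root {w : ℂ} (hw : ‖w‖ = 1) : ∃ r : ℂ, ‖r‖ = 1 ∧ r ^ 3 = w := by
  obtain ⟨r, hr⟩ := IsAlgClosed.exists_pow_nat_eq w (n := 3) (by norm_num)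
  refine ⟨r, ?_, hr⟩
  have := congrArg norm hr
  rw [norm_pow, hw] at this
  exact (pow_eq_one_iff_of_nonneg (norm_nonneg _) (by norm_num)).1 this

theorem conj_mul_self_of_unit {w : ℂ} (hw : ‖w‖ = 1) : conj w * w = 1 := by
  rw [Complex.conj_mul', hw]; simp

namespace Canon

/-- The point with complex conjugate last coordinate. -/
def conjPoint (p : Point) : Point := (p.a, p.b, p.c, p.d, conj p.z)

/-- On the zero set of `Φ` the conjugate canonical form is attained in another frame. -/
theorem exists_conj (h : Canon τ f g p) (hτ : Bounded τ p.d)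
    (had : Admissible p.a p.b p.c p.d p.x p.y) (hx : 0 < p.x) (hc : 0 < p.c) (hΦ : p.Phi = 0) :
    ∃ f' g' : Fin 3 → E, Canon τ f' g' (conjPoint p) := by
  obtain ⟨α, β, hαβ, hβ, hmax⟩ := h.exists_second_max had hx hc hΦ
  have hpol := fun i => exists_polar (x := α i) (y := β i)
  -- Phases are absorbed into the frame, so that the second triple is a turn by real cosines and
  -- sines.
  choose c s l k hs hl hk eα eβ hc2 hsβ using hpol
  have hd := had.pos
  have hcs : ∀ i, c i ^ 2 + s i ^ 2 = 1 := fun i => by rw [hc2, hsβ, hαβ]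
  set F : Fin 3 → E := fun i => l i • f i with hF
  set G : Fin 3 → E := fun i => k i • g i with hG
  have hFG : Frame F G := h.frame.smul hl hk
  have hturn : ∀ i, turnLeft c s F G i = α i • f i + β i • g i := fun i => by
    simp only [turnLeft, hF, hG, smul_smul, eα i, eβ i]
  have hD : τ F = l 0 * l 1 * l 2 * p.d := by rw [hF, form_smul_fin, h.left_eq]
  have hD1 : ‖τ F‖ = p.d := by
    rw [hD, norm_mul, norm_mul, norm_mul, hl, hl, hl, Complex.norm_real, Real.norm_of_nonneg hd.le]
    ring
  have hD' : ‖τ (turnLeft c s F G)‖ = p.d := by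
    rw [form_eq_tri, hturn, hturn, hturn, hmax]
  have hblock : ∀ i, block τ F G i i = l i * k (i + 1) * k (i + 2) * ![(p.a : ℂ), p.b, p.c] i := by
    intro i
    rw [hF, hG, block_smul, h.block_eq, Matrix.diagonal_apply_eq]
  -- Since `a, b, c > 0` and `a² + b² + c² ≤ d²`, no diagonal block entry has modulus `d`, and `β 0
  -- ≠ 0` rules out that all sines vanish.
  have hs0 : ∀ i, s i ≠ 0 := by
    intro i hi
    rcases turn_degenerate hFG hcs hs hτ hD1 hD' hd hi with h0 | h0
    · exact hβ (by rw [eβ, h0]; simp)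
    · have hsum := had.sum_le
      have hb := hc.trans_le had.hbc
      have ha := hb.trans_le had.hab
      rw [hblock, norm_mul, norm_mul, norm_mul, hl, hk, hk, one_mul, one_mul, one_mul] at h0
      fin_cases i
      · have e : p.a = p.d := by
          simpa [Complex.norm_real, abs_of_pos ha] using h0
        nlinarith
      · have e : p.b = p.d := by
          simpa [Complex.norm_real, abs_of_pos hb] using h0
        nlinarith
      · have e : p.c = p.d := by
          simpa [Complex.norm_real, abs_of_pos hc] using h0
        nlinarith
  obtain ⟨-, hoff, hdiag, hright⟩ := turn_conj hFG hcs hs0 hτ hD1 hD'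
  set f' := turnLeft c s F G
  set g' := turnRight c s F G
  have hfg' : Frame f' g' := hFG.turn hcs
  have hdc : (p.d : ℂ) ≠ 0 := by exact_mod_cast hd.ne'
  have hw : ‖conj (l 0 * l 1 * l 2 * (τ f' / p.d))‖ = 1 := by
    rw [Complex.norm_conj, norm_mul, norm_mul, norm_mul, hl, hl, hl, norm_div, hD',
      Complex.norm_real, Real.norm_of_nonneg hd.le, div_self hd.ne']
    norm_num
  -- A common phase `r` on all six vectors multiplies every value by `r³`. Together with the phases
  -- `l` and `k` it turns the relations of `turn_conj` into the exact conjugate coordinates.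
  obtain ⟨r, hr, hr3⟩ := exists_unit_cube_root hw
  have hrw : r ^ 3 * (l 0 * l 1 * l 2 * τ f') = p.d := by
    have := conj_mul_self_of_unit (w := l 0 * l 1 * l 2 * (τ f' / p.d)) (by simpa using hw)
    rw [← hr3] at this
    field_simp at this
    linear_combination this
  have hll : conj (l 0 * l 1 * l 2) * (l 0 * l 1 * l 2) = 1 :=
    conj_mul_self_of_unit (by rw [norm_mul, norm_mul, hl, hl, hl]; norm_num)
  have hcD : conj (τ F) = conj (l 0 * l 1 * l 2) * p.d := by
    rw [hD, map_mul _ (l 0 * l 1 * l 2), Complex.conj_ofReal]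
  have hfin : Frame (fun i => (r * l i) • f' i) (fun i => (r * k i) • g' i) :=
    hfg'.smul (fun i => by rw [norm_mul, hr, hl, one_mul]) fun i => by rw [norm_mul, hr, hk, one_mul]
  have hleft : τ (fun i => (r * l i) • f' i) = p.d := by
    rw [form_smul_fin, ← hrw]; ring
  refine ⟨_, _, hfin, ?_, hleft, ?_, fun i => ?_⟩
  · ext i j
    rw [block_smul, Matrix.diagonal_apply]
    split_ifs with hij
    · subst hij
      have e := hdiag i
      rw [hblock, hcD] at e
      simp only [map_mul] at e
      have em : conj (![(p.a : ℂ), p.b, p.c] i) = ![(p.a : ℂ), p.b, p.c] i := by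
        fin_cases i <;> exact Complex.conj_ofReal _
      rw [em] at e
      have u0 := conj_mul_self_of_unit (hl i)
      have u1 := conj_mul_self_of_unit (hk (i + 1))
      have u2 := conj_mul_self_of_unit (hk (i + 2))
      change _ = ![(p.a : ℂ), p.b, p.c] i
      generalize ![(p.a : ℂ), p.b, p.c] i = m at e ⊢
      have ul : conj (l 0) * conj (l 1) * conj (l 2) * (l 0 * l 1 * l 2) = 1 := by
        rw [← hll]; simp only [map_mul]
      have uu : conj (l i) * conj (k (i + 1)) * conj (k (i + 2)) *
          (l i * k (i + 1) * k (i + 2)) = 1 := by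
        linear_combination conj (k (i + 1)) * conj (k (i + 2)) * k (i + 1) * k (i + 2) * u0 +
          conj (k (i + 2)) * k (i + 2) * u1 + u2
      refine mul_left_cancel₀ hdc ?_
      linear_combination (r ^ 3 * (l i * k (i + 1) * k (i + 2))) * (l 0 * l 1 * l 2) * e +
        m * (r ^ 3 * (l 0 * l 1 * l 2 * τ f')) * uu + m * hrw -
        p.d * (r ^ 3 * (l i * k (i + 1) * k (i + 2)) * block τ f' g' i i) * ul
    · rw [hoff i j hij, mul_zero]
  · have e := hright
    have eG : τ G = k 0 * k 1 * k 2 * conj p.z := by rw [hG, form_smul_fin, h.right_eq]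
    rw [eG, hcD, map_mul _ (k 0 * k 1 * k 2), Complex.conj_conj] at e
    have uk : conj (k 0 * k 1 * k 2) * (k 0 * k 1 * k 2) = 1 :=
      conj_mul_self_of_unit (by rw [norm_mul, norm_mul, hk, hk, hk]; norm_num)
    rw [form_smul_fin]
    change _ = conj (conj p.z)
    rw [Complex.conj_conj]
    generalize conj (k 0 * k 1 * k 2) = K' at e uk
    generalize conj (l 0 * l 1 * l 2) = L' at e hll
    refine mul_left_cancel₀ hdc ?_
    linear_combination (r ^ 3 * (k 0 * k 1 * k 2)) * (l 0 * l 1 * l 2) * e +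
        p.z * (r ^ 3 * (l 0 * l 1 * l 2 * τ f')) * uk + p.z * hrw -
        p.d * (r ^ 3 * (k 0 * k 1 * k 2) * τ g') * hll
  · exact tri_eq_zero_of_orthogonal hτ hfin.left
      (by rw [hleft, Complex.norm_real, Real.norm_of_nonneg hd.le]) fun l => hfin.cross l i

end Canon

end ConjugateForms

/-! ### Uniqueness of the parameters -/

theorem eq_of_esymm {r₀ r₁ r₂ s₀ s₁ s₂ : ℝ} (hr : r₁ ≤ r₀) (hr' : r₂ ≤ r₁) (hs : s₁ ≤ s₀)
    (hs' : s₂ ≤ s₁) (e₁ : r₀ + r₁ + r₂ = s₀ + s₁ + s₂)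
    (e₂ : r₀ * r₁ + r₀ * r₂ + r₁ * r₂ = s₀ * s₁ + s₀ * s₂ + s₁ * s₂)
    (e₃ : r₀ * r₁ * r₂ = s₀ * s₁ * s₂) : r₀ = s₀ ∧ r₁ = s₁ ∧ r₂ = s₂ := by
  have hle : r₀ ≤ s₀ := by
    have : (r₀ - s₀) * (r₀ - s₁) * (r₀ - s₂) = 0 := by
      linear_combination r₀ ^ 2 * e₁ - r₀ * e₂ + e₃
    rcases mul_eq_zero.1 this with h | h
    · rcases mul_eq_zero.1 h with h | h <;> linarith
    · linarith
  have hge : s₀ ≤ r₀ := by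
    have : (s₀ - r₀) * (s₀ - r₁) * (s₀ - r₂) = 0 := by
      linear_combination -s₀ ^ 2 * e₁ + s₀ * e₂ - e₃
    rcases mul_eq_zero.1 this with h | h
    · rcases mul_eq_zero.1 h with h | h <;> linarith
    · linarith
  have h0 : r₀ = s₀ := le_antisymm hle hge
  subst h0
  have h1 : r₁ - r₂ = s₁ - s₂ := by
    refine (pow_left_inj₀ (by linarith) (by linarith) two_ne_zero).1 ?_
    linear_combination (r₁ + r₂ + s₁ + s₂ + 4 * r₀) * e₁ - 4 * e₂
  exact ⟨rfl, by linarith, by linarith⟩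

/-- The weak order of the first coordinates. -/
structure Point.Ordered (p : Point) : Prop where
  hab : p.b ≤ p.a
  hbc : p.c ≤ p.b
  hc : 0 ≤ p.c

theorem Point.Ordered.hb {p : Point} (h : p.Ordered) : 0 ≤ p.b := h.hc.trans h.hbc

theorem Point.Ordered.ha {p : Point} (h : p.Ordered) : 0 ≤ p.a := h.hb.trans h.hab

theorem Point.Ordered.eq_of_esymm {p q : Point} (hp : p.Ordered) (hq : q.Ordered)
    (e₁ : q.a ^ 2 + q.b ^ 2 + q.c ^ 2 = p.a ^ 2 + p.b ^ 2 + p.c ^ 2)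
    (e₂ : q.a ^ 2 * q.b ^ 2 + q.a ^ 2 * q.c ^ 2 + q.b ^ 2 * q.c ^ 2 =
      p.a ^ 2 * p.b ^ 2 + p.a ^ 2 * p.c ^ 2 + p.b ^ 2 * p.c ^ 2)
    (e₃ : q.a ^ 2 * q.b ^ 2 * q.c ^ 2 = p.a ^ 2 * p.b ^ 2 * p.c ^ 2) :
    q.a = p.a ∧ q.b = p.b ∧ q.c = p.c := by
  have h := ThreeFermion.eq_of_esymm (pow_le_pow_left₀ hq.hb hq.hab 2)
    (pow_le_pow_left₀ hq.hc hq.hbc 2) (pow_le_pow_left₀ hp.hb hp.hab 2)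
    (pow_le_pow_left₀ hp.hc hp.hbc 2) e₁ e₂ e₃
  exact ⟨(pow_left_inj₀ hq.ha hp.ha two_ne_zero).1 h.1,
    (pow_left_inj₀ hq.hb hp.hb two_ne_zero).1 h.2.1,
    (pow_left_inj₀ hq.hc hp.hc two_ne_zero).1 h.2.2⟩

section Uniqueness

variable {E : Type*} [NormedAddCommGroup E] [InnerProductSpace ℂ E]
variable {τ : E [⋀^Fin 3]→ₗ[ℂ] ℂ} {f₀ g₀ f₁ g₁ f g : Fin 3 → E} {p q : Point}

namespace Canon

theorem charpoly_block (h : Canon τ f g p) :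
    (block τ f g * (block τ f g).conjTranspose).charpoly =
      (Matrix.diagonal fun i => ((![p.a ^ 2, p.b ^ 2, p.c ^ 2] i : ℝ) : ℂ)).charpoly := by
  rw [h.block_eq, diagonal_mul_conjTranspose]
  congr 2
  ext i
  fin_cases i <;> simp

/-- The invariants of a canonical form, read off in a frame with the same first subspace and
a diagonal block. -/
theorem invariants (hE : finrank ℂ E = 6) (h : Canon τ f₀ g₀ p) (h' : Frame f g)
    (hs : ∀ i j, inner ℂ (g₀ j) (f i) = 0) {m : Fin 3 → ℂ} (hm : block τ f g = Matrix.diagonal m) :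
    ‖m 0‖ ^ 2 + ‖m 1‖ ^ 2 + ‖m 2‖ ^ 2 = p.a ^ 2 + p.b ^ 2 + p.c ^ 2 ∧
    ‖m 0‖ ^ 2 * ‖m 1‖ ^ 2 + ‖m 0‖ ^ 2 * ‖m 2‖ ^ 2 + ‖m 1‖ ^ 2 * ‖m 2‖ ^ 2 =
      p.a ^ 2 * p.b ^ 2 + p.a ^ 2 * p.c ^ 2 + p.b ^ 2 * p.c ^ 2 ∧
    ‖m 0‖ ^ 2 * ‖m 1‖ ^ 2 * ‖m 2‖ ^ 2 = p.a ^ 2 * p.b ^ 2 * p.c ^ 2 ∧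
    τ g ^ 2 * τ f * conj (m 0 * m 1 * m 2) = conj p.z ^ 2 * p.d * (p.a * p.b * p.c) := by
  obtain ⟨h1, -, -, h4⟩ := transition_invariants hE τ h.frame h' hs
  rw [h.charpoly_block, hm, diagonal_mul_conjTranspose] at h1
  have h2 := esymm_of_charpoly_diagonal h1
  refine ⟨h2.1, h2.2.1, h2.2.2, ?_⟩
  rw [hm, h.block_eq, Matrix.det_diagonal, Matrix.det_diagonal, Fin.prod_univ_three,
    Fin.prod_univ_three, h.left_eq, h.right_eq] at h4
  rw [h4]
  simp

theorem norm_left_right (hE : finrank ℂ E = 6) (h : Canon τ f₀ g₀ p) (h' : Frame f g)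
    (hs : ∀ i j, inner ℂ (g₀ j) (f i) = 0) (hd : 0 ≤ p.d) : ‖τ f‖ = p.d ∧ ‖τ g‖ = ‖p.z‖ := by
  obtain ⟨-, h2, h3, -⟩ := transition_invariants hE τ h.frame h' hs
  rw [h2, h3, h.left_eq, h.right_eq, Complex.norm_real, Real.norm_of_nonneg hd, Complex.norm_conj]
  exact ⟨rfl, rfl⟩

theorem sum_block (hE : finrank ℂ E = 6) (h : Canon τ f₀ g₀ p) (h' : Frame f g)
    (hs : ∀ i j, inner ℂ (g₀ j) (f i) = 0) :
    ∑ i, ∑ j, ‖block τ f g i j‖ ^ 2 = p.a ^ 2 + p.b ^ 2 + p.c ^ 2 := by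
  have h1 := (transition_invariants hE τ h.frame h' hs).1
  rw [h.charpoly_block] at h1
  have h2 : (block τ f g * (block τ f g).conjTranspose).trace =
      (Matrix.diagonal fun i => ((![p.a ^ 2, p.b ^ 2, p.c ^ 2] i : ℝ) : ℂ)).trace := by
    rw [Matrix.trace_eq_neg_charpoly_coeff, Matrix.trace_eq_neg_charpoly_coeff, h1]
  have h3 : (block τ f g * (block τ f g).conjTranspose).trace =
      ((∑ i, ∑ j, ‖block τ f g i j‖ ^ 2 : ℝ) : ℂ) := by
    push_cast
    refine Finset.sum_congr rfl fun i _ => ?_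
    rw [Matrix.diag_apply, Matrix.mul_apply]
    refine Finset.sum_congr rfl fun j _ => ?_
    rw [Matrix.conjTranspose_apply, ← Complex.mul_conj']
    rfl
  rw [h3, Matrix.trace_diagonal, ← Complex.ofReal_sum, Complex.ofReal_inj] at h2
  rw [h2, Fin.sum_univ_three]
  rfl

/-- A block entry of maximal modulus makes the canonical form degenerate. -/
theorem degenerate (hE : finrank ℂ E = 6) (h : Canon τ f₀ g₀ p) (h' : Frame f g)
    (hs : ∀ i j, inner ℂ (g₀ j) (f i) = 0) (hp : p.Ordered)
    (hle : p.a ^ 2 + p.b ^ 2 + p.c ^ 2 ≤ p.d ^ 2) (hd : 0 ≤ p.d) {k : Fin 3}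
    (hk : ‖block τ f g k k‖ = p.d) : p.a = p.d ∧ p.b = 0 ∧ p.c = 0 := by
  have hsum := h.sum_block hE h' hs
  -- The squared moduli of the entries sum to `a² + b² + c² ≤ d²`, which the entry `(k, k)` already
  -- exhausts.
  have hoff : ∀ i j, (i, j) ≠ (k, k) → block τ f g i j = 0 := by
    intro i j hij
    have h1 : ∑ x ∈ {(i, j), (k, k)}, ‖block τ f g x.1 x.2‖ ^ 2 ≤
        ∑ x : Fin 3 × Fin 3, ‖block τ f g x.1 x.2‖ ^ 2 :=
      Finset.sum_le_sum_of_subset_of_nonneg (Finset.subset_univ _) fun _ _ _ => sq_nonneg _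
    rw [Finset.sum_pair hij, Fintype.sum_prod_type, hsum] at h1
    simp only [hk] at h1
    have h2 : ‖block τ f g i j‖ ^ 2 = 0 := le_antisymm (by linarith) (sq_nonneg _)
    exact norm_eq_zero.1 (pow_eq_zero_iff two_ne_zero |>.1 h2)
  have hm : block τ f g = Matrix.diagonal fun i => if i = k then block τ f g k k else 0 := by
    ext i j
    rw [Matrix.diagonal_apply]
    split_ifs with h1 h2
    · rw [← h1, h2]
    · exact hoff i j fun h => h2 (congrArg Prod.fst h)
    · exact hoff i j fun h => h1 ((congrArg Prod.fst h).trans (congrArg Prod.snd h).symm)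
  obtain ⟨e1, e2, -, -⟩ := h.invariants hE h' hs hm
  have e1' : p.d ^ 2 = p.a ^ 2 + p.b ^ 2 + p.c ^ 2 := by
    rw [← e1]
    fin_cases k <;> simp at hk ⊢ <;> rw [hk]
  have e2' : p.a ^ 2 * p.b ^ 2 + p.a ^ 2 * p.c ^ 2 + p.b ^ 2 * p.c ^ 2 = 0 := by
    rw [← e2]
    fin_cases k <;> simp
  have hq : Point.Ordered (p.d, 0, 0, p.d, 0) := ⟨hd, le_rfl, le_rfl⟩
  exact hq.eq_of_esymm hp (by simp [Point.a, Point.b, Point.c] at e1' ⊢; linarith)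
    (by simpa [Point.a, Point.b, Point.c] using e2') (by
      have : p.b ^ 2 * p.c ^ 2 = 0 := by
        refine le_antisymm ?_ (by positivity)
        have : 0 ≤ p.a ^ 2 * p.b ^ 2 := by positivity
        have : 0 ≤ p.a ^ 2 * p.c ^ 2 := by positivity
        linarith
      rw [mul_assoc, this]
      simp [Point.a, Point.b, Point.c])

end Canon

end Uniqueness

section Uniqueness

variable {E : Type*} [NormedAddCommGroup E] [InnerProductSpace ℂ E]
variable {τ : E [⋀^Fin 3]→ₗ[ℂ] ℂ} {f₀ g₀ f₁ g₁ f g : Fin 3 → E} {p q : Point}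

/-- `Φ` involves only invariants of the maximizing subspace, so it may be evaluated in the principal
frame instead of the canonical one. -/
theorem Point.phi_eq_zero_of_turn {c s : Fin 3 → ℝ} (hcs : ∀ i, c i ^ 2 + s i ^ 2 = 1)
    (hs : ∀ i, s i ≠ 0) (h : Frame f g) (hτ : Bounded τ p.d) (hd0 : 0 < p.d) (hd : ‖τ f‖ = p.d)
    (hd' : ‖τ (turnLeft c s f g)‖ = p.d) (hr : ‖τ g‖ = ‖p.z‖)
    (e₁ : ‖block τ f g 0 0‖ ^ 2 + ‖block τ f g 1 1‖ ^ 2 + ‖block τ f g 2 2‖ ^ 2 =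
      p.a ^ 2 + p.b ^ 2 + p.c ^ 2)
    (e₃ : ‖block τ f g 0 0‖ ^ 2 * ‖block τ f g 1 1‖ ^ 2 * ‖block τ f g 2 2‖ ^ 2 =
      p.a ^ 2 * p.b ^ 2 * p.c ^ 2)
    (e₄ : τ g ^ 2 * τ f * conj (block τ f g 0 0 * block τ f g 1 1 * block τ f g 2 2) =
      conj p.z ^ 2 * p.d * (p.a * p.b * p.c)) : p.Phi = 0 := by
  have hZ := turn_right h hcs hτ hd hd' 0
  have hm : ∀ k, (s (k + 1) : ℂ) * s (k + 2) * block τ f g k k =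
      c k * τ (turnLeft c s f g) - c (k + 1) * c (k + 2) * τ f := fun k => by
    have := turn_block h hcs hτ hd hd' k k
    rwa [if_pos rfl] at this
  have key := phi_turn_eq_zero hcs hs hd0 (m := fun k => block τ f g k k) hd hd' hm hZ
  rw [e₁, e₃, e₄, hr] at key
  have hre : (conj p.z ^ 2 * p.d * (p.a * p.b * p.c) : ℂ).re =
      p.a * p.b * p.c * p.d * (p.x ^ 2 - p.y ^ 2) := by
    simp only [pow_two, Complex.mul_re, Complex.mul_im, Complex.conj_re, Complex.conj_im,
      Complex.ofReal_re, Complex.ofReal_im]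
    ring
  rw [hre] at key
  rw [Point.Phi]
  linarith

theorem Point.norm_z_eq (hp : p ∈ sphere) (hq : q ∈ sphere) (ha : q.a = p.a) (hb : q.b = p.b)
    (hc : q.c = p.c) (hd : q.d = p.d) : ‖q.z‖ = ‖p.z‖ := by
  have h1 : p.a ^ 2 + p.b ^ 2 + p.c ^ 2 + p.d ^ 2 + ‖p.z‖ ^ 2 = 1 := hp
  have h2 : q.a ^ 2 + q.b ^ 2 + q.c ^ 2 + q.d ^ 2 + ‖q.z‖ ^ 2 = 1 := hq
  rw [ha, hb, hc, hd] at h2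
  exact (pow_left_inj₀ (norm_nonneg _) (norm_nonneg _) two_ne_zero).1 (by linarith)

/-- Two canonical forms of one alternating form. -/
theorem Canon.uniqueness (hE : finrank ℂ E = 6) (hp : Canon τ f₀ g₀ p) (hq : Canon τ f₁ g₁ q)
    (hτ : Bounded τ p.d) (hd0 : 0 < p.d) (hd : q.d = p.d) (op : p.Ordered) (oq : q.Ordered)
    (sp : p ∈ sphere) (sq : q ∈ sphere) :
    q.a = p.a ∧ q.b = p.b ∧ q.c = p.c ∧ ‖q.z‖ = ‖p.z‖ ∧
      (p.c = 0 ∨ q.z ^ 2 = p.z ^ 2 ∨ q.z ^ 2 = conj p.z ^ 2 ∧ p.Phi = 0) := by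
  obtain ⟨f, g, c, s, hF, hcs, hs, hin, hin'⟩ := exists_principal hE hp.frame hq.frame
  have hF' := hF.turn hcs
  obtain ⟨n1, n2⟩ := hp.norm_left_right hE hF hin hd0.le
  obtain ⟨n1', -⟩ := hq.norm_left_right hE hF' hin' (hd ▸ hd0.le)
  have hdc : (p.d : ℂ) ≠ 0 := by exact_mod_cast hd0.ne'
  have abc : p.c ≠ 0 → (p.a * p.b * p.c : ℂ) ≠ 0 := by
    intro hc
    have h1 : 0 < p.c := lt_of_le_of_ne op.hc (Ne.symm hc)
    have h2 := h1.trans_le op.hbc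
    have h3 := h2.trans_le op.hab
    exact_mod_cast (mul_pos (mul_pos h3 h2) h1).ne'
  -- All sines vanish: the subspaces coincide, and their common invariants give `a, b, c` and, for
  -- `c ≠ 0`, also `z²`.
  by_cases h0 : ∀ i, s i = 0
  · have hin0 : ∀ i j, inner ℂ (g₁ j) (f₀ i) = 0 := by
      have hc0 : ∀ i, c i ≠ 0 := fun i hi => by
        have := hcs i
        rw [h0, hi] at this
        norm_num at this
      have h1 : ∀ i j, inner ℂ (g₁ j) (f i) = 0 := fun i j => by
        have := hin' i j
        rw [turnLeft, h0, Complex.ofReal_zero, zero_smul, add_zero, inner_smul_right] at this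
        exact (mul_eq_zero.1 this).resolve_left (by exact_mod_cast hc0 i)
      intro i j
      obtain ⟨P, Q, -, -, eP, eQ⟩ := exists_transition hE hF hp.frame fun i j => by
        obtain ⟨P, Q, -, uQ, -, eQ⟩ := exists_transition hE hp.frame hF hin
        rw [eQ, sum_inner]
        exact Finset.sum_eq_zero fun k _ => by rw [inner_smul_left, hp.frame.cross', mul_zero]
      rw [eP, inner_sum]
      exact Finset.sum_eq_zero fun k _ => by rw [inner_smul_right, h1, mul_zero]
    obtain ⟨e1, e2, e3, e4⟩ := hq.invariants hE hp.frame hin0 hp.block_eq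
    have e := op.eq_of_esymm oq (by simpa using e1.symm) (by simpa using e2.symm)
      (by simpa using e3.symm)
    refine ⟨e.1, e.2.1, e.2.2, Point.norm_z_eq sp sq e.1 e.2.1 e.2.2 hd, ?_⟩
    by_cases hc : p.c = 0
    · exact Or.inl hc
    · refine Or.inr (Or.inl ?_)
      rw [hp.left_eq, hp.right_eq, e.1, e.2.1, e.2.2, hd] at e4
      simp only [Matrix.cons_val, map_mul, Complex.conj_ofReal] at e4
      have h1 := mul_right_cancel₀ hdc (mul_right_cancel₀ (abc hc) e4)
      have h2 := congrArg conj h1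
      simp only [map_pow, Complex.conj_conj] at h2
      exact h2.symm
  -- Different subspaces sharing a principal direction: both points have `a = d` and `b = c = 0`.
  by_cases h1 : ∃ k, s k = 0
  · obtain ⟨k, hk⟩ := h1
    have hp' := hp.degenerate hE hF hin op (hp.admissible hτ hd0 op.hab op.hbc op.hc).sum_le hd0.le
      ((turn_degenerate hF hcs hs hτ n1 (hd ▸ n1') hd0 hk).resolve_left h0)
    have hq' := hq.degenerate hE hF' hin' oq
      (hq.admissible (hd ▸ hτ) (hd ▸ hd0) oq.hab oq.hbc oq.hc).sum_le (hd ▸ hd0.le)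
      ((turn_degenerate hF' hcs hs (hd ▸ hτ) n1' (by rw [turn_turn_left hcs, n1, hd]) (hd ▸ hd0)
        hk).resolve_left h0)
    have ea : q.a = p.a := by rw [hq'.1, hp'.1, hd]
    have eb : q.b = p.b := by rw [hq'.2.1, hp'.2.1]
    have ec : q.c = p.c := by rw [hq'.2.2, hp'.2.2]
    exact ⟨ea, eb, ec, Point.norm_z_eq sp sq ea eb ec hd, Or.inl hp'.2.2⟩
  -- General position: all coordinates are conjugate up to phases of modulus one.
  · push Not at h1
    rw [hd] at n1'
    obtain ⟨off, off', dg, rt⟩ := turn_conj hF hcs h1 hτ n1 n1'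
    have diag : ∀ M : Matrix (Fin 3) (Fin 3) ℂ, (∀ i j, i ≠ j → M i j = 0) →
        M = Matrix.diagonal fun i => M i i := fun M hM => by
      ext i j
      rw [Matrix.diagonal_apply]
      split_ifs with hij
      · rw [hij]
      · exact hM i j hij
    obtain ⟨e1, e2, e3, e4⟩ := hp.invariants hE hF hin (diag _ off)
    obtain ⟨e1', e2', e3', e4'⟩ := hq.invariants hE hF' hin' (diag _ off')
    have hnorm : ∀ i, ‖block τ (turnLeft c s f g) (turnRight c s f g) i i‖ = ‖block τ f g i i‖ := by
      intro i
      have := congrArg norm (dg i)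
      rw [norm_mul, norm_mul, Complex.norm_conj, Complex.norm_conj, n1, n1'] at this
      exact mul_left_cancel₀ hd0.ne' this
    simp only [hnorm] at e1' e2' e3'
    have e := op.eq_of_esymm oq (e1'.symm.trans e1) (e2'.symm.trans e2) (e3'.symm.trans e3)
    refine ⟨e.1, e.2.1, e.2.2, Point.norm_z_eq sp sq e.1 e.2.1 e.2.2 hd, ?_⟩
    by_cases hc : p.c = 0
    · exact Or.inl hc
    · refine Or.inr (Or.inr ⟨?_, Point.phi_eq_zero_of_turn hcs h1 hF hτ hd0 n1 n1' n2 e1 e3 e4⟩)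
      rw [e.1, e.2.1, e.2.2, hd] at e4'
      have c0 := congrArg conj (dg 0)
      have c1 := congrArg conj (dg 1)
      have c2 := congrArg conj (dg 2)
      have c4 := congrArg conj e4
      simp only [map_mul, map_pow, Complex.conj_conj, Complex.conj_ofReal] at c0 c1 c2 c4 e4 e4'
      have hD := mul_conj_of_norm n1
      have hD' := mul_conj_of_norm n1'
      have hDc : conj (τ f) ≠ 0 := by
        intro h
        rw [h, mul_zero] at hD
        exact hdc (pow_eq_zero_iff two_ne_zero |>.1 hD.symm)
      generalize τ f = D at *
      generalize τ (turnLeft c s f g) = D' at *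
      generalize τ (turnRight c s f g) = Z' at *
      generalize τ g = Z at *
      -- The product of the conjugation relations turns the phase invariant of `q` into the
      -- conjugate of that of `p`.
      have hkey : conj q.z ^ 2 * p.d * (p.a * p.b * p.c) = p.z ^ 2 * p.d * (p.a * p.b * p.c) := by
        have t1 : (conj D * Z') ^ 2 * D' * ((D * conj (block τ (turnLeft c s f g) (turnRight c s f g) 0 0)) *
          (D * conj (block τ (turnLeft c s f g) (turnRight c s f g) 1 1)) *
          (D * conj (block τ (turnLeft c s f g) (turnRight c s f g) 2 2))) =
          (D' * conj Z) ^ 2 * D' * ((conj D' * block τ f g 0 0) * (conj D' * block τ f g 1 1) *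
            (conj D' * block τ f g 2 2)) := by
          rw [rt, c0, c1, c2]
        have t2 : (D * conj D) ^ 2 * D * (Z' ^ 2 * D' *
          (conj (block τ (turnLeft c s f g) (turnRight c s f g) 0 0) *
          conj (block τ (turnLeft c s f g) (turnRight c s f g) 1 1) *
          conj (block τ (turnLeft c s f g) (turnRight c s f g) 2 2))) =
          (D' * conj D') ^ 3 * (conj Z ^ 2 * (block τ f g 0 0 * block τ f g 1 1 * block τ f g 2 2)) := by
          linear_combination t1
        rw [e4', hD, hD'] at t2
        have hd6 : (p.d : ℂ) ^ 6 ≠ 0 := pow_ne_zero _ hdc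
        refine mul_left_cancel₀ hd6 ?_
        linear_combination conj D * t2 + p.d ^ 6 * c4 - p.d ^ 4 * conj q.z ^ 2 * p.d * (p.a * p.b * p.c) * hD
      have h1 := mul_right_cancel₀ hdc (mul_right_cancel₀ (abc hc) hkey)
      have h2 := congrArg conj h1
      simp only [map_pow, Complex.conj_conj] at h2
      exact h2

end Uniqueness

/-! ### Phase changes of a canonical frame -/

section Rescale

variable {E : Type*} [NormedAddCommGroup E] [InnerProductSpace ℂ E]
variable {τ : E [⋀^Fin 3]→ₗ[ℂ] ℂ} {f g : Fin 3 → E} {p : Point}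

/-- Change of the phases of the vectors of a canonical frame. -/
theorem Canon.rescale (h : Canon τ f g p) {r s : Fin 3 → ℂ} (hr : ∀ i, ‖r i‖ = 1)
    (hs : ∀ i, ‖s i‖ = 1) (hl : r 0 * r 1 * r 2 = 1)
    (hm : ∀ i, r i * s (i + 1) * s (i + 2) * ![(p.a : ℂ), p.b, p.c] i = ![(p.a : ℂ), p.b, p.c] i)
    {z : ℂ} (hz : s 0 * s 1 * s 2 * conj p.z = conj z) :
    ∃ f' g' : Fin 3 → E, Canon τ f' g' (p.a, p.b, p.c, p.d, z) := by
  refine ⟨_, _, h.frame.smul hr hs, ?_, ?_, ?_, fun i j => ?_⟩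
  · ext i j
    rw [block_smul, h.block_eq]
    change _ = Matrix.diagonal ![(p.a : ℂ), p.b, p.c] i j
    rw [Matrix.diagonal_apply]
    split_ifs with hij
    · rw [← hij]; exact hm i
    · rw [mul_zero]
  · rw [form_smul_fin, h.left_eq, hl, one_mul]
  · rw [form_smul_fin, h.right_eq, hz]
  · rw [tri_smul_left, tri_smul_mid, tri_smul_right, h.crit]
    simp

/-- When `c = 0`, the third block entry imposes no condition on the phases, which frees one phase
for `z`. -/
theorem Canon.exists_rotate (h : Canon τ f g p) (hc : p.c = 0) :
    ∃ f' g' : Fin 3 → E, Canon τ f' g' (p.a, p.b, p.c, p.d, (‖p.z‖ : ℂ)) := by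
  obtain ⟨u, hu, eu⟩ := exists_unit_mul_eq_norm p.z
  have huu := conj_mul_self_of_unit hu
  refine h.rescale (r := ![u, u, conj u ^ 2]) (s := ![1, 1, conj u]) (fun i => ?_) (fun i => ?_) ?_
    (fun i => ?_) ?_
  · fin_cases i <;> simp [hu]
  · fin_cases i <;> simp [hu]
  · simp only [Matrix.cons_val]
    linear_combination (conj u * u + 1) * huu
  · fin_cases i
    · change u * 1 * conj u * (p.a : ℂ) = p.a
      linear_combination p.a * huu
    · change u * conj u * 1 * (p.b : ℂ) = p.b
      linear_combination p.b * huu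
    · simp [hc]
  · rw [← eu]; simp

/-- Replacing `g` by `-g` preserves the block, of degree two in `g`, and negates `τ g`, of degree
three. -/
theorem Canon.exists_neg (h : Canon τ f g p) :
    ∃ f' g' : Fin 3 → E, Canon τ f' g' (p.a, p.b, p.c, p.d, -p.z) :=
  h.rescale (r := fun _ => 1) (s := fun _ => -1) (fun _ => by simp) (fun _ => by simp) (by simp)
    (fun _ => by simp) (by simp)

end Rescale

/-! ### Back to states and the canonical region -/

theorem form_comp_symm {φ ψ : W3} {U : V ≃ₗᵢ[ℂ] V}
    (hU : ψ = exteriorPower.map 3 U.toLinearEquiv.toLinearMap φ) (h : Fin 3 → V) :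
    form φ (U.symm ∘ h) = form ψ h := by
  rw [hU, ← form_map U φ]
  congr 1
  ext i
  simp

theorem LUEquiv.isMu_iff {φ ψ : W3} (h : LUEquiv φ ψ) (m : ℝ) : IsMu φ m ↔ IsMu ψ m := by
  obtain ⟨U, hU⟩ := h
  have key := form_comp_symm hU
  have key' : ∀ h : Fin 3 → V, form ψ (U ∘ h) = form φ h := fun h => by
    rw [← key]
    congr 1
    ext i
    simp
  rw [ThreeFermion.isMu_iff, ThreeFermion.isMu_iff]
  constructor
  · rintro ⟨hb, x, hx, e⟩
    exact ⟨fun x hx => key x ▸ hb _ (hx.comp_linearIsometry U.symm.toLinearIsometry),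
      U ∘ x, hx.comp_linearIsometry U.toLinearIsometry, by rw [key', e]⟩
  · rintro ⟨hb, x, hx, e⟩
    exact ⟨fun x hx => key' x ▸ hb _ (hx.comp_linearIsometry U.toLinearIsometry),
      U.symm ∘ x, hx.comp_linearIsometry U.symm.toLinearIsometry, by rw [key, e]⟩

theorem braket_state (p : Point) : braket p.state p.state =
    ((p.a ^ 2 + p.b ^ 2 + p.c ^ 2 + p.d ^ 2 + ‖p.z‖ ^ 2 : ℝ) : ℂ) := by
  have key : ∀ l m n, braket p.state (e l m n) = tri (form p.state) (ket l) (ket m) (ket n) :=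
    fun l m n => (form_apply _ _).symm
  have e1 : braket p.state p.state = p.a * braket p.state (e 1 2 4) +
      p.b * braket p.state (e 0 3 4) + p.c * braket p.state (e 0 2 5) +
      p.d * braket p.state (e 1 3 5) + p.z * braket p.state (e 0 2 4) := by
    conv_lhs => arg 2; rw [Point.state]
    simp only [braket_add_right, braket_smul_right]
  rw [e1]
  have hz := Complex.mul_conj' p.z
  push_cast
  rw [← hz]
  simp only [key, tri_state, Matrix.det_fin_three]
  simp
  ring

theorem LUEquiv.mem_sphere {φ : W3} {p : Point} (h : LUEquiv φ p.state) (hφ : Normalized φ) :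
    p ∈ sphere := by
  obtain ⟨U, hU⟩ := h
  have h1 := braket_map U φ φ
  rw [← hU, braket_state, hφ] at h1
  exact_mod_cast h1

theorem Delta.ordered {p : Point} (hp : p ∈ Delta) : p.Ordered := ⟨hp.2.1, hp.2.2.1, hp.2.2.2.1⟩

theorem Delta.bounded {p : Point} (hp : p ∈ Delta) : Bounded (form p.state) p.d :=
  ((isMu_iff _ _).1 hp.2.2.2.2.2).1

/-- Up to conjugation, all coordinates of `p` are values of the form at orthonormal triples. They
would vanish with the maximum `d`, contrary to normalization. -/
theorem Delta.d_pos {p : Point} (hp : p ∈ Delta) : 0 < p.d := by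
  have hb := Delta.bounded hp
  have hc := canon_ket p
  have hd := hb.nonneg hc.frame.left
  refine lt_of_le_of_ne hd fun h0 => ?_
  have h1 : ∀ i : Fin 3, ‖![(p.a : ℂ), p.b, p.c] i‖ = 0 := fun i => by
    have hi := hb.norm_tri_le (hc.frame.cross i (i + 1)) (hc.frame.cross i (i + 2))
      (hc.frame.right.2 (i := i + 1) (j := i + 2) (by decide +revert))
    rw [hc.block_apply, if_pos rfl, ← h0, zero_mul] at hi
    exact le_antisymm hi (norm_nonneg _)
  have hz := hb _ hc.frame.right
  rw [hc.right_eq, ← h0, Complex.norm_conj] at hz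
  have hz0 := le_antisymm hz (norm_nonneg _)
  have ha : p.a = 0 := by simpa using h1 0
  have hb' : p.b = 0 := by simpa using h1 1
  have hc' : p.c = 0 := by simpa using h1 2
  have hs : p.a ^ 2 + p.b ^ 2 + p.c ^ 2 + p.d ^ 2 + ‖p.z‖ ^ 2 = 1 := hp.1
  rw [ha, hb', hc', ← h0, hz0] at hs
  norm_num at hs

theorem Delta.admissible {p : Point} (hp : p ∈ Delta) : Admissible p.a p.b p.c p.d p.x p.y :=
  have o := Delta.ordered hp
  (canon_ket p).admissible (Delta.bounded hp) (Delta.d_pos hp) o.hab o.hbc o.hc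

theorem Delta.phi_nonneg {p : Point} (hp : p ∈ Delta) : 0 ≤ p.Phi := by
  rw [Canon.phi_eq]
  exact (Delta.admissible hp).phi_nonneg

section Representatives

variable {φ : W3} {p q : Point}

theorem Delta.bounded_of_lUEquiv (hp : p ∈ Delta) (h : LUEquiv φ p.state) :
    Bounded (form φ) p.d :=
  ((isMu_iff _ _).1 ((h.isMu_iff _).2 hp.2.2.2.2.2)).1

theorem exists_mem_delta (hφ : Normalized φ) : ∃ p ∈ Delta, LUEquiv φ p.state := by
  obtain ⟨f, g, p, h, hb, hd, hab, hbc, hc, hx⟩ := exists_canon finrank_V (form φ)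
  have hL : LUEquiv φ p.state := (lUEquiv_iff φ p).2 ⟨f, g, h⟩
  refine ⟨p, ⟨hL.mem_sphere hφ, hab, hbc, hc, hx, (hL.isMu_iff _).1 ?_⟩, hL⟩
  exact (isMu_iff _ _).2 ⟨hb, f, h.frame.left, h.le_left hb⟩

/-- A change of the last coordinate which preserves its modulus. -/
theorem Delta.of_canon (hp : p ∈ Delta) (h : LUEquiv φ p.state) {z : ℂ} (hz : ‖z‖ = ‖p.z‖)
    (hx : 0 ≤ z.re) (hc : ∃ f g : Fin 3 → V, Canon (form φ) f g (p.a, p.b, p.c, p.d, z)) :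
    ((p.a, p.b, p.c, p.d, z) : Point) ∈ Delta ∧
      LUEquiv φ (Point.state (p.a, p.b, p.c, p.d, z)) := by
  have hL := (lUEquiv_iff φ _).2 hc
  obtain ⟨h1, h2, h3, h4, -, h6⟩ := hp
  refine ⟨⟨?_, h2, h3, h4, hx, (hL.isMu_iff _).1 ((h.isMu_iff _).2 h6)⟩, hL⟩
  change p.a ^ 2 + p.b ^ 2 + p.c ^ 2 + p.d ^ 2 + ‖z‖ ^ 2 = 1
  rw [hz]
  exact h1

theorem Delta.uniqueness (hp : p ∈ Delta) (h : LUEquiv φ p.state) (hq : q ∈ Delta)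
    (h' : LUEquiv φ q.state) : q.a = p.a ∧ q.b = p.b ∧ q.c = p.c ∧ q.d = p.d ∧ ‖q.z‖ = ‖p.z‖ ∧
      (p.c = 0 ∨ q.z ^ 2 = p.z ^ 2 ∨ q.z ^ 2 = conj p.z ^ 2 ∧ p.Phi = 0) := by
  obtain ⟨f, g, hc⟩ := (lUEquiv_iff φ p).1 h
  obtain ⟨f', g', hc'⟩ := (lUEquiv_iff φ q).1 h'
  have hd : q.d = p.d := ((h'.isMu_iff _).2 hq.2.2.2.2.2).unique ((h.isMu_iff _).2 hp.2.2.2.2.2)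
  obtain ⟨e1, e2, e3, e4, e5⟩ := hc.uniqueness finrank_V hc' (Delta.bounded_of_lUEquiv hp h)
    (Delta.d_pos hp) hd (Delta.ordered hp) (Delta.ordered hq) hp.1 hq.1
  exact ⟨e1, e2, e3, hd, e4, e5⟩

theorem Point.ext_of_eq (h1 : q.a = p.a) (h2 : q.b = p.b) (h3 : q.c = p.c) (h4 : q.d = p.d)
    (h5 : q.x = p.x) (h6 : q.y = p.y) : q = p :=
  Prod.ext h1 (Prod.ext h2 (Prod.ext h3 (Prod.ext h4 (Complex.ext h5 h6))))

theorem Delta.eq_of_pos (hp : p ∈ Delta) (h : LUEquiv φ p.state) (hq : q ∈ Delta)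
    (h' : LUEquiv φ q.state) (hpos : 0 < p.c * p.x * p.Phi) : q = p := by
  obtain ⟨e1, e2, e3, e4, -, e5⟩ := Delta.uniqueness hp h hq h'
  have hx : 0 < p.x := by
    refine lt_of_le_of_ne hp.2.2.2.2.1 fun h0 => ?_
    rw [← h0] at hpos
    simp at hpos
  rcases e5 with h0 | h0 | ⟨-, h0⟩
  · rw [h0] at hpos
    simp at hpos
  · rcases sq_eq_sq_iff_eq_or_eq_neg.1 h0 with hz | hz
    · exact Point.ext_of_eq e1 e2 e3 e4 (by rw [Point.x, hz]) (by rw [Point.y, hz])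
    · have h1 : q.x = -p.x := by rw [Point.x, hz, Complex.neg_re]
      have h2 : 0 ≤ q.x := hq.2.2.2.2.1
      linarith
  · rw [h0] at hpos
    simp at hpos

/-- Each vanishing factor brings its own symmetry: a free phase of `z` for `c = 0`, a change of sign
for `x = 0`, and conjugation for `Φ = 0`. -/
theorem Delta.exists_normal (hp : p ∈ Delta) (h : LUEquiv φ p.state)
    (h0 : p.c * p.x * p.Phi = 0) :
    ∃ q : Point, q ∈ Delta ∧ LUEquiv φ q.state ∧ 0 ≤ q.y ∧ (q.c = 0 → q.y = 0) := by
  obtain ⟨f, g, hc⟩ := (lUEquiv_iff φ p).1 h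
  by_cases hc0 : p.c = 0
  · obtain ⟨h1, h2⟩ := Delta.of_canon hp h (z := (‖p.z‖ : ℂ)) (by simp) (by simp)
      (hc.exists_rotate hc0)
    exact ⟨_, h1, h2, by simp [Point.y, Point.z], fun _ => by simp [Point.y, Point.z]⟩
  by_cases hy : 0 ≤ p.y
  · exact ⟨p, hp, h, hy, fun h1 => absurd h1 hc0⟩
  by_cases hx0 : p.x = 0
  · obtain ⟨h1, h2⟩ := Delta.of_canon hp h (z := -p.z) (by simp)
      (by rw [Complex.neg_re]; exact (neg_eq_zero.2 hx0).ge) hc.exists_neg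
    refine ⟨_, h1, h2, ?_, fun h3 => absurd h3 hc0⟩
    change 0 ≤ (-p.z).im
    rw [Complex.neg_im]
    push Not at hy
    exact (neg_pos.2 hy).le
  · have hΦ : p.Phi = 0 := (mul_eq_zero.1 h0).resolve_left (mul_ne_zero hc0 hx0)
    have hx : 0 ≤ p.x := hp.2.2.2.2.1
    obtain ⟨h1, h2⟩ := Delta.of_canon hp h (z := conj p.z) (by simp) (by simpa using hx)
      (hc.exists_conj (Delta.bounded_of_lUEquiv hp h) (Delta.admissible hp)
        (lt_of_le_of_ne hx (Ne.symm hx0)) (lt_of_le_of_ne hp.2.2.2.1 (Ne.symm hc0)) hΦ)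
    refine ⟨_, h1, h2, ?_, fun h3 => absurd h3 hc0⟩
    change 0 ≤ (conj p.z).im
    rw [Complex.conj_im]
    push Not at hy
    exact (neg_pos.2 hy).le

/-- If `c ≠ 0`, the last coordinates differ at most by sign and conjugation, which `x, y ≥ 0` makes
ineffective. If `c = 0`, then `y = 0` and the modulus decides. -/
theorem Delta.normal_unique (hp : p ∈ Delta) (h : LUEquiv φ p.state) (hq : q ∈ Delta)
    (h' : LUEquiv φ q.state) (hy : 0 ≤ p.y) (hy' : 0 ≤ q.y) (hc : p.c = 0 → p.y = 0)
    (hc' : q.c = 0 → q.y = 0) : q = p := by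
  obtain ⟨e1, e2, e3, e4, e5, e6⟩ := Delta.uniqueness hp h hq h'
  have hx : 0 ≤ p.x := hp.2.2.2.2.1
  have hx' : 0 ≤ q.x := hq.2.2.2.2.1
  suffices q.x = p.x ∧ q.y = p.y from Point.ext_of_eq e1 e2 e3 e4 this.1 this.2
  rcases e6 with h0 | h0 | ⟨h0, -⟩
  · have y0 := hc h0
    have y0' := hc' (e3.trans h0)
    refine ⟨?_, y0'.trans y0.symm⟩
    have h1 := congrArg (fun t : ℝ => t ^ 2) e5
    simp only [Complex.sq_norm, Complex.normSq_apply] at h1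
    refine (pow_left_inj₀ hx' hx two_ne_zero).1 ?_
    rw [Point.y] at y0 y0'
    rw [y0, y0'] at h1
    linarith
  · rcases sq_eq_sq_iff_eq_or_eq_neg.1 h0 with hz | hz
    · exact ⟨congrArg Complex.re hz, congrArg Complex.im hz⟩
    · have h1 := congrArg Complex.re hz
      have h2 := congrArg Complex.im hz
      rw [Complex.neg_re] at h1
      rw [Complex.neg_im] at h2
      exact ⟨by linarith, by linarith⟩
  · rcases sq_eq_sq_iff_eq_or_eq_neg.1 h0 with hz | hz
    · have h1 := congrArg Complex.re hz
      have h2 := congrArg Complex.im hz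
      rw [Complex.conj_re] at h1
      rw [Complex.conj_im] at h2
      exact ⟨by linarith, by linarith⟩
    · have h1 := congrArg Complex.re hz
      have h2 := congrArg Complex.im hz
      rw [Complex.neg_re, Complex.conj_re] at h1
      rw [Complex.neg_im, Complex.conj_im] at h2
      exact ⟨by linarith, by linarith⟩

end Representatives

/-! ### The relative interior -/

section Interior

variable {p : Point}

/-- Small displacements of an interior point remain in the region after normalization. -/
theorem DeltaInterior.exists_smul_mem (hp : p ∈ DeltaInterior) (v : Point) :
    ∃ ε t : ℝ, 0 < ε ∧ 0 < t ∧ t • (p + ε • v) ∈ Delta := by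
  let N : Point → ℝ := fun q => q.a ^ 2 + q.b ^ 2 + q.c ^ 2 + q.d ^ 2 + ‖q.z‖ ^ 2
  have hN : Continuous N := by
    simp only [N, Point.a, Point.b, Point.c, Point.d, Point.z]
    fun_prop
  have hp1 : N p = 1 := hp.1.1
  let w : ℝ → Point := fun ε => p + ε • v
  have hw : Continuous w := by fun_prop
  have hw0 : w 0 = p := by simp [w]
  have hpos : ∀ᶠ ε in 𝓝 (0 : ℝ), 0 < N (w ε) :=
    (hN.comp hw).continuousAt.eventually_const_lt (by simp [hw0, hp1])
  let γ : ℝ → Point := fun ε => (Real.sqrt (N (w ε)))⁻¹ • w ε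
  have hγ : Filter.Tendsto γ (𝓝 0) (𝓝 p) := by
    have h1 : ContinuousAt γ 0 := by
      have hsq : ContinuousAt (fun ε => Real.sqrt (N (w ε))) 0 :=
        (Real.continuous_sqrt.comp (hN.comp hw)).continuousAt
      exact (hsq.inv₀ (by simp [hw0, hp1])).smul hw.continuousAt
    have h2 : γ 0 = p := by simp [γ, hw0, hp1]
    rw [ContinuousAt, h2] at h1
    exact h1
  have hsph : ∀ᶠ ε in 𝓝 (0 : ℝ), γ ε ∈ sphere := by
    filter_upwards [hpos] with ε hε
    have h1 : N (γ ε) = ((Real.sqrt (N (w ε)))⁻¹) ^ 2 * N (w ε) := by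
      simp only [N, γ, Point.a, Point.b, Point.c, Point.d, Point.z, Prod.smul_fst, Prod.smul_snd,
        smul_eq_mul, norm_smul, mul_pow, norm_inv, Real.norm_eq_abs, sq_abs, inv_pow]
      ring
    change N (γ ε) = 1
    rw [h1, inv_pow, Real.sq_sqrt hε.le, inv_mul_cancel₀ hε.ne']
  have hmem : ∀ᶠ ε in 𝓝 (0 : ℝ), γ ε ∈ Delta :=
    (tendsto_nhdsWithin_iff.2 ⟨hγ, hsph⟩).eventually hp.2
  have hall : ∀ᶠ ε in 𝓝[>] (0 : ℝ), (γ ε ∈ Delta ∧ 0 < N (w ε)) ∧ 0 < ε :=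
    ((hmem.and hpos).filter_mono nhdsWithin_le_nhds).and self_mem_nhdsWithin
  obtain ⟨ε, ⟨h1, h2⟩, h3⟩ := hall.exists
  exact ⟨ε, _, h3, inv_pos.2 (Real.sqrt_pos.2 h2), h1⟩

theorem DeltaInterior.c_pos (hp : p ∈ DeltaInterior) : 0 < p.c := by
  refine lt_of_le_of_ne hp.1.2.2.2.1 fun h0 => ?_
  obtain ⟨ε, t, hε, ht, hm⟩ := DeltaInterior.exists_smul_mem hp (0, 0, -1, 0, 0)
  have h1 : 0 ≤ t * (p.c + ε * -1) := hm.2.2.2.1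
  rw [← h0] at h1
  nlinarith

theorem DeltaInterior.x_pos (hp : p ∈ DeltaInterior) : 0 < p.x := by
  refine lt_of_le_of_ne hp.1.2.2.2.2.1 fun h0 => ?_
  obtain ⟨ε, t, hε, ht, hm⟩ := DeltaInterior.exists_smul_mem hp (0, 0, 0, 0, -1)
  have h1 : 0 ≤ (t • (p.z + ε • (-1 : ℂ))).re := hm.2.2.2.2.1
  simp only [Complex.smul_re, Complex.add_re, smul_eq_mul, Complex.neg_re, Complex.one_re] at h1
  rw [← show 0 = p.z.re from h0] at h1
  nlinarith

/-- `Φ` is homogeneous of degree six and affine in `x²`, with slope `-(d² (d² - s₁) + 2abcd) < 0`.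
From an interior zero, increasing `x` would reach a point of the region with `Φ < 0`. -/
theorem DeltaInterior.phi_pos (hp : p ∈ DeltaInterior) : 0 < p.Phi := by
  refine lt_of_le_of_ne (Delta.phi_nonneg hp.1) fun h0 => ?_
  have hx := DeltaInterior.x_pos hp
  have hc := DeltaInterior.c_pos hp
  have had := Delta.admissible hp.1
  have hb := hc.trans_le had.hbc
  have ha := hb.trans_le had.hab
  have hd := had.pos
  obtain ⟨ε, t, hε, ht, hm⟩ := DeltaInterior.exists_smul_mem hp (0, 0, 0, 0, 1)
  have h1 := Delta.phi_nonneg hm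
  have e : Point.Phi (t • (p + ε • (0, 0, 0, 0, 1))) = t ^ 6 * (p.Phi - (2 * ε * p.x + ε ^ 2) *
      (p.d ^ 2 * (p.d ^ 2 - (p.a ^ 2 + p.b ^ 2 + p.c ^ 2)) + 2 * p.a * p.b * p.c * p.d)) := by
    simp only [Point.Phi, Point.a, Point.b, Point.c, Point.d, Point.x, Point.y, Point.z,
      Prod.smul_fst, Prod.smul_snd, Prod.fst_add, Prod.snd_add, smul_eq_mul, Complex.sq_norm,
      Complex.normSq_apply, Complex.smul_re, Complex.smul_im, Complex.add_re, Complex.add_im,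
      Complex.one_re, Complex.one_im, mul_zero, add_zero, mul_one]
    ring
  rw [e, ← h0, zero_sub] at h1
  have h2 : 0 < 2 * p.a * p.b * p.c * p.d := by positivity
  have h3 := had.hessian
  have h4 : 0 < t ^ 6 * ((2 * ε * p.x + ε ^ 2) *
      (p.d ^ 2 * (p.d ^ 2 - (p.a ^ 2 + p.b ^ 2 + p.c ^ 2)) + 2 * p.a * p.b * p.c * p.d)) :=
    mul_pos (by positivity) (mul_pos (by positivity) (by linarith))
  linarith

end Interior

end ThreeFermion

end

theorem mainTheorem5 :
    (∀ φ : ThreeFermion.W3, ThreeFermion.Normalized φ →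
      -- every normalized state has a representative in the canonical region
      (∃ p ∈ ThreeFermion.Delta, ThreeFermion.LUEquiv φ p.state) ∧
      (∀ p ∈ ThreeFermion.Delta, ThreeFermion.LUEquiv φ p.state →
        -- it is the only one if `c x Φ(p) > 0`
        (0 < p.c * p.x * p.Phi →
          ∀ q ∈ ThreeFermion.Delta, ThreeFermion.LUEquiv φ q.state → q = p) ∧
        -- otherwise `c x Φ(p) = 0`, and exactly one representative has `y ≥ 0`, with `y = 0` if `c = 0`
        (¬ 0 < p.c * p.x * p.Phi →
          p.c * p.x * p.Phi = 0 ∧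
          ∃! q : ThreeFermion.Point, q ∈ ThreeFermion.Delta ∧ ThreeFermion.LUEquiv φ q.state ∧
            0 ≤ q.y ∧ (q.c = 0 → q.y = 0)))) ∧
    -- the first case holds on the relative interior of the canonical region
    (∀ p ∈ ThreeFermion.DeltaInterior, 0 < p.c * p.x * p.Phi) := by
  refine ⟨fun φ hφ => ⟨ThreeFermion.exists_mem_delta hφ, fun p hp h => ⟨fun hpos q hq h' =>
    ThreeFermion.Delta.eq_of_pos hp h hq h' hpos, fun hpos => ?_⟩⟩, fun p hp =>
    mul_pos (mul_pos (ThreeFermion.DeltaInterior.c_pos hp) (ThreeFermion.DeltaInterior.x_pos hp))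
      (ThreeFermion.DeltaInterior.phi_pos hp)⟩
  have h0 : p.c * p.x * p.Phi = 0 := le_antisymm (not_lt.1 hpos)
    (mul_nonneg (mul_nonneg hp.2.2.2.1 hp.2.2.2.2.1) (ThreeFermion.Delta.phi_nonneg hp))
  obtain ⟨q, h1, h2, h3, h4⟩ := ThreeFermion.Delta.exists_normal hp h h0
  exact ⟨h0, q, ⟨h1, h2, h3, h4⟩, fun q' ⟨k1, k2, k3, k4⟩ =>
    ThreeFermion.Delta.normal_unique h1 h2 k1 k2 h3 k3 h4 k4⟩
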